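/- **Setting.** Fix a number of periods $T$. For units $i=0,1,2,\dots$ and periods $t\in\{1,\dots,T\}$ let $Y_{it}(\mathbf d)\in\mathbb R$ be the potential outcome under a treatment path $\mathbf d\in\mathcal D^T$, $\mathcal D\subseteq\mathbb R^{\dim D}$; let $D_{it}\in\mathcal D$ be the treatment, $\mathbf D_i=(D_{i1},\dots,D_{iT})$, $Y_{it}=Y_{it}(\mathbf D_i)$ the observed outcome and $X_i\in\mathcal X\subseteq\mathbb R^{\dim X}$ the covariates; write $W_i=((Y_{it})_t,\mathbf D_i,X_i)$. An effective treatment function $f$ for period $t$ (a map from $\mathcal D^T$ to a Euclidean space) is *correct* if $f(\mathbf d)=f(\mathbf d')$ implies $Y_{it}(\mathbf d)=Y_{it}(\mathbf d')$ for all $i$; it is *coarser* than $g$ if $f=c\circ g$ for a surjection $c$ from the range of $g$ onto the range of $f$; it is *true* if it is correct and coarser than every correct one. For every $t$ let $E_t$ be a user-specified effective treatment function and $E_t^*$ a true one; put $E_{it}=E_t(\mathbf D_i)$ and $Y_{it}^*(0)=Y_{it}(\mathbf d)$ for any $\mathbf d$ with $E_t^*(\mathbf d)=0$. Let $\mathcal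 A$ be a finite set of triples $(t,s,e)$ with $s<t$ and $e\neq0$ in the range of $E_t$. Put $$M_{i,t,s,e}=\mathbf 1\{E_{it}=e,E_{is}=0\},\quad S_{i,t,s}=\mathbf 1\{E_{it}=0,E_{is}=0\},\quad \Delta Y_{i,t,s}=Y_{it}-Y_{is},$$ $$\mathrm{ATEM}(t,s,e)=\mathbb E[Y_{it}-Y^*_{it}(0)\mid M_{i,t,s,e}=1],\quad m_{t,s}(X_i)=\mathbb E[\Delta Y_{i,t,s}\mid S_{i,t,s}=1,X_i],$$ $$p_{t,s,e}(X_i)=\mathbb P(M_{i,t,s,e}=1\mid M_{i,t,s,e}+S_{i,t,s}=1,X_i).$$ Let $m_{t,s}(x;\gamma)$, $\gamma\in\Gamma_{t,s}$, and $p_{t,s,e}(x;\pi)$, $\pi\in\Pi_{t,s,e}$, be finite-dimensional parametric models with pseudo-true values $\gamma^*_{t,s},\pi^*_{t,s,e}$ and first-step estimators $\hat\gamma_{t,s},\hat\pi_{t,s,e}$ (depending on the sample size $N$). With $r=p/(1-p)$ and $\mathbb E_N[A_i]=N^{-1}\sum_{i\le N}A_i$ (the mean over $N$ units), the doubly robust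 estimator is $$\widehat{\mathrm{ATEM}}(t,s,e)=\mathbb E_N\Big[\Big(\frac{M_{i,t,s,e}}{\mathbb E_N[M_{i,t,s,e}]}-\frac{r_{t,s,e}(X_i;\hat\pi_{t,s,e})S_{i,t,s}}{\mathbb E_N[r_{t,s,e}(X_i;\hat\pi_{t,s,e})S_{i,t,s}]}\Big)\big(\Delta Y_{i,t,s}-m_{t,s}(X_i;\hat\gamma_{t,s})\big)\Big].$$ **Influence function.** Omit the indices $t,s,e$ and let $w_i^M=M_i/\mathbb E[M_i]$, $w_i^S=r(X_i;\pi^*)S_i/\mathbb E[r(X_i;\pi^*)S_i]$, $R_i=\Delta Y_i-m(X_i;\gamma^*)$, and let $\dot m,\dot p$ be the gradients in the parameter, $\dot w_i^S=\dot p(X_i;\pi^*)\,(1-p(X_i;\pi^*))^{-2}S_i/\mathbb E[r(X_i;\pi^*)S_i]$. Define $$\psi_{i}(\theta^*)=w_i^M\big(R_i-\mathbb E[w_i^MR_i]\big)-w_i^S\big(R_i-\mathbb E[w_i^SR_i]\big)-\psi_i^\gamma(\gamma^*)^\top M^1-\psi_i^\pi(\pi^*)^\top M^2,$$ $$M^1=\mathbb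 E[(w_i^M-w_i^S)\,\dot m(X_i;\gamma^*)],\qquad M^2=\mathbb E[\dot w_i^SR_i]-\mathbb E[\dot w_i^S]\,\mathbb E[w_i^SR_i],$$ where $\psi^\gamma,\psi^\pi$ are the influence functions of the first-step estimators in assumption 6. **Assumptions** (2, 4, 6, 7 for each $(t,s,e)\in\mathcal A$). 1. Every $E_t$ has finite range, and $E_t(\mathbf d)=0$ implies $E^*_t(\mathbf d)=0$. 2. Overlap: for some $\varepsilon>0$, $\varepsilon\le\mathbb E[S_{i,t,s}\mid X_i]\le1-\varepsilon$ and $\varepsilon\le p_{t,s,e}(X_i)\le1-\varepsilon$ a.s. 3. Parallel trends: for $t\ge2$, $Y^*_{it}(0)-Y^*_{i,t-1}(0)$ is integrable and $\mathbb E[Y^*_{it}(0)-Y^*_{i,t-1}(0)\mid\mathbf D_i,X_i]=\mathbb E[Y^*_{it}(0)-Y^*_{i,t-1}(0)\mid X_i]$ a.s. 4. Either $\gamma^*_{t,s}$ is the unique $\gamma\in\Gamma_{t,s}$ with $m_{t,s}(X_i)=m_{t,s}(X_i;\gamma)$ a.s., or $\pi^*_{t,s,e}$ is the unique $\pi\in\Pi_{t,s,e}$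 with $p_{t,s,e}(X_i)=p_{t,s,e}(X_i;\pi)$ a.s. 5. The $W_i$ are independent and identically distributed. 6. For $(g,\vartheta,\Theta)$ equal to $(m_{t,s},\gamma_{t,s},\Gamma_{t,s})$ and to $(p_{t,s,e},\pi_{t,s,e},\Pi_{t,s,e})$: $\Theta$ is compact; $g(X_i;\cdot)$ is a.s. continuous on $\Theta$; $\vartheta^*\in\operatorname{int}\Theta$; on a neighbourhood $\Theta^*\subseteq\Theta$ of $\vartheta^*$, $g(X_i;\cdot)$ is a.s. twice continuously differentiable with first and second derivatives bounded by a constant; $\hat\vartheta\to\vartheta^*$ a.s.; and $\sqrt N(\hat\vartheta-\vartheta^*)=N^{-1/2}\sum_{i}\psi^\vartheta_i(\vartheta^*)+o_{\mathbb P}(1)$, the sum being over the $N$ sampled units, where $\psi^\vartheta_i(\vartheta)$ is a function of $W_i$ and $\vartheta$, $\psi_i^\vartheta(\vartheta^*)$ is square integrable with mean zero and positive definite $\mathbb E[\psi^\vartheta_i(\vartheta^*)\psi^\vartheta_i(\vartheta^*)^\top]$, and $\lim_{\delta\to0}\mathbb E[\sup_{\vartheta\in\Theta^*,\|\vartheta-\vartheta^*\|\le\delta}\|\psi^\vartheta_i(\vartheta)-\psi^\vartheta_i(\vartheta^*)\|^2]=0$.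 Moreover, for some $\varepsilon>0$ and all $\pi\in\Pi_{t,s,e}$, $\varepsilon\le p_{t,s,e}(X_i;\pi)\le1-\varepsilon$ a.s. 7. $\mathbb E[\Delta Y_{i,t,s}^2]<\infty$ and $\mathbb E[\psi_{i,t,s,e}(\theta^*_{t,s,e})^2]<\infty$. **Theorem.** As $N\to\infty$, for each $(t,s,e)\in\mathcal A$, $$\sqrt N\big(\widehat{\mathrm{ATEM}}(t,s,e)-\mathrm{ATEM}(t,s,e)\big)=\frac1{\sqrt N}\sum_{i}\psi_{i,t,s,e}(\theta^*_{t,s,e})+o_{\mathbb P}(1),$$ the sum being over the $N$ sampled units. Consequently the vectors stacked over $\mathcal A$ satisfy $$\sqrt N\big(\widehat{\mathrm{ATEM}}_{\mathcal A}-\mathrm{ATEM}_{\mathcal A}\big)\xrightarrow{d}\mathrm{Normal}(0,\Sigma_{\mathcal A}),\qquad\Sigma_{\mathcal A}=\mathbb E[\psi_{i,\mathcal A}(\theta^*)\psi_{i,\mathcal A}(\theta^*)^\top].$$ -/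

import Mathlib

open MeasureTheory ProbabilityTheory Filter Topology
open scoped ENNReal

noncomputable section

/-- Short name for the Euclidean space `ℝᵏ`. -/
abbrev RVec (k : ℕ) : Type := EuclideanSpace ℝ (Fin k)

/-! ### Panel data, potential outcomes and effective treatment -/

/-- A panel with `T` periods (the elements of `Fin T`) and units `i = 0, 1, 2, …`, together with a
user-specified effective treatment function `eff` and a second one, `effStar`, which is meant to be
the true one.  Treatments take values in `𝒟 ⊆ ℝ^dD`, covariates in `𝒳 ⊆ ℝ^dX`.
`Ypot i t d` is the potential outcome of unit `i` in period `t` under the whole treatment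
path `d`. -/
structure PanelSetup (Ω : Type*) [MeasurableSpace Ω] (T dD dX dE dEs : ℕ) where
  𝒟 : Set (RVec dD)
  𝒳 : Set (RVec dX)
  Ypot : ℕ → Fin T → (Fin T → 𝒟) → Ω → ℝ
  D : ℕ → Fin T → Ω → 𝒟
  X : ℕ → Ω → 𝒳
  eff : Fin T → (Fin T → 𝒟) → RVec dE
  effStar : Fin T → (Fin T → 𝒟) → RVec dEs
  measurable_Ypot : ∀ i t d, Measurable (Ypot i t d)
  measurable_D : ∀ i t, Measurable (D i t)
  measurable_X : ∀ i, Measurable (X i)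
  measurable_Y : ∀ i t, Measurable fun ω => Ypot i t (fun r => D i r ω) ω
  measurable_eff : ∀ t, Measurable (eff t)

namespace PanelSetup

variable {Ω : Type*} [MeasurableSpace Ω] {T dD dX dE dEs : ℕ}
variable (S : PanelSetup Ω T dD dX dE dEs)

/-- Treatment paths over all periods. -/
abbrev Path : Type := Fin T → S.𝒟

/-- The observable data of one unit: outcomes, treatments, covariates. -/
abbrev Obs : Type := (Fin T → ℝ) × S.Path × S.𝒳

/-- Realized treatment path of unit `i`. -/
def path (i : ℕ) (ω : Ω) : S.Path := fun r => S.D i r ω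

/-- Observed outcome. -/
def Y (i : ℕ) (t : Fin T) (ω : Ω) : ℝ := S.Ypot i t (S.path i ω) ω

/-- Observed data of unit `i`. -/
def obs (i : ℕ) (ω : Ω) : S.Obs := (fun t => S.Y i t ω, S.path i ω, S.X i ω)

/-- An effective treatment function for period `t` is correct if paths with the same effective
treatment give the same potential outcomes, for every unit. -/
def IsCorrect (t : Fin T) {k : ℕ} (f : S.Path → RVec k) : Prop :=
  ∀ (i : ℕ) (d d' : S.Path), f d = f d' → S.Ypot i t d = S.Ypot i t d'

/-- `f` is coarser than `g`. -/
def IsCoarser {k l : ℕ} (f : S.Path → RVec k) (g : S.Path → RVec l) : Prop :=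
  ∃ c : Set.range g → Set.range f, Function.Surjective c ∧
    ∀ d, f d = (c ⟨g d, Set.mem_range_self d⟩ : RVec k)

/-- `f` is the true effective treatment function for period `t`: it is correct, and coarser than
every correct one. -/
def IsTrue (t : Fin T) {k : ℕ} (f : S.Path → RVec k) : Prop :=
  S.IsCorrect t f ∧ ∀ (l : ℕ) (g : S.Path → RVec l), S.IsCorrect t g → S.IsCoarser f g

open Classical in
/-- `Y*_{it}(e)`: the common value of the potential outcomes over the paths `d` with
`effStar t d = e` (they agree when `effStar t` is correct). -/
def Ystar (i : ℕ) (t : Fin T) (e : RVec dEs) (ω : Ω) : ℝ :=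
  if h : ∃ d, S.effStar t d = e then S.Ypot i t h.choose ω else 0

/-- The realized effective treatment `E_{it}`. -/
def E (i : ℕ) (t : Fin T) (ω : Ω) : RVec dE := S.eff t (S.path i ω)

/-- Mover indicator `M_{i,t,s,e}`. -/
def M (i : ℕ) (t s : Fin T) (e : RVec dE) : Ω → ℝ :=
  Set.indicator {ω | S.E i t ω = e ∧ S.E i s ω = 0} 1

/-- Stayer indicator `S_{i,t,s}`. -/
def St (i : ℕ) (t s : Fin T) : Ω → ℝ :=
  Set.indicator {ω | S.E i t ω = 0 ∧ S.E i s ω = 0} 1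

/-- `ΔY_{i,t,s}`. -/
def dY (i : ℕ) (t s : Fin T) (ω : Ω) : ℝ := S.Y i t ω - S.Y i s ω

/-- The σ-algebra generated by `X_i`. -/
abbrev sigmaX (i : ℕ) : MeasurableSpace Ω := MeasurableSpace.comap (S.X i) inferInstance

/-- The σ-algebra generated by the treatment path and the covariates of unit `i`. -/
abbrev sigmaDX (i : ℕ) : MeasurableSpace Ω :=
  MeasurableSpace.comap (fun ω => (S.path i ω, S.X i ω)) inferInstance

variable (μ : Measure Ω)

/-- `ATEM(t, s, e) = 𝔼[Y_{it} - Y*_{it}(0) | M_{i,t,s,e} = 1]`. -/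
def atem (i : ℕ) (t s : Fin T) (e : RVec dE) : ℝ :=
  ∫ ω, (S.Y i t ω - S.Ystar i t 0 ω) ∂(μ[|{ω | S.M i t s e ω = 1}])

/-- The outcome regression function at `X_i`: `m_{t,s}(X_i) = 𝔼[ΔY_{i,t,s} | S_{i,t,s} = 1, X_i]`,
the conditional expectation given `X_i` under the law conditioned on `S_{i,t,s} = 1`. -/
def orFun (i : ℕ) (t s : Fin T) : Ω → ℝ :=
  (μ[|{ω | S.St i t s ω = 1}])[S.dY i t s | S.sigmaX i]

/-- The generalized propensity score at `X_i`:
`p_{t,s,e}(X_i) = ℙ(M_{i,t,s,e} = 1 | M_{i,t,s,e} + S_{i,t,s} = 1, X_i)`. -/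
def gps (i : ℕ) (t s : Fin T) (e : RVec dE) : Ω → ℝ :=
  (μ[|{ω | S.M i t s e ω + S.St i t s ω = 1}])[S.M i t s e | S.sigmaX i]

/-! ### Assumptions on the population -/

/-- `eff` has finitely many values, and comparison units under `eff` are comparison units under
`effStar`. -/
def EffectiveTreatment : Prop :=
  (∀ t, (Set.range (S.eff t)).Finite) ∧ ∀ t d, S.eff t d = 0 → S.effStar t d = 0

/-- Overlap at `(t, s, e)`. -/
def Overlap (t s : Fin T) (e : RVec dE) : Prop :=
  ∃ ε : ℝ, 0 < ε ∧ ∀ i, ∀ᵐ ω ∂μ,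
    (ε ≤ (μ[S.St i t s | S.sigmaX i]) ω ∧ (μ[S.St i t s | S.sigmaX i]) ω ≤ 1 - ε) ∧
    (ε ≤ S.gps μ i t s e ω ∧ S.gps μ i t s e ω ≤ 1 - ε)

/-- Conditional parallel trends, for each unit and each pair of consecutive periods `r' = r - 1`
and `r`. -/
def ParallelTrends : Prop :=
  ∀ (i : ℕ) (r r' : Fin T), (r' : ℕ) + 1 = (r : ℕ) →
    Integrable (fun ω => S.Ystar i r 0 ω - S.Ystar i r' 0 ω) μ ∧
    μ[fun ω => S.Ystar i r 0 ω - S.Ystar i r' 0 ω | S.sigmaDX i] =ᵐ[μ]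
      μ[fun ω => S.Ystar i r 0 ω - S.Ystar i r' 0 ω | S.sigmaX i]

/-- The observed data are independent and identically distributed across units. -/
def IID : Prop :=
  iIndepFun (fun i => S.obs i) μ ∧ ∀ i j, IdentDistrib (S.obs i) (S.obs j) μ μ

end PanelSetup

/-! ### Parametric first step -/

/-- A parametric first step: a model `g(x; ϑ)` with parameter space `Θ ⊆ ℝ^dim`, the pseudo-true
value `ϑ*`, the estimators `ϑ̂` (indexed by the sample size `N`) and the influence function
`ψ^ϑ(·; ϑ)` of the estimator, as a function of the data of one unit. -/
structure ParametricStep (Ω 𝒳 𝒲 : Type*) where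
  dim : ℕ
  g : 𝒳 → RVec dim → ℝ
  Θ : Set (RVec dim)
  star : RVec dim
  est : ℕ → Ω → RVec dim
  infl : 𝒲 → RVec dim → RVec dim

namespace PanelSetup

variable {Ω : Type*} [MeasurableSpace Ω] {T dD dX dE dEs : ℕ}
variable (S : PanelSetup Ω T dD dX dE dEs) (μ : Measure Ω)

/-- Type of the parametric first steps for data from `S`. -/
abbrev Step : Type _ := ParametricStep Ω S.𝒳 S.Obs

/-- The model `F` is correctly specified for the function whose value at `X_i` is `h i`: the
pseudo-true value is the unique parameter at which the model reproduces that function. -/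
def CorrectModel (F : S.Step) (h : ℕ → Ω → ℝ) : Prop :=
  F.star ∈ F.Θ ∧ (∀ i, h i =ᵐ[μ] fun ω => F.g (S.X i ω) F.star) ∧
    ∀ ϑ ∈ F.Θ, (∀ i, h i =ᵐ[μ] fun ω => F.g (S.X i ω) ϑ) → ϑ = F.star

/-- Regularity of a first step: measurability; (i) compact parameter space; (ii) continuity of the
model; (iii) interior pseudo-true value; (iv) two continuous, bounded derivatives of the model in a
neighbourhood `U` of it; (v) strong consistency and asymptotic linearity of the
estimator, with a centred, square integrable, nondegenerate influence function that is mean square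
continuous at the pseudo-true value. -/
def RegularStep (F : S.Step) : Prop :=
  (Measurable (Function.uncurry F.g) ∧ (∀ N, Measurable (F.est N)) ∧
    ∀ ϑ ∈ F.Θ, Measurable fun w => F.infl w ϑ) ∧
  IsCompact F.Θ ∧
  (∀ i, ∀ᵐ ω ∂μ, ContinuousOn (F.g (S.X i ω)) F.Θ) ∧
  F.star ∈ interior F.Θ ∧
  (∃ U : Set (RVec F.dim), IsOpen U ∧ F.star ∈ U ∧ U ⊆ F.Θ ∧
    (∃ C : ℝ, ∀ i, ∀ᵐ ω ∂μ, ContDiffOn ℝ 2 (F.g (S.X i ω)) U ∧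
      ∀ ϑ ∈ U, ‖fderiv ℝ (F.g (S.X i ω)) ϑ‖ ≤ C ∧
        ‖iteratedFDeriv ℝ 2 (F.g (S.X i ω)) ϑ‖ ≤ C) ∧
    ∀ i, Tendsto
      (fun δ : ℝ => ∫⁻ ω, ⨆ ϑ ∈ {ϑ ∈ U | ‖ϑ - F.star‖ ≤ δ},
        ENNReal.ofReal (‖F.infl (S.obs i ω) ϑ - F.infl (S.obs i ω) F.star‖ ^ 2) ∂μ)
      (𝓝[>] 0) (𝓝 0)) ∧
  (∀ᵐ ω ∂μ, Tendsto (fun N => F.est N ω) atTop (𝓝 F.star)) ∧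
  TendstoInMeasure μ
    (fun (N : ℕ) ω => √(N : ℝ) • (F.est N ω - F.star) -
      (√(N : ℝ))⁻¹ • ∑ i ∈ Finset.range N, F.infl (S.obs i ω) F.star)
    atTop (fun _ => 0) ∧
  ∀ i, MemLp (fun ω => F.infl (S.obs i ω) F.star) 2 μ ∧
    ∫ ω, F.infl (S.obs i ω) F.star ∂μ = 0 ∧
    (Matrix.of fun a b : Fin F.dim =>
      ∫ ω, F.infl (S.obs i ω) F.star a * F.infl (S.obs i ω) F.star b ∂μ).PosDef

/-- The propensity score model is bounded away from `0` and `1`. -/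
def BoundedScore (G : S.Step) : Prop :=
  ∃ ε : ℝ, 0 < ε ∧ ∀ π ∈ G.Θ, ∀ i, ∀ᵐ ω ∂μ, ε ≤ G.g (S.X i ω) π ∧ G.g (S.X i ω) π ≤ 1 - ε

/-! ### The two-step estimator -/

/-- The sample mean `𝔼_N` over the first `N` units. -/
def sampleMean (N : ℕ) (A : ℕ → ℝ) : ℝ := (N : ℝ)⁻¹ * ∑ i ∈ Finset.range N, A i

/-- The ratio `r(x; π) = p(x; π) / (1 - p(x; π))`. -/
def ratio (G : S.Step) (x : S.𝒳) (π : RVec G.dim) : ℝ := G.g x π / (1 - G.g x π)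

/-- The doubly robust estimator of `ATEM(t, s, e)` from the first `N` units; `F` is the first step
for the outcome regression and `G` the one for the propensity score. -/
def atemHat (F G : S.Step) (t s : Fin T) (e : RVec dE) (N : ℕ) (ω : Ω) : ℝ :=
  sampleMean N fun i =>
    (S.M i t s e ω / sampleMean N (fun j => S.M j t s e ω) -
      S.ratio G (S.X i ω) (G.est N ω) * S.St i t s ω /
        sampleMean N (fun j => S.ratio G (S.X j ω) (G.est N ω) * S.St j t s ω)) *
    (S.dY i t s ω - F.g (S.X i ω) (F.est N ω))

/-! ### The influence function -/

/-- The weight `w^M_{i,t,s,e}`. -/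
def wM (i : ℕ) (t s : Fin T) (e : RVec dE) (ω : Ω) : ℝ :=
  S.M i t s e ω / ∫ ω', S.M i t s e ω' ∂μ

/-- The weight `w^S_{i,t,s,e}(π)`. -/
def wS (G : S.Step) (i : ℕ) (t s : Fin T) (π : RVec G.dim) (ω : Ω) : ℝ :=
  S.ratio G (S.X i ω) π * S.St i t s ω / ∫ ω', S.ratio G (S.X i ω') π * S.St i t s ω' ∂μ

/-- The gradient `ṙ(x; π) = ṗ(x; π) / (1 - p(x; π))²`. -/
def ratioDot (G : S.Step) (x : S.𝒳) (π : RVec G.dim) : RVec G.dim :=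
  ((1 - G.g x π) ^ 2)⁻¹ • gradient (G.g x) π

/-- The vector `ẇ^S_{i,t,s,e}(π)`. -/
def wSDot (G : S.Step) (i : ℕ) (t s : Fin T) (π : RVec G.dim) (ω : Ω) : RVec G.dim :=
  (S.St i t s ω / ∫ ω', S.ratio G (S.X i ω') π * S.St i t s ω' ∂μ) • S.ratioDot G (S.X i ω) π

/-- The residual `ΔY_{i,t,s} - m_{t,s}(X_i; γ)`. -/
def resid (F : S.Step) (i : ℕ) (t s : Fin T) (γ : RVec F.dim) (ω : Ω) : ℝ :=
  S.dY i t s ω - F.g (S.X i ω) γ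

/-- `ψ^M_{i,t,s,e}(γ)`. -/
def psiM (F : S.Step) (i : ℕ) (t s : Fin T) (e : RVec dE) (γ : RVec F.dim) (ω : Ω) : ℝ :=
  S.wM μ i t s e ω * S.resid F i t s γ ω -
    S.wM μ i t s e ω * ∫ ω', S.wM μ i t s e ω' * S.resid F i t s γ ω' ∂μ

/-- `ψ^S_{i,t,s,e}(γ, π)`. -/
def psiS (F G : S.Step) (i : ℕ) (t s : Fin T) (γ : RVec F.dim) (π : RVec G.dim) (ω : Ω) : ℝ :=
  S.wS μ G i t s π ω * S.resid F i t s γ ω -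
    S.wS μ G i t s π ω * ∫ ω', S.wS μ G i t s π ω' * S.resid F i t s γ ω' ∂μ

/-- The vector `M¹_{t,s,e}(γ, π)`. -/
def M1 (F G : S.Step) (i : ℕ) (t s : Fin T) (e : RVec dE) (γ : RVec F.dim) (π : RVec G.dim) :
    RVec F.dim :=
  ∫ ω, (S.wM μ i t s e ω - S.wS μ G i t s π ω) • gradient (F.g (S.X i ω)) γ ∂μ

/-- The vector `M²_{t,s,e}(γ, π)`. -/
def M2 (F G : S.Step) (i : ℕ) (t s : Fin T) (γ : RVec F.dim) (π : RVec G.dim) : RVec G.dim :=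
  (∫ ω, S.resid F i t s γ ω • S.wSDot μ G i t s π ω ∂μ) -
    (∫ ω, S.wS μ G i t s π ω * S.resid F i t s γ ω ∂μ) • ∫ ω, S.wSDot μ G i t s π ω ∂μ

/-- `ψ^est_{i,t,s,e}(γ, π)`: the contribution of the first-step estimation. -/
def psiEst (F G : S.Step) (i : ℕ) (t s : Fin T) (e : RVec dE) (γ : RVec F.dim) (π : RVec G.dim)
    (ω : Ω) : ℝ :=
  inner ℝ (F.infl (S.obs i ω) γ) (S.M1 μ F G i t s e γ π) +
    inner ℝ (G.infl (S.obs i ω) π) (S.M2 μ F G i t s γ π)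

/-- The influence function `ψ_{i,t,s,e}(γ, π)`. -/
def psi (F G : S.Step) (i : ℕ) (t s : Fin T) (e : RVec dE) (γ : RVec F.dim) (π : RVec G.dim)
    (ω : Ω) : ℝ :=
  S.psiM μ F i t s e γ ω - S.psiS μ F G i t s γ π ω - S.psiEst μ F G i t s e γ π ω

/-- `ψ_{i,t,s,e}(θ*)`, at the pseudo-true values. -/
def psiStar (F G : S.Step) (i : ℕ) (t s : Fin T) (e : RVec dE) (ω : Ω) : ℝ :=
  S.psi μ F G i t s e F.star G.star ω

end PanelSetup

end

/-! The estimator is a difference of two quotients, A₁/A₂ - A₃/A₄, of the sample means of M(ΔY -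
m̂), M, r̂S(ΔY - m̂) and r̂S (`atemHat_eq`). Three things have to be shown: the population
counterpart of this expression is the ATEM, each of the four means is asymptotically linear, and the
resulting influence function is ψ.

Identification (`atem_eq_doublyRobust`). Let m₀ be the conditional mean given X of the untreated
trend, and h = m₀ - m(X; γ*). Movers and stayers are both untreated in period s, so parallel trends
give ATEM = E[M(ΔY - m₀)]/E[M] and E[rS(ΔY - m₀)] = 0. The estimand therefore differs from the ATEM
by E[Mh]/E[M] - E[rSh]/E[rS]. If the outcome model is correct, h = 0 (`orFun_ae_eq`); if the score
is correct, weighting stayers by r reproduces movers for every function of X, so both numerators and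
both denominators agree (`integral_M_mul_eq`).

Linearization (`asympLinear_meanSum_of_taylor`, `asympLinear_twoStep`). Each mean is expanded to
first order in the estimation errors δ of the first steps, with a remainder at most K‖δ‖², K
integrable. Since √N δ is bounded in probability and δ → 0, the remainder vanishes after scaling by
√N; the law of large numbers replaces the averaged gradient by its expectation, and √N δ is replaced
by its influence sum. The delta method (`AsympLinear.div`) handles the quotients, and `psiStar_eq`
is the algebra that identifies the outcome with ψ.

Convergence in probability is expressed as convergence along the filter `whp` on ℕ × Ω, so limits
can be added, multiplied, inverted and squeezed as ordinary limits along a filter.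

Joint normality follows from the central limit theorem for the stacked ψ, reduced to dimension one
through characteristic functions, together with Slutsky's theorem. -/

noncomputable section

/-! ### Normalized sums and sample means -/

section Sums

variable {Ω : Type*}

/-- The normalized sum `N^{-1/2} ∑ φ_i`. -/
def normSum {E : Type*} [AddCommGroup E] [Module ℝ E] (φ : ℕ → Ω → E) (p : ℕ × Ω) : E :=
  (√(p.1 : ℝ))⁻¹ • ∑ i ∈ Finset.range p.1, φ i p.2

/-- The sample mean `N⁻¹ ∑ φ_i`. -/
def meanSum {E : Type*} [AddCommGroup E] [Module ℝ E] (φ : ℕ → Ω → E) (p : ℕ × Ω) : E :=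
  (p.1 : ℝ)⁻¹ • ∑ i ∈ Finset.range p.1, φ i p.2

section Algebra
variable {E : Type*} [AddCommGroup E] [Module ℝ E]

lemma normSum_add (φ χ : ℕ → Ω → E) (p : ℕ × Ω) :
    normSum (fun i ω => φ i ω + χ i ω) p = normSum φ p + normSum χ p := by
  simp [normSum, Finset.sum_add_distrib]

lemma normSum_sub (φ χ : ℕ → Ω → E) (p : ℕ × Ω) :
    normSum (fun i ω => φ i ω - χ i ω) p = normSum φ p - normSum χ p := by
  simp [normSum, Finset.sum_sub_distrib, smul_sub]

lemma normSum_const_mul (c : ℝ) (φ : ℕ → Ω → ℝ) (p : ℕ × Ω) :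
    normSum (fun i ω => c * φ i ω) p = c * normSum φ p := by
  simp only [normSum, ← Finset.mul_sum, smul_eq_mul]
  ring

lemma normSum_eq_sqrt_smul_meanSum (φ : ℕ → Ω → E) (p : ℕ × Ω) :
    normSum φ p = √(p.1 : ℝ) • meanSum φ p := by
  rw [normSum, meanSum, smul_smul]
  congr 1
  rcases Nat.eq_zero_or_pos p.1 with h | h
  · simp [h]
  · have h' : (0 : ℝ) < p.1 := by exact_mod_cast h
    have := Real.mul_self_sqrt h'.le
    field_simp
    nlinarith

lemma meanSum_const (c : E) {p : ℕ × Ω} (hp : 0 < p.1) : meanSum (fun _ _ => c) p = c := by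
  have h' : (p.1 : ℝ) ≠ 0 := by exact_mod_cast hp.ne'
  simp only [meanSum, Finset.sum_const, Finset.card_range, ← Nat.cast_smul_eq_nsmul ℝ, smul_smul]
  rw [inv_mul_cancel₀ h', one_smul]

end Algebra

lemma inner_meanSum {E : Type*} [NormedAddCommGroup E] [InnerProductSpace ℝ E]
    (D : ℕ → Ω → E) (v : E) (p : ℕ × Ω) :
    inner ℝ (meanSum D p) v = (p.1 : ℝ)⁻¹ * ∑ i ∈ Finset.range p.1, inner ℝ (D i p.2) v := by
  simp [meanSum, real_inner_smul_left, sum_inner]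

lemma inner_normSum {E : Type*} [NormedAddCommGroup E] [InnerProductSpace ℝ E]
    (ψ : ℕ → Ω → E) (v : E) (p : ℕ × Ω) :
    inner ℝ v (normSum ψ p) = normSum (fun i ω => inner ℝ v (ψ i ω)) p := by
  simp [normSum, real_inner_smul_right, inner_sum]

end Sums

/-! ### Stochastic order calculus -/

/-- The filter on `ℕ × Ω` of the events whose `N`-th section has probability tending to one:
convergence in probability to a constant is convergence along this filter. -/
def whp {Ω : Type*} [MeasurableSpace Ω] (μ : Measure Ω) : Filter (ℕ × Ω) where
  sets := {s | Tendsto (fun N => μ {ω | (N, ω) ∉ s}) atTop (𝓝 0)}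
  univ_sets := by simp
  sets_of_superset := by
    intro s t hs hst
    refine tendsto_of_tendsto_of_tendsto_of_le_of_le tendsto_const_nhds hs (fun _ => zero_le) ?_
    intro N
    exact measure_mono fun ω h hs => h (hst hs)
  inter_sets := by
    intro s t hs ht
    have h := Tendsto.add hs ht
    rw [add_zero] at h
    refine tendsto_of_tendsto_of_tendsto_of_le_of_le tendsto_const_nhds h (fun _ => zero_le) ?_
    intro N
    refine (measure_mono fun ω h => ?_).trans (measure_union_le _ _)
    simpa [Set.mem_inter_iff, not_and_or, imp_iff_not_or] using h

section Calculus

variable {Ω : Type*} [MeasurableSpace Ω] {μ : Measure Ω}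

lemma eventually_whp_iff {P : ℕ × Ω → Prop} :
    (∀ᶠ p in whp μ, P p) ↔ Tendsto (fun N => μ {ω | ¬ P (N, ω)}) atTop (𝓝 0) := Iff.rfl

lemma eventually_whp_of_ae {P : ℕ × Ω → Prop} (h : ∀ᶠ N in atTop, ∀ᵐ ω ∂μ, P (N, ω)) :
    ∀ᶠ p in whp μ, P p := by
  rw [eventually_whp_iff]
  refine tendsto_const_nhds.congr' ?_
  filter_upwards [h] with N hN
  exact (ae_iff.1 hN).symm

lemma eventually_whp_snd {Q : Ω → Prop} (h : ∀ᵐ ω ∂μ, Q ω) :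
    ∀ᶠ p : ℕ × Ω in whp μ, Q p.2 :=
  eventually_whp_of_ae (P := fun p => Q p.2) (Eventually.of_forall fun _ => h)

lemma tendsto_fst_whp : Tendsto (Prod.fst : ℕ × Ω → ℕ) (whp μ) atTop := by
  refine tendsto_atTop.2 fun n => eventually_whp_of_ae ?_
  filter_upwards [eventually_ge_atTop n] with N hN
  exact ae_of_all _ fun _ => hN

lemma tendsto_whp_iff {E : Type*} [PseudoMetricSpace E] {X : ℕ → Ω → E} {c : E} :
    Tendsto (fun p : ℕ × Ω => X p.1 p.2) (whp μ) (𝓝 c) ↔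
      TendstoInMeasure μ X atTop (fun _ => c) := by
  rw [tendstoInMeasure_iff_dist, Metric.tendsto_nhds]
  refine forall₂_congr fun ε _ => ?_
  rw [eventually_whp_iff]
  simp

/-- A sequence is bounded in probability. -/
def BoundedInProb {E : Type*} [Norm E] (μ : Measure Ω) (X : ℕ × Ω → E) : Prop :=
  ∀ ε : ℝ≥0∞, 0 < ε → ∃ K : ℝ, ∀ᶠ N in atTop, μ {ω | K < ‖X (N, ω)‖} ≤ ε

lemma BoundedInProb.norm {E : Type*} [SeminormedAddCommGroup E] {X : ℕ × Ω → E}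
    (h : BoundedInProb μ X) : BoundedInProb μ (fun p => ‖X p‖) := by
  intro ε hε
  obtain ⟨K, hK⟩ := h ε hε
  exact ⟨K, by simpa using hK⟩

lemma BoundedInProb.of_norm_le {E E' : Type*} [Norm E] [Norm E'] {X : ℕ × Ω → E}
    {Y : ℕ × Ω → E'} (h : BoundedInProb μ X) (hle : ∀ p, ‖Y p‖ ≤ ‖X p‖) :
    BoundedInProb μ Y := by
  intro ε hε
  obtain ⟨K, hK⟩ := h ε hε
  refine ⟨K, hK.mono fun N hN => (measure_mono fun ω hω => ?_).trans hN⟩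
  exact lt_of_lt_of_le hω (hle _)

lemma BoundedInProb.add {E : Type*} [SeminormedAddCommGroup E] {X Y : ℕ × Ω → E}
    (hX : BoundedInProb μ X) (hY : BoundedInProb μ Y) : BoundedInProb μ (fun p => X p + Y p) := by
  intro ε hε
  have hε2 : 0 < ε / 2 := ENNReal.half_pos hε.ne'
  obtain ⟨K, hK⟩ := hX _ hε2
  obtain ⟨L, hL⟩ := hY _ hε2
  refine ⟨K + L, ?_⟩
  filter_upwards [hK, hL] with N h1 h2
  calc μ {ω | K + L < ‖X (N, ω) + Y (N, ω)‖}
      ≤ μ ({ω | K < ‖X (N, ω)‖} ∪ {ω | L < ‖Y (N, ω)‖}) := by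
        refine measure_mono fun ω hω => ?_
        by_contra hcon
        simp only [Set.mem_union, Set.mem_ofPred_eq, not_or, not_lt] at hcon hω
        linarith [norm_add_le (X (N, ω)) (Y (N, ω))]
    _ ≤ _ := measure_union_le _ _
    _ ≤ ε / 2 + ε / 2 := add_le_add h1 h2
    _ = ε := ENNReal.add_halves ε

lemma BoundedInProb.const_smul {E : Type*} [SeminormedAddCommGroup E] [NormedSpace ℝ E]
    {X : ℕ × Ω → E} (hX : BoundedInProb μ X) (c : ℝ) : BoundedInProb μ (fun p => c • X p) := by
  intro ε hε
  obtain ⟨K, hK⟩ := hX ε hε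
  refine ⟨|c| * K, hK.mono fun N hN => (measure_mono fun ω hω => ?_).trans hN⟩
  simp only [Set.mem_ofPred_eq, norm_smul, Real.norm_eq_abs] at hω ⊢
  exact lt_of_mul_lt_mul_left hω (abs_nonneg c)

lemma BoundedInProb.of_tendsto {E : Type*} [SeminormedAddCommGroup E] {X : ℕ × Ω → E} {c : E}
    (hX : Tendsto X (whp μ) (𝓝 c)) : BoundedInProb μ X := by
  intro ε hε
  refine ⟨‖c‖ + 1, ?_⟩
  have h : ∀ᶠ p in whp μ, ‖X p‖ < ‖c‖ + 1 := hX.norm.eventually_lt_const (by linarith)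
  have h' := (eventually_whp_iff.1 h).eventually_le_const hε
  filter_upwards [h'] with N hN
  refine (measure_mono fun ω hω => ?_).trans hN
  simpa using le_of_lt (show ‖c‖ + 1 < _ from hω)

lemma BoundedInProb.mul_tendsto_zero {X Y : ℕ × Ω → ℝ}
    (hX : BoundedInProb μ X) (hY : Tendsto Y (whp μ) (𝓝 0)) :
    Tendsto (fun p => X p * Y p) (whp μ) (𝓝 0) := by
  rw [Metric.tendsto_nhds]
  intro η hη
  rw [eventually_whp_iff, ENNReal.tendsto_nhds_zero]
  intro ε hε
  have hε2 : 0 < ε / 2 := ENNReal.half_pos hε.ne'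
  obtain ⟨K, hK⟩ := hX _ hε2
  have hY' : ∀ᶠ p in whp μ, ‖Y p‖ < η / (|K| + 1) := by
    have : Tendsto (fun p => ‖Y p‖) (whp μ) (𝓝 0) := by simpa using hY.norm
    exact this.eventually_lt_const (by positivity)
  have hY'' := (eventually_whp_iff.1 hY').eventually_le_const hε2
  filter_upwards [hK, hY''] with N h1 h2
  refine le_trans (measure_mono fun ω hω => ?_) <| (measure_union_le _ _).trans <|
    (add_le_add h1 h2).trans_eq (ENNReal.add_halves ε)
  by_contra hcon
  simp only [Set.mem_union, Set.mem_ofPred_eq, not_or, not_lt, not_le, dist_zero_right] at hcon hω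
  obtain ⟨hc1, hc2⟩ := hcon
  have hpos : 0 < |K| + 1 := by positivity
  have : ‖X (N, ω) * Y (N, ω)‖ < η := by
    rw [norm_mul]
    calc ‖X (N, ω)‖ * ‖Y (N, ω)‖ ≤ (|K| + 1) * ‖Y (N, ω)‖ := by
          gcongr
          linarith [le_abs_self K]
      _ < (|K| + 1) * (η / (|K| + 1)) := by gcongr
      _ = η := by field_simp
  exact absurd this (not_lt.2 hω)

/-- Slutsky's rule in the form used for quotients: a factor may be replaced by its limit in
probability when the other factor is only bounded, not convergent. -/
lemma BoundedInProb.mul_tendsto {X Y : ℕ × Ω → ℝ} {c : ℝ}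
    (hX : BoundedInProb μ X) (hY : Tendsto Y (whp μ) (𝓝 c)) :
    Tendsto (fun p => X p * Y p - c * X p) (whp μ) (𝓝 0) := by
  have := hX.mul_tendsto_zero (Y := fun p => Y p - c) (by simpa using hY.sub_const c)
  refine this.congr fun p => ?_
  ring

lemma boundedInProb_finsetSum {ι : Type*} (s : Finset ι) {E : Type*} [SeminormedAddCommGroup E]
    {X : ι → ℕ × Ω → E} (h : ∀ k ∈ s, BoundedInProb μ (X k)) :
    BoundedInProb μ (fun p => ∑ k ∈ s, X k p) := by
  classical
  induction s using Finset.induction_on with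
  | empty =>
    intro ε hε
    exact ⟨0, by simp⟩
  | insert a s ha ih =>
    simp only [Finset.sum_insert ha]
    exact (h a (by simp)).add (ih fun k hk => h k (by simp [hk]))

/-- Inner products of a null sequence with a sequence bounded in probability vanish. -/
lemma BoundedInProb.inner_tendsto_zero {E : Type*} [NormedAddCommGroup E] [InnerProductSpace ℝ E]
    {X Y : ℕ × Ω → E} (hX : BoundedInProb μ X) (hY : Tendsto Y (whp μ) (𝓝 0)) :
    Tendsto (fun p => inner ℝ (Y p) (X p)) (whp μ) (𝓝 0) := by
  refine squeeze_zero_norm (fun p => norm_inner_le_norm _ _) ?_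
  have := hX.norm.mul_tendsto_zero (Y := fun p => ‖Y p‖) (by simpa using hY.norm)
  exact this.congr fun p => mul_comm _ _

/-- Asymptotic linearity: `√N (A_N - a) = N^{-1/2} ∑ φ_i + o_P(1)`. -/
def AsympLinear (μ : Measure Ω) (A : ℕ × Ω → ℝ) (a : ℝ) (φ : ℕ → Ω → ℝ) : Prop :=
  Tendsto (fun p : ℕ × Ω => √(p.1 : ℝ) * (A p - a) - normSum φ p) (whp μ) (𝓝 0)

lemma AsympLinear.sub {A B : ℕ × Ω → ℝ} {a b : ℝ} {φ χ : ℕ → Ω → ℝ}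
    (hA : AsympLinear μ A a φ) (hB : AsympLinear μ B b χ) :
    AsympLinear μ (fun p => A p - B p) (a - b) (fun i ω => φ i ω - χ i ω) := by
  have := Tendsto.sub hA hB
  rw [sub_zero] at this
  refine this.congr fun p => ?_
  rw [normSum_sub]
  ring

lemma AsympLinear.const_mul {A : ℕ × Ω → ℝ} {a : ℝ} {φ : ℕ → Ω → ℝ}
    (hA : AsympLinear μ A a φ) (c : ℝ) :
    AsympLinear μ (fun p => c * A p) (c * a) (fun i ω => c * φ i ω) := by
  have := Tendsto.const_mul c hA
  rw [mul_zero] at this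
  refine this.congr fun p => ?_
  rw [normSum_const_mul]
  ring

lemma AsympLinear.congr_influence {A : ℕ × Ω → ℝ} {a : ℝ} {φ χ : ℕ → Ω → ℝ}
    (hA : AsympLinear μ A a φ) (h : ∀ i, φ i = χ i) : AsympLinear μ A a χ := by
  rwa [show χ = φ from funext fun i => (h i).symm]

lemma tendsto_inv_sqrt_whp : Tendsto (fun p : ℕ × Ω => (√(p.1 : ℝ))⁻¹) (whp μ) (𝓝 0) :=
  ((tendsto_inv_atTop_zero.comp Real.tendsto_sqrt_atTop).comp
    tendsto_natCast_atTop_atTop).comp tendsto_fst_whp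

lemma AsympLinear.boundedInProb {A : ℕ × Ω → ℝ} {a : ℝ} {φ : ℕ → Ω → ℝ}
    (hA : AsympLinear μ A a φ) (hφ : BoundedInProb μ (normSum φ)) :
    BoundedInProb μ (fun p : ℕ × Ω => √(p.1 : ℝ) * (A p - a)) := by
  simpa using (BoundedInProb.of_tendsto hA).add hφ

lemma AsympLinear.tendsto {A : ℕ × Ω → ℝ} {a : ℝ} {φ : ℕ → Ω → ℝ}
    (hA : AsympLinear μ A a φ) (hφ : BoundedInProb μ (normSum φ)) :
    Tendsto A (whp μ) (𝓝 a) := by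
  have h := (hA.boundedInProb hφ).mul_tendsto_zero tendsto_inv_sqrt_whp
  rw [← tendsto_sub_nhds_zero_iff]
  refine h.congr' ?_
  filter_upwards [tendsto_fst_whp.eventually (eventually_gt_atTop 0)] with p hp
  have : 0 < √(p.1 : ℝ) := Real.sqrt_pos.2 (by exact_mod_cast hp)
  field_simp

/-- The delta method for a quotient. -/
lemma AsympLinear.div {A B : ℕ × Ω → ℝ} {a b : ℝ} {φ χ : ℕ → Ω → ℝ}
    (hA : AsympLinear μ A a φ) (hB : AsympLinear μ B b χ) (hb : b ≠ 0)
    (hφ : BoundedInProb μ (normSum φ)) (hχ : BoundedInProb μ (normSum χ)) :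
    AsympLinear μ (fun p => A p / B p) (a / b) (fun i ω => b⁻¹ * (φ i ω - a / b * χ i ω)) := by
  have hBt := hB.tendsto hχ
  -- A/B - a/b = (A - (a/b) B)/B. The numerator is asymptotically linear around a - (a/b) b = 0, and
  -- 1/B may be replaced by 1/b.
  have hlin := hA.sub (hB.const_mul (a / b))
  have hbdd : BoundedInProb μ (normSum fun i ω => φ i ω - a / b * χ i ω) := by
    have := hφ.add (hχ.const_smul (-(a / b)))
    refine this.of_norm_le fun p => le_of_eq ?_
    rw [normSum_sub, normSum_const_mul]
    congr 1
    simp only [smul_eq_mul]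
    ring
  have h1 := (hlin.boundedInProb hbdd).mul_tendsto (hBt.inv₀ hb)
  have h2 := Tendsto.const_mul b⁻¹ hlin
  have h3 := h1.add h2
  rw [mul_zero, add_zero] at h3
  refine h3.congr' ?_
  filter_upwards [hBt.eventually_ne hb] with p hp
  rw [normSum_const_mul]
  field_simp
  ring

/-- Expansion of a sample mean that depends on estimated parameters, with a remainder quadratic in
the estimation errors `δ₁, δ₂`. -/
lemma asympLinear_meanSum_of_taylor {E₁ E₂ : Type*}
    [NormedAddCommGroup E₁] [InnerProductSpace ℝ E₁]
    [NormedAddCommGroup E₂] [InnerProductSpace ℝ E₂]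
    {h : ℕ → ℕ × Ω → ℝ} {h₀ K : ℕ → Ω → ℝ} {D₁ ψ₁ : ℕ → Ω → E₁} {D₂ ψ₂ : ℕ → Ω → E₂}
    {δ₁ : ℕ × Ω → E₁} {δ₂ : ℕ × Ω → E₂} {d₁ : E₁} {d₂ : E₂} {k : ℝ} (a : ℝ)
    (hrem : ∀ᶠ p in whp μ, ∀ i, |h i p - h₀ i p.2 - inner ℝ (D₁ i p.2) (δ₁ p) -
      inner ℝ (D₂ i p.2) (δ₂ p)| ≤ K i p.2 * (‖δ₁ p‖ ^ 2 + ‖δ₂ p‖ ^ 2))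
    (hD₁ : Tendsto (meanSum D₁) (whp μ) (𝓝 d₁)) (hD₂ : Tendsto (meanSum D₂) (whp μ) (𝓝 d₂))
    (hK : Tendsto (meanSum K) (whp μ) (𝓝 k))
    (hδ₁ : Tendsto δ₁ (whp μ) (𝓝 0)) (hδ₂ : Tendsto δ₂ (whp μ) (𝓝 0))
    (hlin₁ : Tendsto (fun p : ℕ × Ω => √(p.1 : ℝ) • δ₁ p - normSum ψ₁ p) (whp μ) (𝓝 0))
    (hlin₂ : Tendsto (fun p : ℕ × Ω => √(p.1 : ℝ) • δ₂ p - normSum ψ₂ p) (whp μ) (𝓝 0))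
    (hψ₁ : BoundedInProb μ (normSum ψ₁)) (hψ₂ : BoundedInProb μ (normSum ψ₂)) :
    AsympLinear μ (fun p : ℕ × Ω => (p.1 : ℝ)⁻¹ * ∑ i ∈ Finset.range p.1, h i p) a
      (fun i ω => h₀ i ω - a + inner ℝ d₁ (ψ₁ i ω) + inner ℝ d₂ (ψ₂ i ω)) := by
  have hb₁ : BoundedInProb μ (fun p : ℕ × Ω => √(p.1 : ℝ) • δ₁ p) := by
    simpa using (BoundedInProb.of_tendsto hlin₁).add hψ₁
  have hb₂ : BoundedInProb μ (fun p : ℕ × Ω => √(p.1 : ℝ) • δ₂ p) := by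
    simpa using (BoundedInProb.of_tendsto hlin₂).add hψ₂
  -- Since √N δ is bounded in probability, the averaged gradients can be replaced by their limits
  -- d₁, d₂.
  have t₁ := hb₁.inner_tendsto_zero (tendsto_sub_nhds_zero_iff.2 hD₁)
  have t₂ := hb₂.inner_tendsto_zero (tendsto_sub_nhds_zero_iff.2 hD₂)
  -- With the gradients fixed, √N δ can be replaced by the influence sums of the first steps.
  have u₁ : Tendsto (fun p => inner ℝ d₁ (√(p.1 : ℝ) • δ₁ p - normSum ψ₁ p)) (whp μ) (𝓝 0) := by
    simpa using (tendsto_const_nhds (x := d₁)).inner (𝕜 := ℝ) hlin₁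
  have u₂ : Tendsto (fun p => inner ℝ d₂ (√(p.1 : ℝ) • δ₂ p - normSum ψ₂ p)) (whp μ) (𝓝 0) := by
    simpa using (tendsto_const_nhds (x := d₂)).inner (𝕜 := ℝ) hlin₂
  -- The scaled quadratic remainder: √N ‖δ‖² = ‖√N δ‖ ‖δ‖ is a bounded factor times a null factor.
  have q₁ := hb₁.norm.mul_tendsto_zero (Y := fun p => ‖δ₁ p‖) (by simpa using hδ₁.norm)
  have q₂ := hb₂.norm.mul_tendsto_zero (Y := fun p => ‖δ₂ p‖) (by simpa using hδ₂.norm)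
  have q := hK.mul (q₁.add q₂)
  rw [add_zero, mul_zero] at q
  have hR : Tendsto (fun p : ℕ × Ω => √(p.1 : ℝ) * ((p.1 : ℝ)⁻¹ * ∑ i ∈ Finset.range p.1,
      (h i p - h₀ i p.2 - inner ℝ (D₁ i p.2) (δ₁ p) - inner ℝ (D₂ i p.2) (δ₂ p))))
      (whp μ) (𝓝 0) := by
    refine squeeze_zero_norm' ?_ q
    filter_upwards [hrem] with p hp
    have hs : 0 ≤ √(p.1 : ℝ) := Real.sqrt_nonneg _
    have hn : (0 : ℝ) ≤ (p.1 : ℝ)⁻¹ := by positivity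
    rw [norm_mul, norm_mul, Real.norm_of_nonneg hs, Real.norm_of_nonneg hn]
    calc √(p.1 : ℝ) * ((p.1 : ℝ)⁻¹ * ‖∑ i ∈ Finset.range p.1,
          (h i p - h₀ i p.2 - inner ℝ (D₁ i p.2) (δ₁ p) - inner ℝ (D₂ i p.2) (δ₂ p))‖)
        ≤ √(p.1 : ℝ) * ((p.1 : ℝ)⁻¹ * ∑ i ∈ Finset.range p.1,
          K i p.2 * (‖δ₁ p‖ ^ 2 + ‖δ₂ p‖ ^ 2)) := by
          gcongr
          exact (norm_sum_le _ _).trans (Finset.sum_le_sum fun i _ => hp i)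
      _ = meanSum K p * (‖√(p.1 : ℝ) • δ₁ p‖ * ‖δ₁ p‖ + ‖√(p.1 : ℝ) • δ₂ p‖ * ‖δ₂ p‖) := by
          rw [← Finset.sum_mul, norm_smul, norm_smul, Real.norm_of_nonneg hs, meanSum, smul_eq_mul]
          ring
  have hall := (((hR.add t₁).add t₂).add u₁).add u₂
  simp only [add_zero] at hall
  refine hall.congr' ?_
  filter_upwards [tendsto_fst_whp.eventually (eventually_gt_atTop 0)] with p hp
  have e1 : normSum (fun i ω => h₀ i ω - a + inner ℝ d₁ (ψ₁ i ω) + inner ℝ d₂ (ψ₂ i ω)) p =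
      √(p.1 : ℝ) * (meanSum h₀ p - a) + inner ℝ d₁ (normSum ψ₁ p) +
        inner ℝ d₂ (normSum ψ₂ p) := by
    rw [normSum_add, normSum_add, inner_normSum, inner_normSum, normSum_sub,
      normSum_eq_sqrt_smul_meanSum h₀, normSum_eq_sqrt_smul_meanSum (fun _ _ => a),
      meanSum_const a hp, smul_eq_mul, smul_eq_mul]
    ring
  rw [e1]
  simp only [Finset.sum_sub_distrib, inner_sub_left, inner_sub_right, real_inner_smul_right,
    inner_meanSum, mul_sub]
  simp only [meanSum, smul_eq_mul]
  ring

end Calculus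

/-! ### Independent, identically distributed sequences -/

section IIDSequences

variable {Ω : Type*} [MeasurableSpace Ω] {μ : Measure Ω} [IsProbabilityMeasure μ]

/-- The law of large numbers, along `whp`. -/
lemma tendsto_meanSum {E : Type*} [NormedAddCommGroup E] [NormedSpace ℝ E] [CompleteSpace E]
    [MeasurableSpace E] [BorelSpace E] {φ : ℕ → Ω → E} (hindep : iIndepFun φ μ)
    (hident : ∀ i j, IdentDistrib (φ i) (φ j) μ μ) (hint : ∀ i, Integrable (φ i) μ) (j : ℕ) :
    Tendsto (meanSum φ) (whp μ) (𝓝 (∫ ω, φ j ω ∂μ)) := by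
  rw [(hident j 0).integral_eq]
  have h := strong_law_ae φ (hint 0) (fun i j hij => hindep.indepFun hij) (fun i => hident i 0)
  refine (tendsto_whp_iff (X := fun N ω => meanSum φ (N, ω))).2 (tendstoInMeasure_of_tendsto_ae ?_ h)
  intro N
  have hs : AEStronglyMeasurable (fun ω => ∑ i ∈ Finset.range N, φ i ω) μ :=
    Finset.aestronglyMeasurable_fun_sum _ fun i _ => (hint i).aestronglyMeasurable
  exact hs.const_smul ((N : ℝ)⁻¹)

/-- Chebyshev's inequality: independence makes the variance of the sum N v, so the normalized sum
has variance v for every N ≥ 1. -/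
lemma boundedInProb_normSum_real {φ : ℕ → Ω → ℝ} (hindep : iIndepFun φ μ)
    (hident : ∀ i j, IdentDistrib (φ i) (φ j) μ μ) (hφ : ∀ i, MemLp (φ i) 2 μ)
    (hmean : ∀ i, ∫ ω, φ i ω ∂μ = 0) : BoundedInProb μ (normSum φ) := by
  have hint : ∀ i, Integrable (φ i) μ := fun i => (hφ i).integrable (by norm_num)
  set v := variance (φ 0) μ with hv
  have hsum : ∀ N : ℕ, variance (fun ω => ∑ i ∈ Finset.range N, φ i ω) μ = N * v := by
    intro N
    have h := IndepFun.variance_sum (μ := μ) (X := φ) (s := Finset.range N) (fun i _ => hφ i)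
      (fun i _ j _ hij => hindep.indepFun hij)
    have h' : (fun ω => ∑ i ∈ Finset.range N, φ i ω) = ∑ i ∈ Finset.range N, φ i := by
      ext ω; simp
    rw [h', h, Finset.sum_congr rfl fun i _ => (hident i 0).variance_eq]
    simp [hv]
  intro ε hε
  rcases eq_or_ne ε ∞ with rfl | hεt
  · exact ⟨0, by simp⟩
  have hv0 : 0 ≤ v := variance_nonneg _ _
  have hεr : 0 < ε.toReal := ENNReal.toReal_pos hε.ne' hεt
  -- Chebyshev bounds the tail by v/K², which has to be at most ε. The added 1 keeps K positive when
  -- v = 0.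
  set K := √((v + 1) / ε.toReal) with hKdef
  have hK0 : 0 < K := Real.sqrt_pos.2 (by positivity)
  have hK2 : K ^ 2 = (v + 1) / ε.toReal := Real.sq_sqrt (by positivity)
  refine ⟨K, ?_⟩
  filter_upwards [eventually_gt_atTop 0] with N hN
  have hN' : (0 : ℝ) < N := by exact_mod_cast hN
  have hs : 0 < √(N : ℝ) := Real.sqrt_pos.2 hN'
  have hc : 0 < √(N : ℝ) * K := by positivity
  have hmem : MemLp (fun ω => ∑ i ∈ Finset.range N, φ i ω) 2 μ :=
    memLp_finsetSum _ fun i _ => hφ i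
  have hcheb := meas_ge_le_variance_div_sq hmem hc
  rw [hsum N, integral_finsetSum _ fun i _ => hint i] at hcheb
  simp only [hmean, Finset.sum_const_zero, sub_zero] at hcheb
  refine (measure_mono fun ω hω => ?_).trans (hcheb.trans ?_)
  · simp only [Set.mem_ofPred_eq, normSum, norm_smul, norm_inv, Real.norm_of_nonneg hs.le] at hω ⊢
    rw [← Real.norm_eq_abs]
    rw [inv_mul_eq_div, lt_div_iff₀ hs] at hω
    linarith
  · rw [mul_pow, Real.sq_sqrt hN'.le, hK2]
    refine ENNReal.ofReal_le_of_le_toReal ?_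
    rw [div_le_iff₀ (by positivity)]
    field_simp
    linarith

lemma boundedInProb_normSum {k : ℕ} {ψ : ℕ → Ω → RVec k} (hindep : iIndepFun ψ μ)
    (hident : ∀ i j, IdentDistrib (ψ i) (ψ j) μ μ) (hψ : ∀ i, MemLp (ψ i) 2 μ)
    (hmean : ∀ i, ∫ ω, ψ i ω ∂μ = 0) : BoundedInProb μ (normSum ψ) := by
  have hcoord : ∀ l : Fin k, BoundedInProb μ (normSum fun i ω => ψ i ω l) := by
    intro l
    have hml : Measurable fun x : RVec k => x l := by fun_prop
    refine boundedInProb_normSum_real (hindep.comp (fun _ x => x l) fun _ => hml)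
      (fun i j => (hident i j).comp hml) (fun i => ?_) (fun i => ?_)
    · exact (EuclideanSpace.proj (𝕜 := ℝ) l).comp_memLp' (hψ i)
    · have := (EuclideanSpace.proj (𝕜 := ℝ) l).integral_comp_comm
        ((hψ i).integrable (by norm_num))
      rw [hmean i] at this
      simpa using this
  refine (boundedInProb_finsetSum Finset.univ fun l _ => (hcoord l).norm).of_norm_le fun p => ?_
  rw [Real.norm_of_nonneg (Finset.sum_nonneg fun l _ => norm_nonneg _)]
  have hsplit : normSum ψ p = ∑ l, EuclideanSpace.single l (normSum (fun i ω => ψ i ω l) p) := by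
    ext m
    simp [normSum]
  rw [hsplit]
  refine (norm_sum_le _ _).trans (le_of_eq ?_)
  simp

end IIDSequences

/-! ### The multivariate central limit theorem -/

section CentralLimit

variable {Ω : Type*} [MeasurableSpace Ω] {μ : Measure Ω}
variable {ι : Type*} [Fintype ι]

open Matrix

/-- Serves twice: it shows that the second moment matrix is positive semidefinite, and it identifies
the variance of a one-dimensional projection with the quadratic form in the Gaussian characteristic
function. -/
lemma secondMoment_quadraticForm {Z : Ω → EuclideanSpace ℝ ι} (hZ : MemLp Z 2 μ)
    (t : EuclideanSpace ℝ ι) :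
    (t : ι → ℝ) ⬝ᵥ (Matrix.of fun a b => ∫ ω, Z ω a * Z ω b ∂μ) *ᵥ (t : ι → ℝ) =
      ∫ ω, (inner ℝ (Z ω) t) ^ 2 ∂μ := by
  have hc : ∀ a, MemLp (fun ω => Z ω a) 2 μ := fun a =>
    (EuclideanSpace.proj (𝕜 := ℝ) a).comp_memLp' hZ
  have hint : ∀ a b, Integrable (fun ω => Z ω a * Z ω b) μ := fun a b =>
    (hc a).integrable_mul (hc b)
  have hsq : ∀ ω, (inner ℝ (Z ω) t) ^ 2 = ∑ a, ∑ b, t a * (t b * (Z ω a * Z ω b)) := by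
    intro ω
    rw [PiLp.inner_apply, sq, Finset.sum_mul_sum]
    refine Finset.sum_congr rfl fun a _ => Finset.sum_congr rfl fun b _ => ?_
    simp only [RCLike.inner_apply, conj_trivial]
    ring
  simp_rw [hsq]
  rw [integral_finsetSum _ fun a _ => integrable_finsetSum _ fun b _ =>
    ((hint a b).const_mul _).const_mul _]
  simp only [dotProduct, Matrix.mulVec, Matrix.of_apply]
  refine Finset.sum_congr rfl fun a _ => ?_
  rw [integral_finsetSum _ fun b _ => ((hint a b).const_mul _).const_mul _, Finset.mul_sum]
  refine Finset.sum_congr rfl fun b _ => ?_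
  rw [integral_const_mul, integral_const_mul]
  ring

lemma secondMoment_posSemidef {Z : Ω → EuclideanSpace ℝ ι} (hZ : MemLp Z 2 μ) :
    (Matrix.of fun a b => ∫ ω, Z ω a * Z ω b ∂μ).PosSemidef := by
  refine Matrix.PosSemidef.of_dotProduct_mulVec_nonneg ?_ fun x => ?_
  · ext a b
    simp [Matrix.conjTranspose_apply, mul_comm]
  · have := secondMoment_quadraticForm hZ (WithLp.toLp 2 x)
    simp only [star_trivial]
    rw [this]
    exact integral_nonneg fun ω => sq_nonneg _

/-- The Cramér–Wold reduction: a characteristic function at t sees only the projection on t, so a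
scalar limit theorem for each t suffices. -/
lemma charFun_map_normSum {Z : ℕ → Ω → EuclideanSpace ℝ ι} (hmeas : ∀ i, AEMeasurable (Z i) μ)
    (t : EuclideanSpace ℝ ι) (N : ℕ) :
    charFun (μ.map fun ω => normSum Z (N, ω)) t =
      charFun (μ.map fun ω => normSum (fun i ω => inner ℝ (Z i ω) t) (N, ω)) 1 := by
  have h1 : AEMeasurable (fun ω => normSum Z (N, ω)) μ :=
    (Finset.aemeasurable_fun_sum (Finset.range N) fun i _ => hmeas i).const_smul (√(N : ℝ))⁻¹
  have h2 : AEMeasurable (fun ω => normSum (fun i ω => (inner ℝ (Z i ω) t : ℝ)) (N, ω)) μ := by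
    have hin : Measurable fun z : EuclideanSpace ℝ ι => (inner ℝ z t : ℝ) := by fun_prop
    exact (Finset.aemeasurable_fun_sum (Finset.range N)
      fun i _ => hin.comp_aemeasurable (hmeas i)).const_smul (√(N : ℝ))⁻¹
  rw [charFun_apply, charFun_apply, integral_map h1 (by fun_prop), integral_map h2 (by fun_prop)]
  refine integral_congr_ae (ae_of_all _ fun ω => ?_)
  simp [normSum, real_inner_smul_left, sum_inner]

variable [IsProbabilityMeasure μ]

/-- The one-dimensional central limit theorem, for the characteristic functions at `1`. -/
lemma tendsto_charFun_normSum_one {X : ℕ → Ω → ℝ} (hindep : iIndepFun X μ)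
    (hident : ∀ i j, IdentDistrib (X i) (X j) μ μ) (hX : MemLp (X 0) 2 μ)
    (hmean : ∫ ω, X 0 ω ∂μ = 0) :
    Tendsto (fun N : ℕ => charFun (μ.map fun ω => normSum X (N, ω)) 1) atTop
      (𝓝 (Complex.exp (-((variance (X 0) μ : ℝ) : ℂ) / 2))) := by
  have hclt := tendstoInDistribution_inv_sqrt_mul_sum_sub (P := μ)
    (P' := gaussianReal 0 (variance (X 0) μ).toNNReal) (Y := id)
    ⟨aemeasurable_id, Measure.map_id⟩ hX hindep (fun i => hident i 0)
  have hchar := ProbabilityMeasure.tendsto_iff_tendsto_charFun.1 hclt.tendsto 1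
  simp only [ProbabilityMeasure.coe_mk, Measure.map_id, hmean, mul_zero, sub_zero] at hchar
  rw [charFun_gaussianReal] at hchar
  have he : Complex.exp (((1 : ℝ) : ℂ) * ((0 : ℝ) : ℂ) * Complex.I -
      (((variance (X 0) μ).toNNReal : ℝ) : ℂ) * ((1 : ℝ) : ℂ) ^ 2 / 2) =
      Complex.exp (-((variance (X 0) μ : ℝ) : ℂ) / 2) := by
    rw [Real.coe_toNNReal _ (variance_nonneg _ _)]
    congr 1
    simp [neg_div]
  rw [← he]
  exact hchar

/-- By Lévy's continuity theorem pointwise convergence of characteristic functions suffices, and at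
each t this is the scalar central limit theorem for ⟨Z, t⟩, whose variance is tᵀVt. -/
theorem tendstoInDistribution_normSum [DecidableEq ι] {Z : ℕ → Ω → EuclideanSpace ℝ ι}
    (hindep : iIndepFun Z μ) (hident : ∀ i j, IdentDistrib (Z i) (Z j) μ μ)
    (hZ : ∀ i, MemLp (Z i) 2 μ) (hmean : ∀ i, ∫ ω, Z i ω ∂μ = 0) (j : ℕ) :
    TendstoInDistribution (fun (N : ℕ) ω => normSum Z (N, ω)) atTop
      (id : EuclideanSpace ℝ ι → EuclideanSpace ℝ ι) (fun _ => μ)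
      (multivariateGaussian 0 (Matrix.of fun a b => ∫ ω, Z j ω a * Z j ω b ∂μ)) := by
  set V := Matrix.of fun a b => ∫ ω, Z j ω a * Z j ω b ∂μ with hV
  have hmeas : ∀ i, AEMeasurable (Z i) μ := fun i => (hident i i).aemeasurable_fst
  have hmeasN : ∀ N : ℕ, AEMeasurable (fun ω => normSum Z (N, ω)) μ := fun N =>
    (Finset.aemeasurable_fun_sum (Finset.range N) fun i _ => hmeas i).const_smul (√(N : ℝ))⁻¹
  refine ⟨hmeasN, aemeasurable_id, ?_⟩
  refine ProbabilityMeasure.tendsto_iff_tendsto_charFun.2 fun t => ?_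
  have hin : Measurable fun z : EuclideanSpace ℝ ι => inner ℝ z t := by fun_prop
  have hL2 : ∀ i, MemLp (fun ω => inner ℝ (Z i ω) t) 2 μ := fun i => by
    have := (innerSL ℝ t).comp_memLp' (hZ i)
    refine this.ae_eq (ae_of_all _ fun ω => ?_)
    simp [real_inner_comm]
  have hm0 : ∀ i, ∫ ω, inner ℝ (Z i ω) t ∂μ = 0 := fun i => by
    have := integral_inner ((hZ i).integrable (by norm_num)) t (𝕜 := ℝ)
    rw [hmean i, inner_zero_right] at this
    simpa [real_inner_comm] using this
  -- The scalar theorem speaks of unit 0 and V of unit j; identical distribution identifies the two.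
  have hvar : variance (fun ω => inner ℝ (Z 0 ω) t) μ = (t : ι → ℝ) ⬝ᵥ V *ᵥ (t : ι → ℝ) := by
    rw [hV, secondMoment_quadraticForm (hZ j), variance_of_integral_eq_zero
      (hL2 0).aestronglyMeasurable.aemeasurable (hm0 0)]
    exact ((hident 0 j).comp (u := fun z => (inner ℝ z t : ℝ) ^ 2)
      (by fun_prop)).integral_eq
  have hchar := tendsto_charFun_normSum_one (hindep.comp (fun _ z => inner ℝ z t) fun _ => hin)
    (fun i k => (hident i k).comp hin) (hL2 0) (hm0 0)
  have hlim : charFun (multivariateGaussian 0 V) t =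
      Complex.exp (-((variance (fun ω => inner ℝ (Z 0 ω) t) μ : ℝ) : ℂ) / 2) := by
    rw [charFun_multivariateGaussian (secondMoment_posSemidef (hZ j)), hvar]
    simp [sub_eq_add_neg, neg_div, hV]
  simp only [ProbabilityMeasure.coe_mk, Measure.map_id]
  rw [hlim]
  exact hchar.congr fun N => (charFun_map_normSum hmeas t N).symm

end CentralLimit

/-! ### Taylor expansion and measurability of gradients -/

section Taylor

lemma inner_gradient_eq_fderiv {k : ℕ} (f : RVec k → ℝ) (x v : RVec k) :
    inner ℝ (gradient f x) v = fderiv ℝ f x v := by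
  rw [gradient, InnerProductSpace.toDual_symm_apply]

lemma norm_gradient_eq {k : ℕ} (f : RVec k → ℝ) (x : RVec k) :
    ‖gradient f x‖ = ‖fderiv ℝ f x‖ := by
  rw [gradient, LinearIsometryEquiv.norm_map]

/-- The mean value inequality, applied to f, then to its derivative, then to f minus its
linearization. The factor 1/2 of the sharp remainder is not needed. -/
lemma abs_taylor_le {k : ℕ} {f : RVec k → ℝ} {U : Set (RVec k)} (hU : IsOpen U)
    (hf : ContDiffOn ℝ 2 f U) {x₀ : RVec k} {ρ C : ℝ} (hρ : 0 < ρ)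
    (hball : Metric.ball x₀ ρ ⊆ U)
    (hC : ∀ x ∈ U, ‖fderiv ℝ f x‖ ≤ C ∧ ‖iteratedFDeriv ℝ 2 f x‖ ≤ C)
    {x : RVec k} (hx : x ∈ Metric.ball x₀ ρ) :
    |f x - f x₀| ≤ C * ‖x - x₀‖ ∧
      |f x - f x₀ - inner ℝ (gradient f x₀) (x - x₀)| ≤ C * ‖x - x₀‖ ^ 2 := by
  have hx₀ : x₀ ∈ Metric.ball x₀ ρ := Metric.mem_ball_self hρ
  have hC0 : 0 ≤ C := (norm_nonneg _).trans (hC x₀ (hball hx₀)).1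
  have hd : ∀ y ∈ U, DifferentiableAt ℝ f y := fun y hy =>
    (hf.differentiableOn (by norm_num)).differentiableAt (hU.mem_nhds hy)
  have hd2 : ∀ y ∈ U, DifferentiableAt ℝ (fderiv ℝ f) y := fun y hy =>
    ((hf.fderiv_of_isOpen hU (m := 1) (by norm_num)).differentiableOn (by norm_num)
      ).differentiableAt (hU.mem_nhds hy)
  have h2 : ∀ y ∈ U, ‖fderiv ℝ (fderiv ℝ f) y‖ ≤ C := fun y hy => by
    rw [← norm_iteratedFDeriv_one, norm_iteratedFDeriv_fderiv]
    exact (hC y hy).2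
  refine ⟨?_, ?_⟩
  · exact (convex_ball x₀ ρ).norm_image_sub_le_of_norm_fderiv_le (fun y hy => hd y (hball hy))
      (fun y hy => (hC y (hball hy)).1) hx₀ hx
  -- On the closed ball of radius r = ‖x - x₀‖ the derivative varies by at most C r, which is what
  -- makes the remainder quadratic.
  · set r := ‖x - x₀‖ with hr
    have hsub : Metric.closedBall x₀ r ⊆ Metric.ball x₀ ρ := by
      refine Metric.closedBall_subset_ball ?_
      rwa [hr, ← dist_eq_norm]
    have hx' : x ∈ Metric.closedBall x₀ r := by rw [Metric.mem_closedBall, dist_eq_norm]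
    have hx₀' : x₀ ∈ Metric.closedBall x₀ r := Metric.mem_closedBall_self (norm_nonneg _)
    have hlip : ∀ y ∈ Metric.closedBall x₀ r, ‖fderiv ℝ f y - fderiv ℝ f x₀‖ ≤ C * r := by
      intro y hy
      refine ((convex_ball x₀ ρ).norm_image_sub_le_of_norm_fderiv_le
        (fun z hz => hd2 z (hball hz)) (fun z hz => h2 z (hball hz)) hx₀ (hsub hy)).trans ?_
      rw [Metric.mem_closedBall, dist_eq_norm] at hy
      gcongr
    have := (convex_closedBall x₀ r).norm_image_sub_le_of_norm_fderiv_le'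
      (fun y hy => hd y (hball (hsub hy))) hlip hx₀' hx'
    rw [inner_gradient_eq_fderiv, sq, ← mul_assoc]
    exact this

/-- Each partial derivative, where it exists, is the limit of difference quotients with increment
1/(n+1). Their upper limit is measurable in x everywhere, so measurability does not depend on
differentiability at every x. -/
lemma exists_measurable_gradient {𝒳 : Type*} [MeasurableSpace 𝒳] {k : ℕ} {g : 𝒳 → RVec k → ℝ}
    (hg : Measurable (Function.uncurry g)) (ϑ : RVec k) :
    ∃ L : 𝒳 → RVec k, Measurable L ∧
      ∀ x, DifferentiableAt ℝ (g x) ϑ → gradient (g x) ϑ = L x := by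
  let q : Fin k → ℕ → 𝒳 → ℝ := fun l n x =>
    ((n : ℝ) + 1) * (g x (ϑ + ((n : ℝ) + 1)⁻¹ • EuclideanSpace.single l 1) - g x ϑ)
  have hgm : ∀ v, Measurable fun x => g x v := fun v =>
    hg.comp (measurable_id.prodMk measurable_const)
  have hq : ∀ l n, Measurable (q l n) := fun l n =>
    ((hgm _).sub (hgm _)).const_mul _
  refine ⟨fun x => WithLp.toLp 2 fun l => limsup (fun n => q l n x) atTop, ?_, ?_⟩
  · refine (WithLp.measurable_toLp 2 _).comp (measurable_pi_lambda _ fun l => ?_)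
    exact Measurable.limsup fun n => hq l n
  · intro x hx
    ext l
    have h1 : (gradient (g x) ϑ) l = fderiv ℝ (g x) ϑ (EuclideanSpace.single l 1) := by
      rw [← inner_gradient_eq_fderiv, EuclideanSpace.inner_single_right]
      simp
    rw [h1]
    have hl := hx.hasFDerivAt.hasLineDerivAt (EuclideanSpace.single l (1 : ℝ))
    have hlim : Tendsto (fun n : ℕ => ((n : ℝ) + 1)⁻¹) atTop (𝓝[≠] 0) := by
      refine tendsto_nhdsWithin_iff.2 ⟨?_, Eventually.of_forall fun n => ?_⟩
      · simpa using tendsto_one_div_add_atTop_nhds_zero_nat (𝕜 := ℝ)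
      · have : (0 : ℝ) < (n : ℝ) + 1 := by positivity
        simpa using this.ne'
    have := hl.tendsto_slope_zero.comp hlim
    refine (Tendsto.limsup_eq (this.congr fun n => ?_)).symm
    simp [q]

end Taylor

/-! ### Local expansions of the outcome and score models -/

namespace PanelSetup

variable {Ω : Type*} [MeasurableSpace Ω] {T dD dX dE dEs : ℕ}
variable {S : PanelSetup Ω T dD dX dE dEs} {μ : Measure Ω}

/-- A uniform first-order expansion of the model around the pseudo-true value. -/
lemma RegularStep.exists_expansion {F : S.Step} (hF : S.RegularStep μ F) :
    ∃ ρ C : ℝ, 0 < ρ ∧ 0 ≤ C ∧ Metric.ball F.star ρ ⊆ F.Θ ∧ ∀ᵐ ω ∂μ, ∀ i,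
      ‖gradient (F.g (S.X i ω)) F.star‖ ≤ C ∧
      DifferentiableAt ℝ (F.g (S.X i ω)) F.star ∧
      ContinuousOn (F.g (S.X i ω)) (Metric.ball F.star ρ) ∧
      ∀ ϑ ∈ Metric.ball F.star ρ,
        |F.g (S.X i ω) ϑ - F.g (S.X i ω) F.star| ≤ C * ‖ϑ - F.star‖ ∧
        |F.g (S.X i ω) ϑ - F.g (S.X i ω) F.star -
          inner ℝ (gradient (F.g (S.X i ω)) F.star) (ϑ - F.star)| ≤ C * ‖ϑ - F.star‖ ^ 2 := by
  obtain ⟨-, -, -, -, ⟨U, hU, hstar, hUΘ, ⟨C, hC⟩, -⟩, -⟩ := hF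
  obtain ⟨ρ, hρ, hball⟩ := Metric.isOpen_iff.1 hU _ hstar
  refine ⟨ρ, |C|, hρ, abs_nonneg C, hball.trans hUΘ, ?_⟩
  filter_upwards [ae_all_iff.2 hC] with ω hω i
  obtain ⟨hcd, hb⟩ := hω i
  have hb' : ∀ ϑ ∈ U, ‖fderiv ℝ (F.g (S.X i ω)) ϑ‖ ≤ |C| ∧
      ‖iteratedFDeriv ℝ 2 (F.g (S.X i ω)) ϑ‖ ≤ |C| := fun ϑ h =>
    ⟨(hb ϑ h).1.trans (le_abs_self C), (hb ϑ h).2.trans (le_abs_self C)⟩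
  refine ⟨?_, ?_, hcd.continuousOn.mono hball, fun ϑ h => abs_taylor_le hU hcd hρ hball hb' h⟩
  · rw [norm_gradient_eq]
    exact (hb' _ hstar).1
  · exact (hcd.differentiableOn (by norm_num)).differentiableAt (hU.mem_nhds hstar)

/-- The bounds on the score hold simultaneously for all parameters near the pseudo-true value. -/
lemma BoundedScore.exists_uniform {G : S.Step} (hB : S.BoundedScore μ G) {ρ : ℝ}
    (hball : Metric.ball G.star ρ ⊆ G.Θ)
    (hcont : ∀ᵐ ω ∂μ, ∀ i, ContinuousOn (G.g (S.X i ω)) (Metric.ball G.star ρ)) :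
    ∃ ε : ℝ, 0 < ε ∧ ∀ᵐ ω ∂μ, ∀ i, ∀ π ∈ Metric.ball G.star ρ,
      ε ≤ G.g (S.X i ω) π ∧ G.g (S.X i ω) π ≤ 1 - ε := by
  obtain ⟨ε, hε, h⟩ := hB
  refine ⟨ε, hε, ?_⟩
  obtain ⟨D, hDc, hDd⟩ := TopologicalSpace.exists_countable_dense (RVec G.dim)
  -- The exceptional null set in the hypothesis depends on π. A countable dense set of parameters
  -- needs only one null set, and continuity in π extends the bounds from it to the whole ball.
  have hae : ∀ᵐ ω ∂μ, ∀ π ∈ D, π ∈ Metric.ball G.star ρ → ∀ i,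
      ε ≤ G.g (S.X i ω) π ∧ G.g (S.X i ω) π ≤ 1 - ε := by
    rw [ae_ball_iff hDc]
    intro π _
    by_cases hπ : π ∈ Metric.ball G.star ρ
    · filter_upwards [ae_all_iff.2 (h π (hball hπ))] with ω hω _ i using hω i
    · exact ae_of_all _ fun ω h => absurd h hπ
  filter_upwards [hae, hcont] with ω hω hc i π hπ
  have hcl : π ∈ closure (D ∩ Metric.ball G.star ρ) := by
    have := hDd.open_subset_closure_inter (Metric.isOpen_ball (x := G.star) (ε := ρ)) hπ
    rwa [Set.inter_comm] at this
  have hct : ContinuousWithinAt (G.g (S.X i ω)) (D ∩ Metric.ball G.star ρ) π :=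
    (hc i π hπ).mono Set.inter_subset_right
  have := hct.mem_closure hcl (t := Set.Icc ε (1 - ε)) fun x hx => hω x hx.1 hx.2 i
  rwa [isClosed_Icc.closure_eq] at this

/-- Expansion of the ratio `p / (1 - p)`. -/
lemma abs_ratio_taylor_le {p p' d ε C δ : ℝ} (hε : 0 < ε) (hp : p ≤ 1 - ε) (hp' : p' ≤ 1 - ε)
    (h1 : |p' - p| ≤ C * δ) (h2 : |p' - p - d| ≤ C * δ ^ 2) :
    |p' / (1 - p') - p / (1 - p)| ≤ C / ε ^ 2 * δ ∧
    |p' / (1 - p') - p / (1 - p) - ((1 - p) ^ 2)⁻¹ * d| ≤ (C / ε ^ 2 + C ^ 2 / ε ^ 3) * δ ^ 2 := by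
  have hq : ε ≤ 1 - p := by linarith
  have hq' : ε ≤ 1 - p' := by linarith
  have hq0 : 0 < 1 - p := hε.trans_le hq
  have hq0' : 0 < 1 - p' := hε.trans_le hq'
  -- Exact formulas for the increment and for its second-order remainder; the denominators are
  -- bounded below by powers of ε.
  have e1 : p' / (1 - p') - p / (1 - p) = (p' - p) / ((1 - p) * (1 - p')) := by
    field_simp
    ring
  have e2 : p' / (1 - p') - p / (1 - p) - ((1 - p) ^ 2)⁻¹ * d =
      (p' - p - d) / (1 - p) ^ 2 + (p' - p) ^ 2 / ((1 - p) ^ 2 * (1 - p')) := by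
    field_simp
    ring
  constructor
  · rw [e1, abs_div, abs_of_pos (mul_pos hq0 hq0'), div_mul_eq_mul_div]
    refine div_le_div₀ ((abs_nonneg _).trans h1) h1 (by positivity) ?_
    nlinarith
  · rw [e2]
    refine (abs_add_le _ _).trans ?_
    rw [add_mul, abs_div, abs_div, abs_of_pos (pow_pos hq0 2),
      abs_of_pos (mul_pos (pow_pos hq0 2) hq0'), div_mul_eq_mul_div, div_mul_eq_mul_div]
    refine add_le_add ?_ ?_
    · refine div_le_div₀ ((abs_nonneg _).trans h2) h2 (by positivity) ?_
      gcongr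
    · have hsq : |(p' - p) ^ 2| ≤ C ^ 2 * δ ^ 2 := by
        rw [abs_pow, ← mul_pow]
        gcongr
      refine div_le_div₀ ((abs_nonneg _).trans hsq) hsq (by positivity) ?_
      calc ε ^ 3 = ε ^ 2 * ε := by ring
        _ ≤ (1 - p) ^ 2 * (1 - p') := by gcongr

end PanelSetup

/-! ### Conditional expectations under a conditioned measure -/

section CondMeasure

variable {Ω : Type*} {m mΩ : MeasurableSpace Ω} {μ : Measure Ω}

lemma setIntegral_cond {B : Set Ω} (hB : MeasurableSet B) (f : Ω → ℝ) {C : Set Ω}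
    (hC : MeasurableSet C) :
    ∫ ω in C, f ω ∂(μ[|B]) = (μ.real B)⁻¹ * ∫ ω in C, B.indicator f ω ∂μ := by
  rw [ProbabilityTheory.cond, Measure.restrict_smul, integral_smul_measure,
    setIntegral_indicator hB, Measure.restrict_restrict hC, measureReal_def, ENNReal.toReal_inv,
    smul_eq_mul]

variable [IsProbabilityMeasure μ]

lemma integrable_cond_iff {B : Set Ω} (hB : MeasurableSet B) (hB0 : μ B ≠ 0) {f : Ω → ℝ} :
    Integrable f (μ[|B]) ↔ Integrable (B.indicator f) μ := by
  rw [ProbabilityTheory.cond, integrable_smul_measure (by simp) (by simpa using hB0),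
    integrable_indicator_iff hB, IntegrableOn]

/-- The conditional expectation under `μ[|B]` characterized by a moment condition under `μ`. -/
lemma condExp_indicator_sub_condExp_cond (hm : m ≤ mΩ) {B : Set Ω} (hB : MeasurableSet B)
    (hB0 : μ B ≠ 0) {f : Ω → ℝ} (hf : Integrable f μ) :
    μ[B.indicator (fun ω => f ω - ((μ[|B])[f | m]) ω) | m] =ᵐ[μ] 0 := by
  have : IsProbabilityMeasure (μ[|B]) := cond_isProbabilityMeasure hB0
  have hfν : Integrable f (μ[|B]) := (integrable_cond_iff hB hB0).2 (hf.indicator hB)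
  have hgν : Integrable ((μ[|B])[f | m]) (μ[|B]) := integrable_condExp
  have hint : Integrable (B.indicator (fun ω => f ω - ((μ[|B])[f | m]) ω)) μ :=
    (integrable_cond_iff hB hB0).1 (hfν.sub hgν)
  -- On every m-measurable C the residual has integral zero under `μ[|B]`, which is the integral of
  -- its restriction to B under μ, divided by the nonzero number μ(B).
  refine (ae_eq_condExp_of_forall_setIntegral_eq hm hint (fun C _ _ => ?_) (fun C hC _ => ?_)
    ?_).symm
  · exact integrableOn_zero
  · have h1 := setIntegral_cond hB (μ := μ) (fun ω => f ω - ((μ[|B])[f | m]) ω) (hm C hC)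
    rw [integral_sub hfν.integrableOn hgν.integrableOn, setIntegral_condExp hm hfν hC,
      sub_self] at h1
    have h2 : (μ.real B)⁻¹ ≠ 0 := by
      simpa [measureReal_def, ENNReal.toReal_eq_zero_iff] using hB0
    simp only [Pi.zero_apply, integral_zero]
    rcases mul_eq_zero.1 h1.symm with h | h
    · exact absurd h h2
    · exact h.symm
  · exact stronglyMeasurable_zero.aestronglyMeasurable

end CondMeasure

namespace PanelSetup

variable {Ω : Type*} [MeasurableSpace Ω] {T dD dX dE dEs : ℕ}
variable (S : PanelSetup Ω T dD dX dE dEs) {μ : Measure Ω}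

/-! ### Measurability of the data -/

lemma measurable_path (i : ℕ) : Measurable (S.path i) :=
  measurable_pi_lambda _ fun r => S.measurable_D i r

lemma measurable_obs (i : ℕ) : Measurable (S.obs i) :=
  (measurable_pi_lambda _ fun t => S.measurable_Y i t).prodMk
    ((S.measurable_path i).prodMk (S.measurable_X i))

lemma sigmaX_le (i : ℕ) : S.sigmaX i ≤ ‹MeasurableSpace Ω› := (S.measurable_X i).comap_le

lemma sigmaDX_le (i : ℕ) : S.sigmaDX i ≤ ‹MeasurableSpace Ω› :=
  ((S.measurable_path i).prodMk (S.measurable_X i)).comap_le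

lemma sigmaX_le_sigmaDX (i : ℕ) : S.sigmaX i ≤ S.sigmaDX i := by
  rintro _ ⟨B, hB, rfl⟩
  exact ⟨Prod.snd ⁻¹' B, measurable_snd hB, rfl⟩

lemma measurable_sigmaX_comp (i : ℕ) {f : S.𝒳 → ℝ} (hf : Measurable f) :
    Measurable[S.sigmaX i] fun ω => f (S.X i ω) :=
  hf.comp (comap_measurable (S.X i))

lemma measurable_dY (i : ℕ) (t s : Fin T) : Measurable (S.dY i t s) :=
  (S.measurable_Y i t).sub (S.measurable_Y i s)

/-- Units with effective treatments `a` in period `t` and `b` in period `s`. -/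
def effEvent (i : ℕ) (t s : Fin T) (a b : RVec dE) : Set Ω :=
  {ω | S.E i t ω = a ∧ S.E i s ω = b}

lemma measurableSet_path_effEvent (t s : Fin T) (a b : RVec dE) :
    MeasurableSet {d : S.Path | S.eff t d = a ∧ S.eff s d = b} :=
  ((S.measurable_eff t) (measurableSet_singleton a)).inter
    ((S.measurable_eff s) (measurableSet_singleton b))

lemma measurableSet_sigmaDX_effEvent (i : ℕ) (t s : Fin T) (a b : RVec dE) :
    MeasurableSet[S.sigmaDX i] (S.effEvent i t s a b) :=
  ⟨_, measurable_fst (S.measurableSet_path_effEvent t s a b), rfl⟩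

lemma measurableSet_effEvent (i : ℕ) (t s : Fin T) (a b : RVec dE) :
    MeasurableSet (S.effEvent i t s a b) :=
  S.sigmaDX_le i _ (S.measurableSet_sigmaDX_effEvent i t s a b)

lemma M_eq_indicator (i : ℕ) (t s : Fin T) (e : RVec dE) :
    S.M i t s e = (S.effEvent i t s e 0).indicator 1 := rfl

lemma St_eq_indicator (i : ℕ) (t s : Fin T) :
    S.St i t s = (S.effEvent i t s 0 0).indicator 1 := rfl

lemma St_eq_M (i : ℕ) (t s : Fin T) : S.St i t s = S.M i t s 0 := rfl

lemma M_eq_zero_or_one (i : ℕ) (t s : Fin T) (e : RVec dE) (ω : Ω) :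
    S.M i t s e ω = 0 ∨ S.M i t s e ω = 1 := by
  rw [M_eq_indicator]
  by_cases h : ω ∈ S.effEvent i t s e 0 <;> simp [h]

lemma M_nonneg (i : ℕ) (t s : Fin T) (e : RVec dE) (ω : Ω) : 0 ≤ S.M i t s e ω := by
  rcases S.M_eq_zero_or_one i t s e ω with h | h <;> simp [h]

lemma M_le_one (i : ℕ) (t s : Fin T) (e : RVec dE) (ω : Ω) : S.M i t s e ω ≤ 1 := by
  rcases S.M_eq_zero_or_one i t s e ω with h | h <;> simp [h]

lemma norm_M_le_one (i : ℕ) (t s : Fin T) (e : RVec dE) (ω : Ω) : ‖S.M i t s e ω‖ ≤ 1 := by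
  rw [Real.norm_of_nonneg (S.M_nonneg i t s e ω)]
  exact S.M_le_one i t s e ω

lemma M_mul_St {e : RVec dE} (he : e ≠ 0) (i : ℕ) (t s : Fin T) (ω : Ω) :
    S.M i t s e ω * S.St i t s ω = 0 := by
  rw [M_eq_indicator, St_eq_indicator]
  by_cases h : S.E i t ω = e
  · have : ω ∉ S.effEvent i t s 0 0 := fun h' => he (h.symm.trans h'.1)
    simp [this]
  · have : ω ∉ S.effEvent i t s e 0 := fun h' => h h'.1
    simp [this]

lemma indicator_effEvent (i : ℕ) (t s : Fin T) (e : RVec dE) (f : Ω → ℝ) :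
    (S.effEvent i t s e 0).indicator f = fun ω => S.M i t s e ω * f ω := by
  ext ω
  rw [M_eq_indicator]
  by_cases h : ω ∈ S.effEvent i t s e 0 <;> simp [h]

lemma setOf_M_eq_one (i : ℕ) (t s : Fin T) (e : RVec dE) :
    {ω | S.M i t s e ω = 1} = S.effEvent i t s e 0 := by
  ext ω
  rw [M_eq_indicator]
  by_cases h : ω ∈ S.effEvent i t s e 0 <;> simp [h]

lemma setOf_M_add_St_eq_one {e : RVec dE} (he : e ≠ 0) (i : ℕ) (t s : Fin T) :
    {ω | S.M i t s e ω + S.St i t s ω = 1} = S.effEvent i t s e 0 ∪ S.effEvent i t s 0 0 := by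
  ext ω
  have h := S.M_mul_St he i t s ω
  rw [M_eq_indicator, St_eq_indicator] at *
  by_cases h1 : ω ∈ S.effEvent i t s e 0 <;> by_cases h2 : ω ∈ S.effEvent i t s 0 0 <;>
    simp [h1, h2] at h ⊢

lemma measurable_sigmaDX_M (i : ℕ) (t s : Fin T) (e : RVec dE) :
    Measurable[S.sigmaDX i] (S.M i t s e) :=
  Measurable.indicator measurable_const (S.measurableSet_sigmaDX_effEvent i t s e 0)

lemma measurable_M (i : ℕ) (t s : Fin T) (e : RVec dE) : Measurable (S.M i t s e) :=
  (S.measurable_sigmaDX_M i t s e).mono (S.sigmaDX_le i) le_rfl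

lemma integrable_M [IsProbabilityMeasure μ] (i : ℕ) (t s : Fin T) (e : RVec dE) :
    Integrable (S.M i t s e) μ :=
  Integrable.of_bound (S.measurable_M i t s e).aestronglyMeasurable 1
    (ae_of_all _ (S.norm_M_le_one i t s e))

lemma integral_M (i : ℕ) (t s : Fin T) (e : RVec dE) :
    ∫ ω, S.M i t s e ω ∂μ = μ.real (S.effEvent i t s e 0) := by
  rw [M_eq_indicator, integral_indicator_one (S.measurableSet_effEvent i t s e 0)]

lemma integrable_M_mul {f : Ω → ℝ} (hf : Integrable f μ) (i : ℕ) (t s : Fin T) (e : RVec dE) :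
    Integrable (fun ω => S.M i t s e ω * f ω) μ :=
  hf.bdd_mul (c := 1) (S.measurable_M i t s e).aestronglyMeasurable
    (ae_of_all _ (S.norm_M_le_one i t s e))

/-! ### Potential outcomes and parallel trends -/

/-- A zero of `eff` is a zero of `effStar`, so the realized path and the path chosen in `Ystar` have
the same true effective treatment. Correctness then equates their outcomes. -/
lemma Y_eq_Ystar (hTrue : ∀ t, S.IsTrue t (S.effStar t)) (hEff : S.EffectiveTreatment)
    {i : ℕ} {t : Fin T} {ω : Ω} (h : S.E i t ω = 0) : S.Y i t ω = S.Ystar i t 0 ω := by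
  have h0 : S.effStar t (S.path i ω) = 0 := hEff.2 t _ h
  have hex : ∃ d, S.effStar t d = 0 := ⟨_, h0⟩
  simp only [Ystar, hex, dif_pos, Y]
  rw [(hTrue t).1 i _ _ (h0.trans hex.choose_spec.symm)]

/-- The trend of the untreated potential outcome. -/
def trend (i : ℕ) (t s : Fin T) (ω : Ω) : ℝ := S.Ystar i t 0 ω - S.Ystar i s 0 ω

lemma St_mul_dY (hTrue : ∀ t, S.IsTrue t (S.effStar t)) (hEff : S.EffectiveTreatment)
    (i : ℕ) (t s : Fin T) (ω : Ω) :
    S.St i t s ω * S.dY i t s ω = S.St i t s ω * S.trend i t s ω := by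
  by_cases h : ω ∈ S.effEvent i t s 0 0
  · rw [dY, trend, S.Y_eq_Ystar hTrue hEff h.1, S.Y_eq_Ystar hTrue hEff h.2]
  · simp [St_eq_indicator, h]

/-- Movers are untreated in period s, so Y_s = Y*_s(0) can be subtracted from both outcomes: the
effect becomes observed change minus untreated trend. -/
lemma M_mul_effect (hTrue : ∀ t, S.IsTrue t (S.effStar t)) (hEff : S.EffectiveTreatment)
    (i : ℕ) (t s : Fin T) (e : RVec dE) (ω : Ω) :
    S.M i t s e ω * (S.Y i t ω - S.Ystar i t 0 ω) =
      S.M i t s e ω * (S.dY i t s ω - S.trend i t s ω) := by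
  by_cases h : ω ∈ S.effEvent i t s e 0
  · rw [dY, trend, S.Y_eq_Ystar hTrue hEff h.2]
    ring
  · simp [M_eq_indicator, h]

variable {S}

/-- The assumption covers consecutive periods only; the trend from s to s + n telescopes into such
increments. -/
lemma ParallelTrends.trend_add (hPar : S.ParallelTrends μ) (i : ℕ) (s : Fin T) :
    ∀ (n : ℕ) (h : (s : ℕ) + n < T),
      Integrable (S.trend i ⟨s + n, h⟩ s) μ ∧
      μ[S.trend i ⟨s + n, h⟩ s | S.sigmaDX i] =ᵐ[μ] μ[S.trend i ⟨s + n, h⟩ s | S.sigmaX i] := by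
  intro n
  induction n with
  | zero =>
    intro h
    have h0 : S.trend i ⟨s + 0, h⟩ s = 0 := by
      ext ω
      simp [trend]
    rw [h0]
    exact ⟨integrable_zero _ _ _, by rw [condExp_zero, condExp_zero]⟩
  | succ n ih =>
    intro h
    have hn : (s : ℕ) + n < T := by omega
    obtain ⟨h1, h2⟩ := ih hn
    obtain ⟨h3, h4⟩ := hPar i ⟨s + (n + 1), h⟩ ⟨s + n, hn⟩ (by simp; omega)
    have hsplit : S.trend i ⟨s + (n + 1), h⟩ s =
        (fun ω => S.Ystar i ⟨s + (n + 1), h⟩ 0 ω - S.Ystar i ⟨s + n, hn⟩ 0 ω) +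
          S.trend i ⟨s + n, hn⟩ s := by
      ext ω
      simp [trend]
    rw [hsplit]
    refine ⟨h3.add h1, ?_⟩
    refine (condExp_add h3 h1 _).trans ?_
    exact (h4.add h2).trans (condExp_add h3 h1 _).symm

lemma ParallelTrends.trend (hPar : S.ParallelTrends μ) (i : ℕ) {t s : Fin T} (hst : s < t) :
    Integrable (S.trend i t s) μ ∧
      μ[S.trend i t s | S.sigmaDX i] =ᵐ[μ] μ[S.trend i t s | S.sigmaX i] := by
  have h : (s : ℕ) + ((t : ℕ) - s) < T := by have := t.2; omega
  have := hPar.trend_add i s ((t : ℕ) - s) h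
  have ht : (⟨(s : ℕ) + ((t : ℕ) - s), h⟩ : Fin T) = t := by
    ext
    simp
    omega
  rwa [ht] at this

/-- Under parallel trends, functions of treatments and covariates do not see the difference between
the untreated trend and its conditional expectation given the covariates. -/
lemma ParallelTrends.condExp_mul_trend (hPar : S.ParallelTrends μ) (i : ℕ) {t s : Fin T}
    (hst : s < t) {h : Ω → ℝ} (hh : Measurable[S.sigmaDX i] h) {c : ℝ} (hc : ∀ᵐ ω ∂μ, ‖h ω‖ ≤ c) :
    μ[fun ω => h ω * S.trend i t s ω | S.sigmaDX i] =ᵐ[μ]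
      fun ω => h ω * (μ[S.trend i t s | S.sigmaX i]) ω := by
  obtain ⟨hint, heq⟩ := hPar.trend i hst
  have hmul : Integrable (h * S.trend i t s) μ :=
    hint.bdd_mul (c := c) (hh.mono (S.sigmaDX_le i) le_rfl).aestronglyMeasurable hc
  refine (condExp_mul_of_stronglyMeasurable_left hh.stronglyMeasurable hmul hint).trans ?_
  filter_upwards [heq] with ω hω
  simp [hω]

variable [IsProbabilityMeasure μ]

lemma ParallelTrends.integral_mul_trend (hPar : S.ParallelTrends μ) (i : ℕ) {t s : Fin T}
    (hst : s < t) {h : Ω → ℝ} (hh : Measurable[S.sigmaDX i] h) {c : ℝ} (hc : ∀ᵐ ω ∂μ, ‖h ω‖ ≤ c) :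
    ∫ ω, h ω * S.trend i t s ω ∂μ = ∫ ω, h ω * (μ[S.trend i t s | S.sigmaX i]) ω ∂μ := by
  rw [← integral_congr_ae (hPar.condExp_mul_trend i hst hh hc), integral_condExp (S.sigmaDX_le i)]

/-! ### Consequences of overlap -/

lemma integral_St_ge {ε : ℝ} {i : ℕ} {t s : Fin T}
    (h : ∀ᵐ ω ∂μ, ε ≤ (μ[S.St i t s | S.sigmaX i]) ω) : ε ≤ ∫ ω, S.St i t s ω ∂μ := by
  rw [← integral_condExp (S.sigmaX_le i)]
  have := integral_mono_ae (integrable_const (μ := μ) ε) (integrable_condExp) h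
  simpa using this

/-- The outcome regression function is the conditional trend. -/
lemma orFun_ae_eq (hTrue : ∀ t, S.IsTrue t (S.effStar t)) (hEff : S.EffectiveTreatment)
    (hPar : S.ParallelTrends μ) {i : ℕ} {t s : Fin T} (hst : s < t)
    {ε : ℝ} (hε : 0 < ε) (hov : ∀ᵐ ω ∂μ, ε ≤ (μ[S.St i t s | S.sigmaX i]) ω)
    (hdY : Integrable (S.dY i t s) μ) :
    S.orFun μ i t s =ᵐ[μ] μ[S.trend i t s | S.sigmaX i] := by
  have hpos : 0 < ∫ ω, S.St i t s ω ∂μ := hε.trans_le (integral_St_ge hov)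
  have hB := S.measurableSet_effEvent i t s 0 0
  have hB0 : μ (S.effEvent i t s 0 0) ≠ 0 := by
    intro h0
    rw [St_eq_M, integral_M, measureReal_def, h0] at hpos
    simp at hpos
  set q := S.orFun μ i t s with hq
  set m₀ := μ[S.trend i t s | S.sigmaX i] with hm₀
  have hqdef : q = (μ[|S.effEvent i t s 0 0])[S.dY i t s | S.sigmaX i] := by
    rw [hq, orFun, St_eq_M, setOf_M_eq_one]
  have hqm : StronglyMeasurable[S.sigmaX i] q := by rw [hqdef]; exact stronglyMeasurable_condExp
  have : IsProbabilityMeasure (μ[|S.effEvent i t s 0 0]) := cond_isProbabilityMeasure hB0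
  have hqint : Integrable (fun ω => S.St i t s ω * q ω) μ := by
    have : Integrable q (μ[|S.effEvent i t s 0 0]) := by rw [hqdef]; exact integrable_condExp
    rw [integrable_cond_iff hB hB0, indicator_effEvent] at this
    exact this
  have hSt : Integrable (S.St i t s) μ := S.integrable_M i t s 0
  obtain ⟨htint, -⟩ := hPar.trend i hst
  have hmint : Integrable (fun ω => S.St i t s ω * m₀ ω) μ :=
    S.integrable_M_mul integrable_condExp i t s 0
  have hsint : Integrable (fun ω => S.St i t s ω * S.trend i t s ω) μ :=
    S.integrable_M_mul htint i t s 0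
  have h1 := condExp_indicator_sub_condExp_cond (S.sigmaX_le i) hB hB0 hdY
  rw [← hqdef, indicator_effEvent] at h1
  have h2 : (fun ω => S.M i t s 0 ω * (S.dY i t s ω - q ω)) =
      (fun ω => S.St i t s ω * S.trend i t s ω) - fun ω => S.St i t s ω * q ω := by
    ext ω
    rw [Pi.sub_apply, ← S.St_mul_dY hTrue hEff, ← St_eq_M]
    ring
  rw [h2] at h1
  have h3 := condExp_sub hsint hqint (S.sigmaX i)
  -- Condition first on (D, X), where S is known and the trend has conditional mean m₀, then on X.
  have h4 : μ[fun ω => S.St i t s ω * S.trend i t s ω | S.sigmaX i] =ᵐ[μ]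
      μ[fun ω => S.St i t s ω * m₀ ω | S.sigmaX i] := by
    refine (condExp_condExp_of_le (S.sigmaX_le_sigmaDX i) (S.sigmaDX_le i)).symm.trans ?_
    exact condExp_congr_ae (hPar.condExp_mul_trend i hst (S.measurable_sigmaDX_M i t s 0)
      (ae_of_all _ (S.norm_M_le_one i t s 0)))
  have h5 := condExp_sub hmint hqint (S.sigmaX i)
  have h6 : (fun ω => S.St i t s ω * m₀ ω) - (fun ω => S.St i t s ω * q ω) =
      (m₀ - q) * S.St i t s := by
    ext ω
    simp only [Pi.sub_apply, Pi.mul_apply]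
    ring
  -- The factor m₀ - q is pulled out of the conditional expectation. Only its product with S is
  -- known to be μ-integrable, since q is a conditional expectation under the conditioned law.
  have hsub : StronglyMeasurable[S.sigmaX i] (m₀ - q) :=
    stronglyMeasurable_condExp.sub hqm
  have h7 := condExp_mul_of_stronglyMeasurable_left hsub (h6 ▸ hmint.sub hqint) hSt
  rw [h6] at h5
  filter_upwards [h1, h3, h4, h5, h7, hov] with ω e1 e3 e4 e5 e7 eo
  simp only [Pi.sub_apply, Pi.mul_apply, Pi.zero_apply] at *
  -- Overlap excludes that the second factor vanishes.
  have : (m₀ ω - q ω) * (μ[S.St i t s | S.sigmaX i]) ω = 0 := by linarith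
  rcases mul_eq_zero.1 this with h | h
  · linarith
  · linarith

/-- Reweighting stayers by `p / (1 - p)` reproduces movers, for functions of the covariates. -/
lemma integral_M_mul_eq {e : RVec dE} (he : e ≠ 0) {i : ℕ} {t s : Fin T}
    {ε : ℝ} (hε : 0 < ε) (hov : ∀ᵐ ω ∂μ, ε ≤ (μ[S.St i t s | S.sigmaX i]) ω)
    (hgps : ∀ᵐ ω ∂μ, ε ≤ S.gps μ i t s e ω ∧ S.gps μ i t s e ω ≤ 1 - ε)
    {h : Ω → ℝ} (hh : StronglyMeasurable[S.sigmaX i] h)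
    (hM : Integrable (fun ω => S.M i t s e ω * h ω) μ)
    (hS : Integrable (fun ω => S.St i t s ω * h ω) μ) :
    ∫ ω, S.M i t s e ω * h ω ∂μ =
      ∫ ω, S.gps μ i t s e ω / (1 - S.gps μ i t s e ω) * (S.St i t s ω * h ω) ∂μ := by
  have hpos : 0 < ∫ ω, S.St i t s ω ∂μ := hε.trans_le (integral_St_ge hov)
  set B := S.effEvent i t s e 0 ∪ S.effEvent i t s 0 0 with hBdef
  have hB : MeasurableSet B := (S.measurableSet_effEvent i t s e 0).union
    (S.measurableSet_effEvent i t s 0 0)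
  have hB0 : μ B ≠ 0 := by
    intro h0
    rw [St_eq_M, integral_M, measureReal_def, measure_mono_null Set.subset_union_right h0] at hpos
    simp at hpos
  set q := S.gps μ i t s e with hq
  have hqdef : q = (μ[|B])[S.M i t s e | S.sigmaX i] := by
    rw [hq, gps, setOf_M_add_St_eq_one S he]
  have hqm : StronglyMeasurable[S.sigmaX i] q := by rw [hqdef]; exact stronglyMeasurable_condExp
  have h1 := condExp_indicator_sub_condExp_cond (S.sigmaX_le i) hB hB0
    (S.integrable_M (μ := μ) i t s e)
  rw [← hqdef] at h1
  -- Movers and stayers are disjoint because e ≠ 0. Hence the score's moment condition reads E[M(1 -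
  -- q) - Sq | X] = 0.
  have hind : B.indicator (fun ω => S.M i t s e ω - q ω) =
      fun ω => S.M i t s e ω * (1 - q ω) - S.St i t s ω * q ω := by
    ext ω
    have h0 := S.M_mul_St he i t s ω
    rw [M_eq_indicator, St_eq_indicator] at *
    by_cases h1 : ω ∈ S.effEvent i t s e 0 <;> by_cases h2 : ω ∈ S.effEvent i t s 0 0 <;>
      simp [h1, h2, hBdef] at h0 ⊢
  rw [hind] at h1
  have hqm' : Measurable q := (hqm.mono (S.sigmaX_le i)).measurable
  have hrS : Integrable (fun ω => q ω / (1 - q ω) * (S.St i t s ω * h ω)) μ := by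
    refine hS.bdd_mul (c := 1 / ε) (hqm'.div (measurable_const.sub hqm')).aestronglyMeasurable ?_
    filter_upwards [hgps] with ω hω
    rw [Real.norm_eq_abs, abs_of_nonneg (div_nonneg (by linarith) (by linarith))]
    exact div_le_div₀ zero_le_one (by linarith) hε (by linarith)
  -- Multiplying M(1 - q) - Sq by this function of X gives Mh - (q/(1 - q)) Sh, which therefore has
  -- mean zero.
  set k : Ω → ℝ := fun ω => h ω / (1 - q ω) with hk
  have hkm : StronglyMeasurable[S.sigmaX i] k :=
    (hh.measurable.div (measurable_const.sub hqm.measurable)).stronglyMeasurable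
  set f : Ω → ℝ := fun ω => S.M i t s e ω * (1 - q ω) - S.St i t s ω * q ω with hf
  have hae : k * f =ᵐ[μ] fun ω => S.M i t s e ω * h ω -
      q ω / (1 - q ω) * (S.St i t s ω * h ω) := by
    filter_upwards [hgps] with ω hω
    have : 1 - q ω ≠ 0 := by linarith [hω.2]
    simp only [Pi.mul_apply, hk, hf]
    field_simp
  have hkf : Integrable (k * f) μ := (hM.sub hrS).congr hae.symm
  have hfint : Integrable f μ := by
    have hqi : Integrable q μ := by
      refine Integrable.of_bound hqm'.aestronglyMeasurable 1 ?_
      filter_upwards [hgps] with ω hω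
      rw [Real.norm_eq_abs, abs_of_nonneg (by linarith)]
      linarith
    exact (S.integrable_M_mul ((integrable_const 1).sub hqi) i t s e).sub
      (S.integrable_M_mul hqi i t s 0)
  have h2 := condExp_mul_of_stronglyMeasurable_left hkm hkf hfint
  have h3 : ∫ ω, (k * f) ω ∂μ = 0 := by
    rw [← integral_condExp (S.sigmaX_le i)]
    refine integral_eq_zero_of_ae ?_
    filter_upwards [h1, h2] with ω e1 e2
    rw [e2, Pi.mul_apply, e1]
    simp
  rw [integral_congr_ae hae, integral_sub hM hrS] at h3
  linarith

/-- Reweighting with h = 1 gives E[M] = E[q/(1 - q) S] ≥ ε E[S], so overlap alone ensures that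
movers exist. -/
lemma integral_M_pos {e : RVec dE} (he : e ≠ 0) {i : ℕ} {t s : Fin T}
    {ε : ℝ} (hε : 0 < ε) (hov : ∀ᵐ ω ∂μ, ε ≤ (μ[S.St i t s | S.sigmaX i]) ω)
    (hgps : ∀ᵐ ω ∂μ, ε ≤ S.gps μ i t s e ω ∧ S.gps μ i t s e ω ≤ 1 - ε) :
    0 < ∫ ω, S.M i t s e ω ∂μ := by
  have hpos : 0 < ∫ ω, S.St i t s ω ∂μ := hε.trans_le (integral_St_ge hov)
  have hSt : Integrable (S.St i t s) μ := S.integrable_M i t s 0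
  have hqm : Measurable (S.gps μ i t s e) :=
    (stronglyMeasurable_condExp.mono (S.sigmaX_le i)).measurable
  have h := integral_M_mul_eq he hε hov hgps (h := fun _ => 1) stronglyMeasurable_const
    (by simpa using S.integrable_M i t s e) (by simpa using hSt)
  simp only [mul_one] at h
  rw [h]
  have hrS : Integrable (fun ω => S.gps μ i t s e ω / (1 - S.gps μ i t s e ω) * S.St i t s ω) μ := by
    refine hSt.bdd_mul (c := 1 / ε) (hqm.div (measurable_const.sub hqm)).aestronglyMeasurable ?_
    filter_upwards [hgps] with ω hω
    rw [Real.norm_eq_abs, abs_of_nonneg (div_nonneg (by linarith) (by linarith))]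
    exact div_le_div₀ zero_le_one (by linarith) hε (by linarith)
  have hle : ∫ ω, ε * S.St i t s ω ∂μ ≤
      ∫ ω, S.gps μ i t s e ω / (1 - S.gps μ i t s e ω) * S.St i t s ω ∂μ := by
    refine integral_mono_ae (hSt.const_mul ε) hrS ?_
    filter_upwards [hgps] with ω hω
    refine mul_le_mul_of_nonneg_right ?_ (S.M_nonneg i t s 0 ω)
    rw [le_div_iff₀ (by linarith)]
    nlinarith
  rw [integral_const_mul] at hle
  exact lt_of_lt_of_le (by positivity) hle

end PanelSetup

namespace PanelSetup

variable {Ω : Type*} [MeasurableSpace Ω] {T dD dX dE dEs : ℕ}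
variable {S : PanelSetup Ω T dD dX dE dEs} {μ : Measure Ω}

/-! ### Double robustness -/

lemma ratio_bounds {G : S.Step} {x : S.𝒳} {π : RVec G.dim} {ε : ℝ} (hε : 0 < ε)
    (h : ε ≤ G.g x π ∧ G.g x π ≤ 1 - ε) :
    ε ≤ S.ratio G x π ∧ S.ratio G x π ≤ 1 / ε := by
  obtain ⟨h1, h2⟩ := h
  constructor
  · rw [ratio, le_div_iff₀ (by linarith)]
    nlinarith
  · exact div_le_div₀ zero_le_one (by linarith) hε (by linarith)

lemma measurable_model {F : S.Step} (hF : Measurable (Function.uncurry F.g)) (ϑ : RVec F.dim) :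
    Measurable fun x => F.g x ϑ :=
  hF.comp (measurable_id.prodMk measurable_const)

lemma measurable_ratio {G : S.Step} (hG : Measurable (Function.uncurry G.g)) (π : RVec G.dim) :
    Measurable fun x => S.ratio G x π :=
  (measurable_model hG π).div (measurable_const.sub (measurable_model hG π))

lemma integral_ratio_St_pos [IsProbabilityMeasure μ] {G : S.Step}
    (hG : Measurable (Function.uncurry G.g)) {i : ℕ} {t s : Fin T} {ε : ℝ} (hε : 0 < ε)
    (hsc : ∀ᵐ ω ∂μ, ε ≤ G.g (S.X i ω) G.star ∧ G.g (S.X i ω) G.star ≤ 1 - ε)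
    (hpos : 0 < ∫ ω, S.St i t s ω ∂μ) :
    0 < ∫ ω, S.ratio G (S.X i ω) G.star * S.St i t s ω ∂μ := by
  have hSt : Integrable (S.St i t s) μ := S.integrable_M i t s 0
  have hr : Measurable fun ω => S.ratio G (S.X i ω) G.star :=
    (measurable_ratio hG _).comp (S.measurable_X i)
  have hint : Integrable (fun ω => S.ratio G (S.X i ω) G.star * S.St i t s ω) μ := by
    refine hSt.bdd_mul (c := 1 / ε) hr.aestronglyMeasurable ?_
    filter_upwards [hsc] with ω hω
    have := ratio_bounds hε hω
    rw [Real.norm_eq_abs, abs_of_nonneg (by linarith)]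
    exact this.2
  have hle : ∫ ω, ε * S.St i t s ω ∂μ ≤
      ∫ ω, S.ratio G (S.X i ω) G.star * S.St i t s ω ∂μ := by
    refine integral_mono_ae (hSt.const_mul ε) hint ?_
    filter_upwards [hsc] with ω hω
    exact mul_le_mul_of_nonneg_right (ratio_bounds hε hω).1 (S.M_nonneg i t s 0 ω)
  rw [integral_const_mul] at hle
  exact lt_of_lt_of_le (by positivity) hle

/-- Identification of the average treatment effect when one of the two models is correct. -/
theorem atem_eq_doublyRobust [IsProbabilityMeasure μ]
    (hTrue : ∀ t, S.IsTrue t (S.effStar t)) (hEff : S.EffectiveTreatment)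
    (hPar : S.ParallelTrends μ) {i : ℕ} {t s : Fin T} {e : RVec dE} (hst : s < t) (he : e ≠ 0)
    (hOverlap : S.Overlap μ t s e) {F G : S.Step} (hF : Measurable (Function.uncurry F.g))
    (hG : Measurable (Function.uncurry G.g))
    (hModel : S.CorrectModel μ F (fun i => S.orFun μ i t s) ∨
      S.CorrectModel μ G (fun i => S.gps μ i t s e))
    {ε : ℝ} (hε : 0 < ε)
    (hsc : ∀ᵐ ω ∂μ, ε ≤ G.g (S.X i ω) G.star ∧ G.g (S.X i ω) G.star ≤ 1 - ε)
    (hdY : Integrable (S.dY i t s) μ)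
    (hMR : Integrable (fun ω => S.M i t s e ω * S.resid F i t s F.star ω) μ)
    (hSR : Integrable (fun ω => S.St i t s ω * S.resid F i t s F.star ω) μ) :
    S.atem μ i t s e =
      (∫ ω, S.M i t s e ω * S.resid F i t s F.star ω ∂μ) / (∫ ω, S.M i t s e ω ∂μ) -
      (∫ ω, S.ratio G (S.X i ω) G.star * (S.St i t s ω * S.resid F i t s F.star ω) ∂μ) /
        ∫ ω, S.ratio G (S.X i ω) G.star * S.St i t s ω ∂μ := by
  obtain ⟨η, hη, hov⟩ := hOverlap
  have hovS : ∀ᵐ ω ∂μ, η ≤ (μ[S.St i t s | S.sigmaX i]) ω := (hov i).mono fun ω h => h.1.1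
  have hgps := (hov i).mono fun ω h => h.2
  obtain ⟨htr, -⟩ := hPar.trend i hst
  set m₀ := μ[S.trend i t s | S.sigmaX i] with hm₀
  have hm₀i : Integrable m₀ μ := integrable_condExp
  have hm₀m : StronglyMeasurable[S.sigmaX i] m₀ := stronglyMeasurable_condExp
  set r : Ω → ℝ := fun ω => S.ratio G (S.X i ω) G.star with hr
  set R := S.resid F i t s F.star with hR
  set gF : Ω → ℝ := fun ω => F.g (S.X i ω) F.star with hgF
  have hrm : Measurable[S.sigmaX i] r := S.measurable_sigmaX_comp i (measurable_ratio hG _)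
  have hrb : ∀ᵐ ω ∂μ, ‖r ω‖ ≤ 1 / ε := by
    filter_upwards [hsc] with ω hω
    have := ratio_bounds hε hω
    rw [Real.norm_eq_abs, abs_of_nonneg (by linarith)]
    exact this.2
  have hrm' : AEStronglyMeasurable r μ := (hrm.mono (S.sigmaX_le i) le_rfl).aestronglyMeasurable
  set h : Ω → ℝ := fun ω => m₀ ω - gF ω with hh
  have hhm : StronglyMeasurable[S.sigmaX i] h :=
    hm₀m.sub (S.measurable_sigmaX_comp i (measurable_model hF _)).stronglyMeasurable
  have hMY := S.integrable_M_mul hdY i t s e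
  have hMm := S.integrable_M_mul hm₀i i t s e
  have hSY : Integrable (fun ω => S.St i t s ω * S.dY i t s ω) μ := S.integrable_M_mul hdY i t s 0
  have hSm : Integrable (fun ω => S.St i t s ω * m₀ ω) μ := S.integrable_M_mul hm₀i i t s 0
  have hSt : Integrable (fun ω => S.St i t s ω * S.trend i t s ω) μ :=
    S.integrable_M_mul htr i t s 0
  -- The model value m(X; γ*) is not assumed integrable. On movers its integrability comes from that
  -- of MR and MΔY, and likewise for stayers.
  have hMh : Integrable (fun ω => S.M i t s e ω * h ω) μ := by
    refine (hMm.sub (hMY.sub hMR)).congr (ae_of_all _ fun ω => ?_)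
    simp only [hh, hR, resid, hgF, Pi.sub_apply]
    ring
  have hSh : Integrable (fun ω => S.St i t s ω * h ω) μ := by
    refine (hSm.sub (hSY.sub hSR)).congr (ae_of_all _ fun ω => ?_)
    simp only [hh, hR, resid, hgF, Pi.sub_apply]
    ring
  -- the effect on the movers
  have hatem : S.atem μ i t s e = (∫ ω, S.M i t s e ω ∂μ)⁻¹ *
      ∫ ω, S.M i t s e ω * (S.dY i t s ω - m₀ ω) ∂μ := by
    have h1 := setIntegral_cond (μ := μ) (S.measurableSet_effEvent i t s e 0)
      (fun ω => S.Y i t ω - S.Ystar i t 0 ω) MeasurableSet.univ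
    rw [setIntegral_univ, setIntegral_univ, indicator_effEvent] at h1
    rw [atem, setOf_M_eq_one, h1, integral_M]
    congr 1
    simp_rw [S.M_mul_effect hTrue hEff, mul_sub]
    rw [integral_sub hMY (S.integrable_M_mul htr i t s e), integral_sub hMY hMm,
      hPar.integral_mul_trend i hst (S.measurable_sigmaDX_M i t s e)
        (ae_of_all _ (S.norm_M_le_one i t s e))]
  have hMR' : ∫ ω, S.M i t s e ω * R ω ∂μ =
      (∫ ω, S.M i t s e ω * (S.dY i t s ω - m₀ ω) ∂μ) + ∫ ω, S.M i t s e ω * h ω ∂μ := by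
    have hi : Integrable (fun ω => S.M i t s e ω * (S.dY i t s ω - m₀ ω)) μ :=
      S.integrable_M_mul (hdY.sub hm₀i) i t s e
    rw [← integral_add hi hMh]
    refine integral_congr_ae (ae_of_all _ fun ω => ?_)
    simp only [hh, hR, resid, hgF]
    ring
  -- On stayers ΔY is the untreated trend, and rS is a function of (D, X), so the trend may be
  -- replaced by m₀ inside the expectation.
  have hSR' : ∫ ω, r ω * (S.St i t s ω * R ω) ∂μ = ∫ ω, r ω * (S.St i t s ω * h ω) ∂μ := by
    have hrS : Measurable[S.sigmaDX i] fun ω => r ω * S.St i t s ω :=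
      (hrm.mono (S.sigmaX_le_sigmaDX i) le_rfl).mul (S.measurable_sigmaDX_M i t s 0)
    have hrSb : ∀ᵐ ω ∂μ, ‖r ω * S.St i t s ω‖ ≤ 1 / ε := by
      filter_upwards [hrb] with ω hω
      rw [norm_mul]
      exact (mul_le_of_le_one_right (norm_nonneg _) (S.norm_M_le_one i t s 0 ω)).trans hω
    have h1 := hPar.integral_mul_trend i hst hrS hrSb
    have e1 : ∀ ω, r ω * (S.St i t s ω * R ω) = r ω * (S.St i t s ω * S.trend i t s ω) -
        r ω * (S.St i t s ω * gF ω) := by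
      intro ω
      rw [← S.St_mul_dY hTrue hEff]
      simp only [hR, resid, hgF]
      ring
    have e2 : ∀ ω, r ω * (S.St i t s ω * h ω) = r ω * (S.St i t s ω * m₀ ω) -
        r ω * (S.St i t s ω * gF ω) := by
      intro ω
      simp only [hh]
      ring
    have hSg : Integrable (fun ω => S.St i t s ω * gF ω) μ := by
      refine (hSm.sub hSh).congr (ae_of_all _ fun ω => ?_)
      simp only [hh, Pi.sub_apply]
      ring
    simp_rw [e1, e2]
    rw [integral_sub (hSt.bdd_mul hrm' hrb) (hSg.bdd_mul hrm' hrb),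
      integral_sub (hSm.bdd_mul hrm' hrb) (hSg.bdd_mul hrm' hrb)]
    congr 1
    simpa only [mul_assoc] using h1
  rw [hatem, hMR', hSR']
  -- What remains is E[Mh]/E[M] = E[rSh]/E[rS]. With a correct outcome model h = 0; with a correct
  -- score the numerators agree and so do the denominators.
  rcases hModel with hm | hm
  · have h0 : h =ᵐ[μ] 0 := by
      filter_upwards [hm.2.1 i, orFun_ae_eq hTrue hEff hPar hst hη hovS hdY] with ω h1 h2
      simp only [hh, hgF, Pi.zero_apply]
      linarith
    have z1 : ∫ ω, S.M i t s e ω * h ω ∂μ = 0 :=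
      integral_eq_zero_of_ae (h0.mono fun ω hω => by simp [hω])
    have z2 : ∫ ω, r ω * (S.St i t s ω * h ω) ∂μ = 0 :=
      integral_eq_zero_of_ae (h0.mono fun ω hω => by simp [hω])
    rw [z1, z2]
    simp only [add_zero, zero_div, sub_zero]
    rw [div_eq_inv_mul]
  · have hq : ∀ᵐ ω ∂μ, S.gps μ i t s e ω / (1 - S.gps μ i t s e ω) = r ω := by
      filter_upwards [hm.2.1 i] with ω hω
      simp only [hr, ratio, hω]
    have w1 : ∫ ω, S.M i t s e ω * h ω ∂μ = ∫ ω, r ω * (S.St i t s ω * h ω) ∂μ := by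
      rw [integral_M_mul_eq he hη hovS hgps hhm hMh hSh]
      exact integral_congr_ae (hq.mono fun ω hω => by simp only [hω])
    have w2 : ∫ ω, S.M i t s e ω ∂μ = ∫ ω, r ω * S.St i t s ω ∂μ := by
      have := integral_M_mul_eq he hη hovS hgps (h := fun _ => 1) stronglyMeasurable_const
        (by simpa using S.integrable_M i t s e)
        (by simp only [mul_one]; exact S.integrable_M i t s 0)
      simp only [mul_one] at this
      rw [this]
      exact integral_congr_ae (hq.mono fun ω hω => by simp only [hω])
    rw [← w1, ← w2]
    ring

/-! ### Functions of the data of one unit -/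

/-- The sequence `φ` is, almost surely, a fixed measurable function of the data of each unit. -/
def IsUnitwise (S : PanelSetup Ω T dD dX dE dEs) (μ : Measure Ω) {E : Type*} [MeasurableSpace E]
    (φ : ℕ → Ω → E) : Prop :=
  ∃ f : S.Obs → E, Measurable f ∧ ∀ i, φ i =ᵐ[μ] fun ω => f (S.obs i ω)

section Unitwise

variable {E E' : Type*} [MeasurableSpace E] [MeasurableSpace E']

lemma IsUnitwise.of_obs {f : S.Obs → E} (hf : Measurable f) :
    S.IsUnitwise μ fun i ω => f (S.obs i ω) := ⟨f, hf, fun _ => ae_eq_rfl⟩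

lemma IsUnitwise.of_X {f : S.𝒳 → E} (hf : Measurable f) :
    S.IsUnitwise μ fun i ω => f (S.X i ω) :=
  IsUnitwise.of_obs (f := fun w => f w.2.2) (hf.comp (measurable_snd.comp measurable_snd))

lemma IsUnitwise.congr {φ χ : ℕ → Ω → E} (hφ : S.IsUnitwise μ φ)
    (h : ∀ i, χ i =ᵐ[μ] φ i) : S.IsUnitwise μ χ := by
  obtain ⟨f, hf, hfe⟩ := hφ
  exact ⟨f, hf, fun i => (h i).trans (hfe i)⟩

lemma IsUnitwise.comp {φ : ℕ → Ω → E} (hφ : S.IsUnitwise μ φ) {u : E → E'} (hu : Measurable u) :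
    S.IsUnitwise μ fun i ω => u (φ i ω) := by
  obtain ⟨f, hf, hfe⟩ := hφ
  exact ⟨u ∘ f, hu.comp hf, fun i => (hfe i).mono fun ω h => by simp [h]⟩

lemma IsUnitwise.prodMk {φ : ℕ → Ω → E} {χ : ℕ → Ω → E'} (hφ : S.IsUnitwise μ φ)
    (hχ : S.IsUnitwise μ χ) : S.IsUnitwise μ fun i ω => (φ i ω, χ i ω) := by
  obtain ⟨f, hf, hfe⟩ := hφ
  obtain ⟨g, hg, hge⟩ := hχ
  refine ⟨fun w => (f w, g w), hf.prodMk hg, fun i => ?_⟩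
  filter_upwards [hfe i, hge i] with ω h1 h2
  simp [h1, h2]

lemma IsUnitwise.mul {φ χ : ℕ → Ω → ℝ} (hφ : S.IsUnitwise μ φ) (hχ : S.IsUnitwise μ χ) :
    S.IsUnitwise μ fun i ω => φ i ω * χ i ω :=
  (hφ.prodMk hχ).comp (u := fun x => x.1 * x.2) (by fun_prop)

lemma IsUnitwise.add {φ χ : ℕ → Ω → ℝ} (hφ : S.IsUnitwise μ φ) (hχ : S.IsUnitwise μ χ) :
    S.IsUnitwise μ fun i ω => φ i ω + χ i ω :=
  (hφ.prodMk hχ).comp (u := fun x => x.1 + x.2) (by fun_prop)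

lemma IsUnitwise.sub {φ χ : ℕ → Ω → ℝ} (hφ : S.IsUnitwise μ φ) (hχ : S.IsUnitwise μ χ) :
    S.IsUnitwise μ fun i ω => φ i ω - χ i ω :=
  (hφ.prodMk hχ).comp (u := fun x => x.1 - x.2) (by fun_prop)

lemma IsUnitwise.smul {k : ℕ} {φ : ℕ → Ω → ℝ} {χ : ℕ → Ω → RVec k} (hφ : S.IsUnitwise μ φ)
    (hχ : S.IsUnitwise μ χ) : S.IsUnitwise μ fun i ω => φ i ω • χ i ω :=
  (hφ.prodMk hχ).comp (u := fun x => x.1 • x.2) (by fun_prop)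

lemma IsUnitwise.const (c : E) : S.IsUnitwise μ fun _ _ => c :=
  IsUnitwise.of_obs (f := fun _ => c) measurable_const

lemma IsUnitwise.aemeasurable {φ : ℕ → Ω → E} (hφ : S.IsUnitwise μ φ) (i : ℕ) :
    AEMeasurable (φ i) μ := by
  obtain ⟨f, hf, hfe⟩ := hφ
  exact (hf.comp (S.measurable_obs i)).aemeasurable.congr (hfe i).symm

lemma IsUnitwise.identDistrib {φ : ℕ → Ω → E} (hφ : S.IsUnitwise μ φ) (hIID : S.IID μ)
    (i j : ℕ) : IdentDistrib (φ i) (φ j) μ μ := by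
  have hi := hφ.aemeasurable i
  have hj := hφ.aemeasurable j
  obtain ⟨f, hf, hfe⟩ := hφ
  exact (IdentDistrib.of_ae_eq hi (hfe i)).trans
    (((hIID.2 i j).comp hf).trans (IdentDistrib.of_ae_eq hj (hfe j)).symm)

lemma IsUnitwise.iIndepFun {φ : ℕ → Ω → E} (hφ : S.IsUnitwise μ φ) (hIID : S.IID μ) :
    iIndepFun φ μ := by
  obtain ⟨f, hf, hfe⟩ := hφ
  exact (hIID.1.comp (fun _ => f) fun _ => hf).congr fun i => (hfe i).symm

lemma IsUnitwise.integral_eq {E : Type*} [NormedAddCommGroup E] [NormedSpace ℝ E]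
    [MeasurableSpace E] [BorelSpace E] {φ : ℕ → Ω → E} (hφ : S.IsUnitwise μ φ)
    (hIID : S.IID μ) (i j : ℕ) : ∫ ω, φ i ω ∂μ = ∫ ω, φ j ω ∂μ :=
  (hφ.identDistrib hIID i j).integral_eq

lemma IsUnitwise.tendsto_meanSum [IsProbabilityMeasure μ] {E : Type*} [NormedAddCommGroup E]
    [NormedSpace ℝ E] [CompleteSpace E] [MeasurableSpace E] [BorelSpace E] {φ : ℕ → Ω → E}
    (hφ : S.IsUnitwise μ φ) (hIID : S.IID μ) (hint : ∀ i, Integrable (φ i) μ) (j : ℕ) :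
    Tendsto (meanSum φ) (whp μ) (𝓝 (∫ ω, φ j ω ∂μ)) :=
  _root_.tendsto_meanSum (hφ.iIndepFun hIID) (fun i j => hφ.identDistrib hIID i j) hint j

lemma IsUnitwise.boundedInProb [IsProbabilityMeasure μ] {φ : ℕ → Ω → ℝ} (hφ : S.IsUnitwise μ φ)
    (hIID : S.IID μ) (hL2 : ∀ i, MemLp (φ i) 2 μ) (hmean : ∀ i, ∫ ω, φ i ω ∂μ = 0) :
    BoundedInProb μ (normSum φ) :=
  boundedInProb_normSum_real (hφ.iIndepFun hIID) (fun i j => hφ.identDistrib hIID i j) hL2 hmean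

end Unitwise

lemma measurable_M_obs (t s : Fin T) (e : RVec dE) : Measurable fun w : S.Obs =>
    ({d : S.Path | S.eff t d = e ∧ S.eff s d = 0}.indicator 1 w.2.1 : ℝ) :=
  (measurable_const.indicator (S.measurableSet_path_effEvent t s e 0)).comp
    (measurable_fst.comp measurable_snd)

lemma isUnitwise_M (t s : Fin T) (e : RVec dE) : S.IsUnitwise μ fun i => S.M i t s e :=
  ⟨_, measurable_M_obs t s e, fun _ => ae_eq_rfl⟩

lemma isUnitwise_dY (t s : Fin T) : S.IsUnitwise μ fun i => S.dY i t s :=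
  IsUnitwise.of_obs (f := fun w : S.Obs => w.1 t - w.1 s)
    (((measurable_pi_apply t).comp measurable_fst).sub
      ((measurable_pi_apply s).comp measurable_fst))

lemma isUnitwise_resid {F : S.Step} (hF : Measurable (Function.uncurry F.g)) (t s : Fin T)
    (γ : RVec F.dim) : S.IsUnitwise μ fun i => S.resid F i t s γ :=
  (isUnitwise_dY t s).sub (IsUnitwise.of_X (measurable_model hF γ))

end PanelSetup

namespace PanelSetup

variable {Ω : Type*} [MeasurableSpace Ω] {T dD dX dE dEs : ℕ}
variable {S : PanelSetup Ω T dD dX dE dEs} {μ : Measure Ω}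

/-! ### First-step estimators -/

namespace RegularStep

variable {F : S.Step}

lemma star_mem (hF : S.RegularStep μ F) : F.star ∈ F.Θ := interior_subset hF.2.2.2.1

lemma measurable_g (hF : S.RegularStep μ F) : Measurable (Function.uncurry F.g) := hF.1.1

lemma measurable_est (hF : S.RegularStep μ F) (N : ℕ) : Measurable (F.est N) := hF.1.2.1 N

lemma isUnitwise_infl (hF : S.RegularStep μ F) :
    S.IsUnitwise μ fun i ω => F.infl (S.obs i ω) F.star :=
  IsUnitwise.of_obs (hF.1.2.2 _ hF.star_mem)

lemma memLp_infl (hF : S.RegularStep μ F) (i : ℕ) :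
    MemLp (fun ω => F.infl (S.obs i ω) F.star) 2 μ := (hF.2.2.2.2.2.2.2 i).1

lemma integral_infl (hF : S.RegularStep μ F) (i : ℕ) :
    ∫ ω, F.infl (S.obs i ω) F.star ∂μ = 0 := (hF.2.2.2.2.2.2.2 i).2.1

/-- Differentiability at the pseudo-true value holds only almost surely, so the gradient is replaced
by a measurable function of X that agrees with it almost surely. -/
lemma isUnitwise_gradient (hF : S.RegularStep μ F) :
    S.IsUnitwise μ fun i ω => gradient (F.g (S.X i ω)) F.star := by
  obtain ⟨L, hL, hLg⟩ := exists_measurable_gradient hF.measurable_g F.star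
  obtain ⟨ρ, C, -, -, -, h⟩ := hF.exists_expansion
  refine (IsUnitwise.of_X hL).congr fun i => ?_
  filter_upwards [h] with ω hω
  exact hLg _ (hω i).2.1

variable [IsProbabilityMeasure μ]

lemma tendsto_est (hF : S.RegularStep μ F) :
    Tendsto (fun p : ℕ × Ω => F.est p.1 p.2 - F.star) (whp μ) (𝓝 0) := by
  rw [tendsto_sub_nhds_zero_iff]
  exact tendsto_whp_iff.2 (tendstoInMeasure_of_tendsto_ae
    (fun N => (hF.measurable_est N).aestronglyMeasurable) hF.2.2.2.2.2.1)

omit [IsProbabilityMeasure μ] in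
lemma tendsto_linearization (hF : S.RegularStep μ F) :
    Tendsto (fun p : ℕ × Ω => √(p.1 : ℝ) • (F.est p.1 p.2 - F.star) -
      normSum (fun i ω => F.infl (S.obs i ω) F.star) p) (whp μ) (𝓝 0) := by
  have h := hF.2.2.2.2.2.2.1
  simp only [normSum]
  exact (tendsto_whp_iff (X := fun (N : ℕ) ω => √(N : ℝ) • (F.est N ω - F.star) -
    (√(N : ℝ))⁻¹ • ∑ i ∈ Finset.range N, F.infl (S.obs i ω) F.star)).2 h

lemma boundedInProb_infl (hF : S.RegularStep μ F) (hIID : S.IID μ) :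
    BoundedInProb μ (normSum fun i ω => F.infl (S.obs i ω) F.star) :=
  boundedInProb_normSum (hF.isUnitwise_infl.iIndepFun hIID)
    (fun i j => hF.isUnitwise_infl.identDistrib hIID i j) hF.memLp_infl hF.integral_infl

end RegularStep

lemma BoundedInProb.inner_normSum {E : Type*} [NormedAddCommGroup E] [InnerProductSpace ℝ E]
    {ψ : ℕ → Ω → E} (h : BoundedInProb μ (normSum ψ)) (d : E) :
    BoundedInProb μ (normSum fun i ω => inner ℝ d (ψ i ω)) := by
  refine (h.norm.const_smul ‖d‖).of_norm_le fun p => ?_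
  rw [← _root_.inner_normSum, smul_eq_mul, norm_mul, norm_norm, norm_norm]
  exact norm_inner_le_norm _ _

/-- The first-order expansion of a sample mean that depends on both first-step estimators, together
with the properties of its influence function. -/
lemma asympLinear_twoStep [IsProbabilityMeasure μ] (hIID : S.IID μ) {F G : S.Step}
    (hF : S.RegularStep μ F) (hG : S.RegularStep μ G)
    {h : ℕ → ℕ × Ω → ℝ} {h₀ K : ℕ → Ω → ℝ} {D₁ : ℕ → Ω → RVec F.dim} {D₂ : ℕ → Ω → RVec G.dim}
    (hh₀ : S.IsUnitwise μ h₀) (hh₀2 : ∀ i, MemLp (h₀ i) 2 μ)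
    (hK : S.IsUnitwise μ K) (hKi : ∀ i, Integrable (K i) μ)
    (hD₁ : S.IsUnitwise μ D₁) (hD₁i : ∀ i, Integrable (D₁ i) μ)
    (hD₂ : S.IsUnitwise μ D₂) (hD₂i : ∀ i, Integrable (D₂ i) μ)
    (hrem : ∀ᶠ p in whp μ, ∀ i, |h i p - h₀ i p.2 -
      inner ℝ (D₁ i p.2) (F.est p.1 p.2 - F.star) - inner ℝ (D₂ i p.2) (G.est p.1 p.2 - G.star)| ≤
        K i p.2 * (‖F.est p.1 p.2 - F.star‖ ^ 2 + ‖G.est p.1 p.2 - G.star‖ ^ 2))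
    {φ : ℕ → Ω → ℝ} {a : ℝ} {d₁ : RVec F.dim} {d₂ : RVec G.dim} (j : ℕ)
    (ha : ∫ ω, h₀ j ω ∂μ = a) (hd₁ : ∫ ω, D₁ j ω ∂μ = d₁) (hd₂ : ∫ ω, D₂ j ω ∂μ = d₂)
    (hφ : ∀ i ω, φ i ω = h₀ i ω - a + inner ℝ d₁ (F.infl (S.obs i ω) F.star) +
      inner ℝ d₂ (G.infl (S.obs i ω) G.star)) :
    AsympLinear μ (fun p : ℕ × Ω => (p.1 : ℝ)⁻¹ * ∑ i ∈ Finset.range p.1, h i p) a φ ∧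
      BoundedInProb μ (normSum φ) ∧ ∀ i, Integrable (φ i) μ ∧ ∫ ω, φ i ω ∂μ = 0 := by
  have hφ' : φ = fun i ω => h₀ i ω - a + inner ℝ d₁ (F.infl (S.obs i ω) F.star) +
      inner ℝ d₂ (G.infl (S.obs i ω) G.star) := by
    funext i ω
    exact hφ i ω
  have hb1 := hF.boundedInProb_infl hIID
  have hb2 := hG.boundedInProb_infl hIID
  have hint : ∀ i, Integrable (h₀ i) μ := fun i => (hh₀2 i).integrable (by norm_num)
  have hc : ∀ i, ∫ ω, (h₀ i ω - a) ∂μ = 0 := fun i => by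
    rw [integral_sub (hint i) (integrable_const a), hh₀.integral_eq hIID i j, ha]
    simp
  have hi1 := fun i => (hF.memLp_infl i).integrable (by norm_num)
  have hi2 := fun i => (hG.memLp_infl i).integrable (by norm_num)
  have hc0 : ∀ i, Integrable (fun ω => h₀ i ω - a) μ := fun i =>
    (hint i).sub (integrable_const a)
  have hu1 : ∀ i, Integrable (fun ω => (inner ℝ d₁ (F.infl (S.obs i ω) F.star) : ℝ)) μ :=
    fun i => (hi1 i).const_inner d₁
  have hu2 : ∀ i, Integrable (fun ω => (inner ℝ d₂ (G.infl (S.obs i ω) G.star) : ℝ)) μ :=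
    fun i => (hi2 i).const_inner d₂
  have hu0 : ∀ i, Integrable (fun ω => h₀ i ω - a +
      (inner ℝ d₁ (F.infl (S.obs i ω) F.star) : ℝ)) μ := fun i => (hc0 i).add (hu1 i)
  subst hφ'
  refine ⟨?_, ?_, fun i => ⟨?_, ?_⟩⟩
  · exact asympLinear_meanSum_of_taylor a hrem (hd₁ ▸ hD₁.tendsto_meanSum hIID hD₁i j)
      (hd₂ ▸ hD₂.tendsto_meanSum hIID hD₂i j) (hK.tendsto_meanSum hIID hKi j)
      hF.tendsto_est hG.tendsto_est hF.tendsto_linearization hG.tendsto_linearization hb1 hb2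
  · have hb0 : BoundedInProb μ (normSum fun i ω => h₀ i ω - a) :=
      (hh₀.sub (IsUnitwise.const a)).boundedInProb hIID
        (fun i => (hh₀2 i).sub (memLp_const a)) hc
    refine ((hb0.add (BoundedInProb.inner_normSum hb1 d₁)).add
      (BoundedInProb.inner_normSum hb2 d₂)).of_norm_le fun p => ?_
    rw [normSum_add, normSum_add]
  · exact (hu0 i).add (hu2 i)
  · have e1 := integral_add (hu0 i) (hu2 i)
    rw [integral_add (hc0 i) (hu1 i), hc, integral_inner (hi1 i), integral_inner (hi2 i),
      hF.integral_infl, hG.integral_infl, inner_zero_right, inner_zero_right, add_zero,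
      add_zero] at e1
    exact e1

/-! ### Square integrability of the residuals -/

lemma memLp_psiEst {F G : S.Step} (hF : S.RegularStep μ F) (hG : S.RegularStep μ G) (i : ℕ)
    (t s : Fin T) (e : RVec dE) : MemLp (S.psiEst μ F G i t s e F.star G.star) 2 μ := by
  refine MemLp.add ?_ ?_
  · refine ((innerSL ℝ (S.M1 μ F G i t s e F.star G.star)).comp_memLp'
      (hF.memLp_infl i)).ae_eq (ae_of_all _ fun ω => ?_)
    simp [real_inner_comm]
  · refine ((innerSL ℝ (S.M2 μ F G i t s F.star G.star)).comp_memLp'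
      (hG.memLp_infl i)).ae_eq (ae_of_all _ fun ω => ?_)
    simp [real_inner_comm]

lemma memLp_bdd_mul {b f : Ω → ℝ} (hf : MemLp f 2 μ) (hb : AEStronglyMeasurable b μ) {c : ℝ}
    (hc : ∀ᵐ ω ∂μ, ‖b ω‖ ≤ c) : MemLp (fun ω => b ω * f ω) 2 μ := by
  refine hf.of_le_mul (c := c) (hb.mul hf.aestronglyMeasurable) ?_
  filter_upwards [hc] with ω hω
  rw [norm_mul]
  gcongr

lemma memLp_M_mul {f : Ω → ℝ} (hf : MemLp f 2 μ) (i : ℕ) (t s : Fin T) (e : RVec dE) :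
    MemLp (fun ω => S.M i t s e ω * f ω) 2 μ :=
  memLp_bdd_mul hf (S.measurable_M i t s e).aestronglyMeasurable
    (ae_of_all _ (S.norm_M_le_one i t s e))

lemma M_mul_M (i : ℕ) (t s : Fin T) (e : RVec dE) (ω : Ω) :
    S.M i t s e ω * S.M i t s e ω = S.M i t s e ω := by
  rcases S.M_eq_zero_or_one i t s e ω with h | h <;> simp [h]

variable [IsProbabilityMeasure μ]

lemma memLp_M {i : ℕ} {t s : Fin T} {e : RVec dE} : MemLp (S.M i t s e) 2 μ :=
  MemLp.of_bound (S.measurable_M i t s e).aestronglyMeasurable 1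
    (ae_of_all _ (S.norm_M_le_one i t s e))

/-- Square integrability is assumed of ψ, not of the residual. On movers S = 0, so ψ plus the square
integrable first-step term is an affine function of R with slope 1/E[M], which can be solved for R.
The centring term enters only as a constant, so its integrability need not be known. -/
lemma memLp_M_mul_resid {F G : S.Step} (hF : S.RegularStep μ F) (hG : S.RegularStep μ G) {i : ℕ}
    {t s : Fin T} {e : RVec dE} (he : e ≠ 0) (hpsi : MemLp (S.psiStar μ F G i t s e) 2 μ)
    (hM : ∫ ω, S.M i t s e ω ∂μ ≠ 0) :
    MemLp (fun ω => S.M i t s e ω * S.resid F i t s F.star ω) 2 μ := by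
  have hEst := memLp_psiEst hF hG i t s e
  set a := ∫ ω, S.M i t s e ω ∂μ with ha
  set c := ∫ ω', S.wM μ i t s e ω' * S.resid F i t s F.star ω' ∂μ with hc
  have h1 : MemLp (fun ω => a * (S.M i t s e ω * (S.psiStar μ F G i t s e ω +
      S.psiEst μ F G i t s e F.star G.star ω)) + c * S.M i t s e ω) 2 μ :=
    ((memLp_M_mul (hpsi.add hEst) i t s e).const_mul a).add (memLp_M.const_mul c)
  refine h1.ae_eq (ae_of_all _ fun ω => ?_)
  have h0 := S.M_mul_St he i t s ω
  have h2 := M_mul_M (S := S) i t s e ω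
  simp only [psiStar, psi, psiM, psiS, wM, wS]
  rw [← ha]
  generalize hb : ∫ ω', S.ratio G (S.X i ω') G.star * S.St i t s ω' ∂μ = b
  generalize hd : ∫ ω', S.ratio G (S.X i ω') G.star * S.St i t s ω' / b *
    S.resid F i t s F.star ω' ∂μ = d
  have hc' : ∫ ω', S.M i t s e ω' / a * S.resid F i t s F.star ω' ∂μ = c := rfl
  rw [hc']
  rcases S.M_eq_zero_or_one i t s e ω with hm | hm
  · simp [hm]
  · rw [hm, one_mul] at h0
    rw [hm, h0]
    field_simp
    ring

/-- The same inversion on stayers, where the slope is -r/E[rS]; the lower bound on r allows division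
by it. -/
lemma memLp_St_mul_resid {F G : S.Step} (hF : S.RegularStep μ F) (hG : S.RegularStep μ G) {i : ℕ}
    {t s : Fin T} {e : RVec dE} (he : e ≠ 0) (hpsi : MemLp (S.psiStar μ F G i t s e) 2 μ)
    (hSt : ∫ ω, S.ratio G (S.X i ω) G.star * S.St i t s ω ∂μ ≠ 0) {ε : ℝ} (hε : 0 < ε)
    (hsc : ∀ᵐ ω ∂μ, ε ≤ G.g (S.X i ω) G.star ∧ G.g (S.X i ω) G.star ≤ 1 - ε) :
    MemLp (fun ω => S.St i t s ω * S.resid F i t s F.star ω) 2 μ := by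
  have hEst := memLp_psiEst hF hG i t s e
  set a := ∫ ω, S.ratio G (S.X i ω) G.star * S.St i t s ω ∂μ with ha
  set c := ∫ ω', S.wS μ G i t s G.star ω' * S.resid F i t s F.star ω' ∂μ with hc
  have hr : Measurable fun ω => (S.ratio G (S.X i ω) G.star)⁻¹ :=
    ((measurable_ratio hG.measurable_g _).comp (S.measurable_X i)).inv
  have hrb : ∀ᵐ ω ∂μ, ‖(S.ratio G (S.X i ω) G.star)⁻¹‖ ≤ ε⁻¹ := by
    filter_upwards [hsc] with ω hω
    have := (ratio_bounds hε hω).1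
    rw [norm_inv, Real.norm_of_nonneg (by linarith)]
    exact inv_anti₀ hε this
  have h0 : MemLp (fun ω => S.St i t s ω * (S.psiStar μ F G i t s e ω +
      S.psiEst μ F G i t s e F.star G.star ω)) 2 μ := memLp_M_mul (hpsi.add hEst) i t s 0
  have hS2 : MemLp (S.St i t s) 2 μ := memLp_M (S := S) (e := 0)
  have h1 : MemLp (fun ω => (S.ratio G (S.X i ω) G.star)⁻¹ * (-a * (S.St i t s ω *
      (S.psiStar μ F G i t s e ω + S.psiEst μ F G i t s e F.star G.star ω))) +
        c * S.St i t s ω) 2 μ :=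
    (memLp_bdd_mul (h0.const_mul (-a)) hr.aestronglyMeasurable hrb).add (hS2.const_mul c)
  refine h1.ae_eq ?_
  filter_upwards [hsc] with ω hω
  have hr0 : S.ratio G (S.X i ω) G.star ≠ 0 := by linarith [(ratio_bounds hε hω).1]
  have h0 := S.M_mul_St he i t s ω
  simp only [psiStar, psi, psiM, psiS, wM, wS]
  rw [← ha]
  generalize hb : ∫ ω', S.M i t s e ω' ∂μ = b
  generalize hd : ∫ ω', S.M i t s e ω' / b * S.resid F i t s F.star ω' ∂μ = d
  have hc' : ∫ ω', S.ratio G (S.X i ω') G.star * S.St i t s ω' / a *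
    S.resid F i t s F.star ω' ∂μ = c := rfl
  rw [hc']
  rcases S.M_eq_zero_or_one i t s 0 ω with hm | hm
  · rw [← St_eq_M] at hm
    simp [hm]
  · rw [← St_eq_M] at hm
    rw [hm, mul_one] at h0
    rw [hm, h0]
    field_simp
    ring

end PanelSetup

namespace PanelSetup

variable {Ω : Type*} [MeasurableSpace Ω] {T dD dX dE dEs : ℕ}
variable {S : PanelSetup Ω T dD dX dE dEs} {μ : Measure Ω} [IsProbabilityMeasure μ]

/-! ### Expansions of the four sample means in the estimator -/

/-- Consistency places the estimate in the ball of the local expansion with probability tending to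
one, and then the expansion holds for all units at once. -/
lemma RegularStep.exists_eventually_expansion {F : S.Step} (hF : S.RegularStep μ F) :
    ∃ C : ℝ, 0 ≤ C ∧ (∀ᵐ ω ∂μ, ∀ i, ‖gradient (F.g (S.X i ω)) F.star‖ ≤ C) ∧
      ∀ᶠ p : ℕ × Ω in whp μ, ∀ i, ‖gradient (F.g (S.X i p.2)) F.star‖ ≤ C ∧
        |F.g (S.X i p.2) (F.est p.1 p.2) - F.g (S.X i p.2) F.star -
          inner ℝ (gradient (F.g (S.X i p.2)) F.star) (F.est p.1 p.2 - F.star)| ≤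
            C * ‖F.est p.1 p.2 - F.star‖ ^ 2 := by
  obtain ⟨ρ, C, hρ, hC, -, h⟩ := hF.exists_expansion
  refine ⟨C, hC, h.mono fun ω hω i => (hω i).1, ?_⟩
  have hball : ∀ᶠ p : ℕ × Ω in whp μ, ‖F.est p.1 p.2 - F.star‖ < ρ := by
    have := hF.tendsto_est.norm
    rw [norm_zero] at this
    exact this.eventually_lt_const hρ
  filter_upwards [hball, eventually_whp_snd h]
    with p hp h' i
  exact ⟨(h' i).1, ((h' i).2.2.2 _ (by rwa [Metric.mem_ball, dist_eq_norm])).2⟩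

/-- Bounds and expansion of the estimated ratio `p / (1 - p)`. -/
lemma RegularStep.exists_ratio_expansion {G : S.Step} (hG : S.RegularStep μ G)
    (hB : S.BoundedScore μ G) :
    ∃ ε C : ℝ, 0 < ε ∧ 0 ≤ C ∧
      (∀ᵐ ω ∂μ, ∀ i, (ε ≤ G.g (S.X i ω) G.star ∧ G.g (S.X i ω) G.star ≤ 1 - ε) ∧
        ‖S.ratioDot G (S.X i ω) G.star‖ ≤ C) ∧
      ∀ᶠ p : ℕ × Ω in whp μ, ∀ i, |S.ratio G (S.X i p.2) (G.est p.1 p.2)| ≤ C ∧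
        |S.ratio G (S.X i p.2) (G.est p.1 p.2) - S.ratio G (S.X i p.2) G.star| ≤
          C * ‖G.est p.1 p.2 - G.star‖ ∧
        |S.ratio G (S.X i p.2) (G.est p.1 p.2) - S.ratio G (S.X i p.2) G.star -
          inner ℝ (S.ratioDot G (S.X i p.2) G.star) (G.est p.1 p.2 - G.star)| ≤
            C * ‖G.est p.1 p.2 - G.star‖ ^ 2 := by
  obtain ⟨ρ, C, hρ, hC, hball, h⟩ := hG.exists_expansion
  obtain ⟨ε, hε, hsc⟩ := hB.exists_uniform hball (h.mono fun ω hω i => (hω i).2.2.1)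
  have hmem : G.star ∈ Metric.ball G.star ρ := Metric.mem_ball_self hρ
  -- One constant dominating the bound on r, its Lipschitz constant, its second-order constant and
  -- the bound on its gradient.
  set C' := 1 / ε + (C / ε ^ 2 + C ^ 2 / ε ^ 3) with hC'
  have hC'0 : 0 ≤ C' := by positivity
  have hle1 : 1 / ε ≤ C' := by
    have : 0 ≤ C / ε ^ 2 + C ^ 2 / ε ^ 3 := by positivity
    linarith
  have hle3 : C / ε ^ 2 + C ^ 2 / ε ^ 3 ≤ C' := by
    have : 0 ≤ 1 / ε := by positivity
    linarith
  have hle2 : C / ε ^ 2 ≤ C' := by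
    have : 0 ≤ C ^ 2 / ε ^ 3 := by positivity
    linarith
  refine ⟨ε, C', hε, hC'0, ?_, ?_⟩
  · filter_upwards [h, hsc] with ω hω hs i
    refine ⟨hs i _ hmem, le_trans ?_ hle2⟩
    have h1 : ε ≤ 1 - G.g (S.X i ω) G.star := by linarith [(hs i _ hmem).2]
    rw [ratioDot, norm_smul, norm_inv, Real.norm_of_nonneg (sq_nonneg _), ← div_eq_inv_mul]
    exact div_le_div₀ hC (hω i).1 (by positivity) (by gcongr)
  · have hnear : ∀ᶠ p : ℕ × Ω in whp μ, ‖G.est p.1 p.2 - G.star‖ < ρ := by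
      have := hG.tendsto_est.norm
      rw [norm_zero] at this
      exact this.eventually_lt_const hρ
    filter_upwards [hnear, eventually_whp_snd h,
      eventually_whp_snd hsc] with p hp h' hs i
    have hpb : G.est p.1 p.2 ∈ Metric.ball G.star ρ := by rwa [Metric.mem_ball, dist_eq_norm]
    obtain ⟨t1, t2⟩ := (h' i).2.2.2 _ hpb
    have hr := ratio_bounds hε (hs i _ hpb)
    have hT := abs_ratio_taylor_le hε (hs i _ hmem).2 (hs i _ hpb).2 t1 t2
    refine ⟨?_, hT.1.trans (by gcongr), ?_⟩
    · rw [abs_of_nonneg (by linarith [hr.1])]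
      exact hr.2.trans hle1
    · rw [ratioDot, real_inner_smul_left]
      exact hT.2.trans (by gcongr)

omit [IsProbabilityMeasure μ] in
lemma RegularStep.isUnitwise_ratioDot {G : S.Step} (hG : S.RegularStep μ G) :
    S.IsUnitwise μ fun i ω => S.ratioDot G (S.X i ω) G.star := by
  refine IsUnitwise.smul ?_ hG.isUnitwise_gradient
  refine IsUnitwise.of_X (f := fun x => ((1 - G.g x G.star) ^ 2)⁻¹) ?_
  exact ((measurable_const.sub (measurable_model hG.measurable_g _)).pow_const 2).inv

omit [IsProbabilityMeasure μ] in
lemma isUnitwise_ratio {G : S.Step} (hG : S.RegularStep μ G) :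
    S.IsUnitwise μ fun i ω => S.ratio G (S.X i ω) G.star :=
  IsUnitwise.of_X (measurable_ratio hG.measurable_g _)

section Expansions

variable (hIID : S.IID μ) {F G : S.Step} (hF : S.RegularStep μ F) (hG : S.RegularStep μ G)
  (t s : Fin T) (e : RVec dE) (j : ℕ)

omit [IsProbabilityMeasure μ] in
lemma integrable_smul_of_bound {k : ℕ} {b : Ω → ℝ} {f : Ω → RVec k} (hb : Integrable b μ)
    (hf : AEStronglyMeasurable f μ) {C : ℝ} (hC : ∀ᵐ ω ∂μ, ‖f ω‖ ≤ C) :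
    Integrable (fun ω => b ω • f ω) μ := by
  refine (hb.norm.mul_const C).mono' (hb.aestronglyMeasurable.smul hf) ?_
  filter_upwards [hC] with ω hω
  rw [norm_smul]
  gcongr

include hIID hF hG

/-- No estimated parameter enters, so both gradients and the remainder are zero; the general
expansion is used to get the same format for all four means. -/
lemma expansion_mean_M :
    AsympLinear μ (fun p : ℕ × Ω => sampleMean p.1 fun i => S.M i t s e p.2)
        (∫ ω, S.M j t s e ω ∂μ) (fun i ω => S.M i t s e ω - ∫ ω', S.M j t s e ω' ∂μ) ∧
      BoundedInProb μ (normSum fun i ω => S.M i t s e ω - ∫ ω', S.M j t s e ω' ∂μ) ∧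
      ∀ i, Integrable (fun ω => S.M i t s e ω - ∫ ω', S.M j t s e ω' ∂μ) μ ∧
        ∫ ω, (S.M i t s e ω - ∫ ω', S.M j t s e ω' ∂μ) ∂μ = 0 := by
  refine asympLinear_twoStep hIID hF hG (h := fun i p => S.M i t s e p.2)
    (D₁ := fun _ _ => 0) (D₂ := fun _ _ => 0) (K := fun _ _ => 0) (d₁ := 0) (d₂ := 0)
    (isUnitwise_M t s e) (fun i => memLp_M) (IsUnitwise.const _) (fun i => integrable_zero _ _ _)
    (IsUnitwise.const _) (fun i => integrable_zero _ _ _)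
    (IsUnitwise.const _) (fun i => integrable_zero _ _ _)
    (Eventually.of_forall fun p i => by simp) j rfl (by simp) (by simp) (fun i ω => by simp)

/-- The residual has derivative -ṁ in γ, whence the sign of the first-step term; M ≤ 1 leaves the
model's constant C as remainder coefficient. Quantifying over φ with an equation names the long
influence function once. -/
lemma expansion_mean_M_mul_resid
    (hMR : ∀ i, MemLp (fun ω => S.M i t s e ω * S.resid F i t s F.star ω) 2 μ) :
    ∀ φ : ℕ → Ω → ℝ, (φ = fun i ω => S.M i t s e ω * S.resid F i t s F.star ω -
        (∫ ω', S.M j t s e ω' * S.resid F j t s F.star ω' ∂μ) -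
        inner ℝ (∫ ω', S.M j t s e ω' • gradient (F.g (S.X j ω')) F.star ∂μ)
          (F.infl (S.obs i ω) F.star)) →
    AsympLinear μ (fun p : ℕ × Ω => sampleMean p.1 fun i =>
        S.M i t s e p.2 * (S.dY i t s p.2 - F.g (S.X i p.2) (F.est p.1 p.2)))
        (∫ ω, S.M j t s e ω * S.resid F j t s F.star ω ∂μ) φ ∧
      BoundedInProb μ (normSum φ) ∧ ∀ i, Integrable (φ i) μ ∧ ∫ ω, φ i ω ∂μ = 0 := by
  rintro φ rfl
  obtain ⟨C, hC, hgrad, hexp⟩ := hF.exists_eventually_expansion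
  have hMu : S.IsUnitwise μ fun i => S.M i t s e := isUnitwise_M t s e
  refine asympLinear_twoStep hIID hF hG
    (h := fun i p => S.M i t s e p.2 * (S.dY i t s p.2 - F.g (S.X i p.2) (F.est p.1 p.2)))
    (D₁ := fun i ω => (-S.M i t s e ω) • gradient (F.g (S.X i ω)) F.star)
    (D₂ := fun _ _ => 0) (K := fun _ _ => C)
    (d₁ := -∫ ω', S.M j t s e ω' • gradient (F.g (S.X j ω')) F.star ∂μ) (d₂ := 0)
    (hMu.mul (isUnitwise_resid hF.measurable_g t s _)) hMR
    (IsUnitwise.const _) (fun i => integrable_const _)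
    ((hMu.comp measurable_neg).smul hF.isUnitwise_gradient)
    (fun i => integrable_smul_of_bound (S.integrable_M i t s e).neg
      (hF.isUnitwise_gradient.aemeasurable i).aestronglyMeasurable (hgrad.mono fun ω h => h i))
    (IsUnitwise.const _) (fun i => integrable_zero _ _ _) ?_ j rfl ?_ (by simp) (fun i ω => ?_)
  · filter_upwards [hexp] with p hp i
    obtain ⟨-, h⟩ := hp i
    have hm := S.norm_M_le_one i t s e p.2
    rw [inner_zero_left, sub_zero, real_inner_smul_left, resid]
    set δ := F.est p.1 p.2 - F.star
    have : S.M i t s e p.2 * (S.dY i t s p.2 - F.g (S.X i p.2) (F.est p.1 p.2)) -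
        S.M i t s e p.2 * (S.dY i t s p.2 - F.g (S.X i p.2) F.star) -
        -S.M i t s e p.2 * inner ℝ (gradient (F.g (S.X i p.2)) F.star) δ =
        -S.M i t s e p.2 * (F.g (S.X i p.2) (F.est p.1 p.2) - F.g (S.X i p.2) F.star -
          inner ℝ (gradient (F.g (S.X i p.2)) F.star) δ) := by ring
    rw [this, abs_mul, abs_neg]
    calc _ ≤ 1 * (C * ‖δ‖ ^ 2) := mul_le_mul hm h (abs_nonneg _) zero_le_one
      _ ≤ _ := by
        rw [one_mul]
        gcongr
        exact le_add_of_nonneg_right (sq_nonneg _)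
  · simp_rw [neg_smul]
    exact integral_neg _
  · rw [inner_neg_left, inner_zero_left]
    ring

lemma expansion_mean_ratio_mul_St (hB : S.BoundedScore μ G) :
    ∀ φ : ℕ → Ω → ℝ, (φ = fun i ω => S.ratio G (S.X i ω) G.star * S.St i t s ω -
        (∫ ω', S.ratio G (S.X j ω') G.star * S.St j t s ω' ∂μ) +
        inner ℝ (∫ ω', S.St j t s ω' • S.ratioDot G (S.X j ω') G.star ∂μ)
          (G.infl (S.obs i ω) G.star)) →
    AsympLinear μ (fun p : ℕ × Ω => sampleMean p.1 fun i =>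
        S.ratio G (S.X i p.2) (G.est p.1 p.2) * S.St i t s p.2)
        (∫ ω, S.ratio G (S.X j ω) G.star * S.St j t s ω ∂μ) φ ∧
      BoundedInProb μ (normSum φ) ∧ ∀ i, Integrable (φ i) μ ∧ ∫ ω, φ i ω ∂μ = 0 := by
  rintro φ rfl
  obtain ⟨ε, C, hε, hC, hae, hexp⟩ := hG.exists_ratio_expansion hB
  have hSu : S.IsUnitwise μ fun i => S.St i t s := isUnitwise_M t s 0
  have hrS : ∀ i, MemLp (fun ω => S.ratio G (S.X i ω) G.star * S.St i t s ω) 2 μ := fun i => by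
    refine memLp_bdd_mul (memLp_M (S := S) (e := 0))
      ((isUnitwise_ratio hG).aemeasurable i).aestronglyMeasurable (c := 1 / ε) ?_
    filter_upwards [hae] with ω hω
    have := ratio_bounds hε (hω i).1
    rw [Real.norm_of_nonneg (by linarith)]
    exact this.2
  refine asympLinear_twoStep hIID hF hG
    (h := fun i p => S.ratio G (S.X i p.2) (G.est p.1 p.2) * S.St i t s p.2)
    (D₁ := fun _ _ => 0)
    (D₂ := fun i ω => S.St i t s ω • S.ratioDot G (S.X i ω) G.star) (K := fun _ _ => C)
    (d₁ := 0)
    ((isUnitwise_ratio hG).mul hSu) hrS (IsUnitwise.const _) (fun i => integrable_const _)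
    (IsUnitwise.const _) (fun i => integrable_zero _ _ _)
    (hSu.smul hG.isUnitwise_ratioDot)
    (fun i => integrable_smul_of_bound (S.integrable_M i t s 0)
      (hG.isUnitwise_ratioDot.aemeasurable i).aestronglyMeasurable
      (hae.mono fun ω h => (h i).2))
    ?_ j rfl (by simp) rfl (fun i ω => ?_)
  · filter_upwards [hexp] with p hp i
    obtain ⟨-, -, h⟩ := hp i
    have hm : ‖S.St i t s p.2‖ ≤ 1 := S.norm_M_le_one i t s 0 p.2
    rw [inner_zero_left, sub_zero, real_inner_smul_left]
    set δ := G.est p.1 p.2 - G.star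
    have : S.ratio G (S.X i p.2) (G.est p.1 p.2) * S.St i t s p.2 -
        S.ratio G (S.X i p.2) G.star * S.St i t s p.2 -
        S.St i t s p.2 * inner ℝ (S.ratioDot G (S.X i p.2) G.star) δ =
        S.St i t s p.2 * (S.ratio G (S.X i p.2) (G.est p.1 p.2) - S.ratio G (S.X i p.2) G.star -
          inner ℝ (S.ratioDot G (S.X i p.2) G.star) δ) := by ring
    rw [this, abs_mul]
    calc _ ≤ 1 * (C * ‖δ‖ ^ 2) := mul_le_mul hm h (abs_nonneg _) zero_le_one
      _ ≤ _ := by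
        rw [one_mul]
        gcongr
        exact le_add_of_nonneg_left (sq_nonneg _)
  · rw [inner_zero_left]
    ring

lemma expansion_mean_ratio_mul_St_mul_resid (hB : S.BoundedScore μ G)
    (hSR : ∀ i, MemLp (fun ω => S.St i t s ω * S.resid F i t s F.star ω) 2 μ) :
    ∀ φ : ℕ → Ω → ℝ, (φ = fun i ω =>
        S.ratio G (S.X i ω) G.star * (S.St i t s ω * S.resid F i t s F.star ω) -
        (∫ ω', S.ratio G (S.X j ω') G.star * (S.St j t s ω' * S.resid F j t s F.star ω') ∂μ) -
        inner ℝ (∫ ω', (S.ratio G (S.X j ω') G.star * S.St j t s ω') •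
          gradient (F.g (S.X j ω')) F.star ∂μ) (F.infl (S.obs i ω) F.star) +
        inner ℝ (∫ ω', (S.St j t s ω' * S.resid F j t s F.star ω') •
          S.ratioDot G (S.X j ω') G.star ∂μ) (G.infl (S.obs i ω) G.star)) →
    AsympLinear μ (fun p : ℕ × Ω => sampleMean p.1 fun i =>
        S.ratio G (S.X i p.2) (G.est p.1 p.2) * S.St i t s p.2 *
          (S.dY i t s p.2 - F.g (S.X i p.2) (F.est p.1 p.2)))
        (∫ ω, S.ratio G (S.X j ω) G.star * (S.St j t s ω * S.resid F j t s F.star ω) ∂μ) φ ∧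
      BoundedInProb μ (normSum φ) ∧ ∀ i, Integrable (φ i) μ ∧ ∫ ω, φ i ω ∂μ = 0 := by
  rintro φ rfl
  obtain ⟨ε, C, hε, hC, hae, hexp⟩ := hG.exists_ratio_expansion hB
  obtain ⟨C', hC', hgrad, hexp'⟩ := hF.exists_eventually_expansion
  have hSu : S.IsUnitwise μ fun i => S.St i t s := isUnitwise_M t s 0
  have hru := isUnitwise_ratio hG
  have hRu : S.IsUnitwise μ fun i => S.resid F i t s F.star := isUnitwise_resid hF.measurable_g t s _
  have hrb : ∀ i, ∀ᵐ ω ∂μ, ‖S.ratio G (S.X i ω) G.star‖ ≤ 1 / ε := fun i => by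
    filter_upwards [hae] with ω hω
    have := ratio_bounds hε (hω i).1
    rw [Real.norm_of_nonneg (by linarith)]
    exact this.2
  have hSRi : ∀ i, Integrable (fun ω => S.St i t s ω * S.resid F i t s F.star ω) μ := fun i =>
    (hSR i).integrable (by norm_num)
  have hSi : ∀ i, Integrable (S.St i t s) μ := fun i => S.integrable_M i t s 0
  refine asympLinear_twoStep hIID hF hG
    (h := fun i p => S.ratio G (S.X i p.2) (G.est p.1 p.2) * S.St i t s p.2 *
      (S.dY i t s p.2 - F.g (S.X i p.2) (F.est p.1 p.2)))
    (D₁ := fun i ω => (-(S.ratio G (S.X i ω) G.star * S.St i t s ω)) •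
      gradient (F.g (S.X i ω)) F.star)
    (D₂ := fun i ω => (S.St i t s ω * S.resid F i t s F.star ω) •
      S.ratioDot G (S.X i ω) G.star)
    -- The first term comes from the curvature of r, multiplied by the residual. Of the two copies
    -- of C C', one covers the curvature of m and one the cross term of the two estimation errors.
    (K := fun i ω => C * ‖S.St i t s ω * S.resid F i t s F.star ω‖ + 2 * C * C')
    (d₁ := -∫ ω', (S.ratio G (S.X j ω') G.star * S.St j t s ω') •
      gradient (F.g (S.X j ω')) F.star ∂μ)
    (hru.mul (hSu.mul hRu))
    (fun i => memLp_bdd_mul (hSR i) (hru.aemeasurable i).aestronglyMeasurable (hrb i))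
    (((IsUnitwise.const C).mul ((hSu.mul hRu).comp measurable_norm)).add (IsUnitwise.const _))
    (fun i => ((hSRi i).norm.const_mul C).add (integrable_const _))
    (((hru.mul hSu).comp measurable_neg).smul hF.isUnitwise_gradient)
    (fun i => integrable_smul_of_bound
      ((hSi i).bdd_mul (hru.aemeasurable i).aestronglyMeasurable (hrb i)).neg
      (hF.isUnitwise_gradient.aemeasurable i).aestronglyMeasurable (hgrad.mono fun ω h => h i))
    ((hSu.mul hRu).smul hG.isUnitwise_ratioDot)
    (fun i => integrable_smul_of_bound (hSRi i)
      (hG.isUnitwise_ratioDot.aemeasurable i).aestronglyMeasurable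
      (hae.mono fun ω h => (h i).2))
    ?_ j rfl ?_ rfl (fun i ω => ?_)
  · filter_upwards [hexp, hexp'] with p hp hp' i
    obtain ⟨b1, b2, b3⟩ := hp i
    obtain ⟨c1, c2⟩ := hp' i
    have hm : |S.St i t s p.2| ≤ 1 := S.norm_M_le_one i t s 0 p.2
    rw [real_inner_smul_left, real_inner_smul_left]
    have hdelta : S.dY i t s p.2 - F.g (S.X i p.2) (F.est p.1 p.2) =
        S.resid F i t s F.star p.2 -
          (F.g (S.X i p.2) (F.est p.1 p.2) - F.g (S.X i p.2) F.star) := by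
      rw [resid]; ring
    rw [hdelta]
    have hin : |inner ℝ (gradient (F.g (S.X i p.2)) F.star) (F.est p.1 p.2 - F.star)| ≤
        C' * ‖F.est p.1 p.2 - F.star‖ :=
      (abs_real_inner_le_norm _ _).trans (by gcongr)
    rw [Real.norm_eq_abs]
    generalize F.g (S.X i p.2) (F.est p.1 p.2) - F.g (S.X i p.2) F.star = dg at *
    generalize inner ℝ (gradient (F.g (S.X i p.2)) F.star) (F.est p.1 p.2 - F.star) = u at *
    generalize inner ℝ (S.ratioDot G (S.X i p.2) G.star) (G.est p.1 p.2 - G.star) = v at *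
    generalize S.ratio G (S.X i p.2) (G.est p.1 p.2) = r' at *
    generalize S.ratio G (S.X i p.2) G.star = r at *
    generalize S.St i t s p.2 = m at *
    generalize S.resid F i t s F.star p.2 = R at *
    have hx := norm_nonneg (F.est p.1 p.2 - F.star)
    have hy := norm_nonneg (G.est p.1 p.2 - G.star)
    generalize ‖F.est p.1 p.2 - F.star‖ = x at *
    generalize ‖G.est p.1 p.2 - G.star‖ = y at *
    -- The remainder of a product: curvature of r against the residual, curvature of m against the
    -- estimated ratio, and the product of the two first-order changes.
    have hid : r' * m * (R - dg) - r * (m * R) - -(r * m) * u - m * R * v =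
        (r' - r - v) * (m * R) - m * (r' * (dg - u)) - m * ((r' - r) * u) := by ring
    rw [hid]
    have k1 : |(r' - r - v) * (m * R)| ≤ C * y ^ 2 * |m * R| := by
      rw [abs_mul]; gcongr
    have k2 : |m * (r' * (dg - u))| ≤ C * (C' * x ^ 2) := by
      rw [abs_mul, abs_mul]
      calc |m| * (|r'| * |dg - u|) ≤ 1 * (C * (C' * x ^ 2)) := by gcongr
        _ = _ := one_mul _
    have k3 : |m * ((r' - r) * u)| ≤ (C * y) * (C' * x) := by
      rw [abs_mul, abs_mul]
      calc |m| * (|r' - r| * |u|) ≤ 1 * ((C * y) * (C' * x)) := by gcongr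
        _ = _ := one_mul _
    have k4 : C * C' * (y * x) ≤ C * C' * (x ^ 2 + y ^ 2) := by
      gcongr
      nlinarith [sq_nonneg (x - y), sq_nonneg x, sq_nonneg y]
    have k5 : 0 ≤ C * C' * y ^ 2 := by positivity
    have k6 : 0 ≤ C * |m * R| * x ^ 2 := by positivity
    have k7 := abs_sub ((r' - r - v) * (m * R) - m * (r' * (dg - u))) (m * ((r' - r) * u))
    have k8 := abs_sub ((r' - r - v) * (m * R)) (m * (r' * (dg - u)))
    nlinarith
  · simp_rw [neg_smul]
    exact integral_neg _
  · rw [inner_neg_left]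
    ring

end Expansions

end PanelSetup

namespace PanelSetup

variable {Ω : Type*} [MeasurableSpace Ω] {T dD dX dE dEs : ℕ}
variable {S : PanelSetup Ω T dD dX dE dEs} {μ : Measure Ω}

/-! ### The influence function and asymptotic linearity of the estimator -/

/-- The two normalizing means do not depend on the summation index and come out of the outer mean.
This also holds if one of them is zero, by the convention for division by zero. -/
lemma atemHat_eq (F G : S.Step) (t s : Fin T) (e : RVec dE) (N : ℕ) (ω : Ω) :
    S.atemHat F G t s e N ω =
      sampleMean N (fun i =>
        S.M i t s e ω * (S.dY i t s ω - F.g (S.X i ω) (F.est N ω))) /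
          sampleMean N (fun i => S.M i t s e ω) -
      sampleMean N (fun i => S.ratio G (S.X i ω) (G.est N ω) * S.St i t s ω *
        (S.dY i t s ω - F.g (S.X i ω) (F.est N ω))) /
          sampleMean N (fun i => S.ratio G (S.X i ω) (G.est N ω) * S.St i t s ω) := by
  rw [atemHat]
  generalize sampleMean N (fun i => S.M i t s e ω) = a
  generalize sampleMean N (fun i => S.ratio G (S.X i ω) (G.est N ω) * S.St i t s ω) = b
  simp only [sampleMean, sub_mul, Finset.sum_sub_distrib, div_mul_eq_mul_div, ← Finset.sum_div]
  ring

lemma measurable_atemHat {F G : S.Step} (hF : S.RegularStep μ F) (hG : S.RegularStep μ G)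
    (t s : Fin T) (e : RVec dE) (N : ℕ) : Measurable (S.atemHat F G t s e N) := by
  have hg : ∀ i, Measurable fun ω => F.g (S.X i ω) (F.est N ω) := fun i =>
    hF.measurable_g.comp ((S.measurable_X i).prodMk (hF.measurable_est N))
  have hp : ∀ i, Measurable fun ω => G.g (S.X i ω) (G.est N ω) := fun i =>
    hG.measurable_g.comp ((S.measurable_X i).prodMk (hG.measurable_est N))
  have hr : ∀ i, Measurable fun ω => S.ratio G (S.X i ω) (G.est N ω) * S.St i t s ω := fun i =>
    ((hp i).div (measurable_const.sub (hp i))).mul (S.measurable_M i t s 0)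
  have hmean : ∀ {f : ℕ → Ω → ℝ}, (∀ i, Measurable (f i)) →
      Measurable fun ω => sampleMean N fun i => f i ω := fun hf =>
    (Finset.measurable_fun_sum _ fun i _ => hf i).const_mul _
  have hM := fun i => S.measurable_M i t s e
  exact hmean fun i => (((hM i).div (hmean hM)).sub ((hr i).div (hmean hr))).mul
    ((S.measurable_dY i t s).sub (hg i))

/-- The influence function in terms of those of the four sample means, with all population
quantities written for unit `j`. -/
lemma psiStar_eq (hIID : S.IID μ) {F G : S.Step} (hF : S.RegularStep μ F)
    (hG : S.RegularStep μ G) (t s : Fin T) (e : RVec dE)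
    (hMD : ∀ i, Integrable (fun ω => S.M i t s e ω • gradient (F.g (S.X i ω)) F.star) μ)
    (hSD : ∀ i, Integrable (fun ω => (S.ratio G (S.X i ω) G.star * S.St i t s ω) •
      gradient (F.g (S.X i ω)) F.star) μ) (j : ℕ)
    {a₁ a₂ a₃ a₄ : ℝ} {v₁ v₃ : RVec F.dim} {w₃ w₄ : RVec G.dim}
    (ha₁ : ∫ ω, S.M j t s e ω * S.resid F j t s F.star ω ∂μ = a₁)
    (ha₂ : ∫ ω, S.M j t s e ω ∂μ = a₂)
    (ha₃ : ∫ ω, S.ratio G (S.X j ω) G.star * (S.St j t s ω * S.resid F j t s F.star ω) ∂μ = a₃)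
    (ha₄ : ∫ ω, S.ratio G (S.X j ω) G.star * S.St j t s ω ∂μ = a₄)
    (hv₁ : ∫ ω, S.M j t s e ω • gradient (F.g (S.X j ω)) F.star ∂μ = v₁)
    (hv₃ : ∫ ω, (S.ratio G (S.X j ω) G.star * S.St j t s ω) •
      gradient (F.g (S.X j ω)) F.star ∂μ = v₃)
    (hw₃ : ∫ ω, (S.St j t s ω * S.resid F j t s F.star ω) •
      S.ratioDot G (S.X j ω) G.star ∂μ = w₃)
    (hw₄ : ∫ ω, S.St j t s ω • S.ratioDot G (S.X j ω) G.star ∂μ = w₄)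
    (h2 : a₂ ≠ 0) (h4 : a₄ ≠ 0) (i : ℕ) (ω : Ω) :
    S.psiStar μ F G i t s e ω =
      a₂⁻¹ * ((S.M i t s e ω * S.resid F i t s F.star ω - a₁ -
        inner ℝ v₁ (F.infl (S.obs i ω) F.star)) - a₁ / a₂ * (S.M i t s e ω - a₂)) -
      a₄⁻¹ * ((S.ratio G (S.X i ω) G.star * (S.St i t s ω * S.resid F i t s F.star ω) - a₃ -
        inner ℝ v₃ (F.infl (S.obs i ω) F.star) + inner ℝ w₃ (G.infl (S.obs i ω) G.star)) -
        a₃ / a₄ * (S.ratio G (S.X i ω) G.star * S.St i t s ω - a₄ +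
          inner ℝ w₄ (G.infl (S.obs i ω) G.star))) := by
  have hMu : S.IsUnitwise μ fun i => S.M i t s e := isUnitwise_M t s e
  have hSu : S.IsUnitwise μ fun i => S.St i t s := isUnitwise_M t s 0
  have hRu : S.IsUnitwise μ fun i => S.resid F i t s F.star := isUnitwise_resid hF.measurable_g t s _
  have hru := isUnitwise_ratio hG
  have hgu := hF.isUnitwise_gradient
  have hdu := hG.isUnitwise_ratioDot
  -- The expectations inside ψ for unit i are taken at unit i; identical distribution moves those of
  -- unit j there.
  rw [(hMu.mul hRu).integral_eq hIID j i] at ha₁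
  rw [hMu.integral_eq hIID j i] at ha₂
  rw [(hru.mul (hSu.mul hRu)).integral_eq hIID j i] at ha₃
  rw [(hru.mul hSu).integral_eq hIID j i] at ha₄
  rw [(hMu.smul hgu).integral_eq hIID j i] at hv₁
  rw [((hru.mul hSu).smul hgu).integral_eq hIID j i] at hv₃
  rw [((hSu.mul hRu).smul hdu).integral_eq hIID j i] at hw₃
  rw [(hSu.smul hdu).integral_eq hIID j i] at hw₄
  have c1 : ∫ ω', S.wM μ i t s e ω' * S.resid F i t s F.star ω' ∂μ = a₁ / a₂ := by
    simp only [wM, ha₂, div_mul_eq_mul_div]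
    rw [integral_div, ha₁]
  have c3 : ∫ ω', S.wS μ G i t s G.star ω' * S.resid F i t s F.star ω' ∂μ = a₃ / a₄ := by
    simp only [wS, ha₄, div_mul_eq_mul_div, mul_assoc]
    rw [integral_div, ha₃]
  have i1 : Integrable (fun ω => a₂⁻¹ • S.M i t s e ω • gradient (F.g (S.X i ω)) F.star) μ :=
    (hMD i).smul a₂⁻¹
  have i3 : Integrable (fun ω => a₄⁻¹ • (S.ratio G (S.X i ω) G.star * S.St i t s ω) •
      gradient (F.g (S.X i ω)) F.star) μ := (hSD i).smul a₄⁻¹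
  have m1 : S.M1 μ F G i t s e F.star G.star = a₂⁻¹ • v₁ - a₄⁻¹ • v₃ := by
    rw [M1, ← hv₁, ← hv₃, ← integral_smul, ← integral_smul,
      ← integral_sub i1 i3]
    refine integral_congr_ae (ae_of_all _ fun ω => ?_)
    simp only [wM, wS, ha₂, ha₄, smul_smul, sub_smul, div_eq_inv_mul]
  have m2 : S.M2 μ F G i t s F.star G.star = a₄⁻¹ • w₃ - (a₃ / a₄) • (a₄⁻¹ • w₄) := by
    rw [M2, c3, ← hw₃, ← hw₄, ← integral_smul a₄⁻¹, ← integral_smul a₄⁻¹]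
    congr 1
    · refine integral_congr_ae (ae_of_all _ fun ω => ?_)
      simp only [wSDot, ha₄, smul_smul, div_eq_inv_mul]
      ring_nf
    · congr 1
      refine integral_congr_ae (ae_of_all _ fun ω => ?_)
      simp only [wSDot, ha₄, smul_smul, div_eq_inv_mul]
  simp only [psiStar, psi, psiM, psiS, psiEst, c1, c3, m1, m2, inner_sub_right,
    real_inner_smul_right]
  simp only [wM, wS, ha₂, ha₄]
  rw [real_inner_comm v₁, real_inner_comm v₃, real_inner_comm w₃, real_inner_comm w₄]
  field_simp
  ring

/-- The expectations inside ψ are formally indexed by the unit. Replacing them by those of unit 0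
exhibits one function of the data for all units, which transfers independence and identical
distribution to ψ. -/
lemma isUnitwise_psiStar (hIID : S.IID μ) {F G : S.Step} (hF : S.RegularStep μ F)
    (hG : S.RegularStep μ G) (t s : Fin T) (e : RVec dE) :
    S.IsUnitwise μ fun i => S.psiStar μ F G i t s e := by
  have hMu : S.IsUnitwise μ fun i => S.M i t s e := isUnitwise_M t s e
  have hSu : S.IsUnitwise μ fun i => S.St i t s := isUnitwise_M t s 0
  have hRu : S.IsUnitwise μ fun i => S.resid F i t s F.star := isUnitwise_resid hF.measurable_g t s _
  have hru := isUnitwise_ratio hG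
  have hgu := hF.isUnitwise_gradient
  have hdu := hG.isUnitwise_ratioDot
  have hwM : S.IsUnitwise μ fun i => S.wM μ i t s e := by
    refine (hMu.mul (IsUnitwise.const (∫ ω, S.M 0 t s e ω ∂μ)⁻¹)).congr fun i =>
      ae_of_all _ fun ω => ?_
    simp only [wM]
    rw [hMu.integral_eq hIID i 0, div_eq_mul_inv]
  have hwS : S.IsUnitwise μ fun i => S.wS μ G i t s G.star := by
    refine ((hru.mul hSu).mul (IsUnitwise.const
      (∫ ω, S.ratio G (S.X 0 ω) G.star * S.St 0 t s ω ∂μ)⁻¹)).congr fun i =>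
      ae_of_all _ fun ω => ?_
    simp only [wS]
    rw [(hru.mul hSu).integral_eq hIID i 0, div_eq_mul_inv]
  have hwD : S.IsUnitwise μ fun i => S.wSDot μ G i t s G.star := by
    refine ((hSu.mul (IsUnitwise.const
      (∫ ω, S.ratio G (S.X 0 ω) G.star * S.St 0 t s ω ∂μ)⁻¹)).smul hdu).congr fun i =>
      ae_of_all _ fun ω => ?_
    simp only [wSDot]
    rw [(hru.mul hSu).integral_eq hIID i 0, div_eq_mul_inv]
  have hM1 : ∀ i, S.M1 μ F G i t s e F.star G.star = S.M1 μ F G 0 t s e F.star G.star := fun i =>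
    ((hwM.sub hwS).smul hgu).integral_eq hIID i 0
  have hM2 : ∀ i, S.M2 μ F G i t s F.star G.star = S.M2 μ F G 0 t s F.star G.star := fun i => by
    simp only [M2]
    rw [(hRu.smul hwD).integral_eq hIID i 0, (hwS.mul hRu).integral_eq hIID i 0,
      hwD.integral_eq hIID i 0]
  have hEst : S.IsUnitwise μ fun i => S.psiEst μ F G i t s e F.star G.star := by
    refine ((hF.isUnitwise_infl.comp (u := fun v => inner ℝ v (S.M1 μ F G 0 t s e F.star G.star))
      (by fun_prop)).add (hG.isUnitwise_infl.comp
        (u := fun v => inner ℝ v (S.M2 μ F G 0 t s F.star G.star)) (by fun_prop))).congr fun i =>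
      ae_of_all _ fun ω => ?_
    simp only [psiEst, hM1 i, hM2 i]
  refine (((hwM.mul hRu).sub (hwM.mul (IsUnitwise.const
    (∫ ω, S.wM μ 0 t s e ω * S.resid F 0 t s F.star ω ∂μ)))).sub
    ((hwS.mul hRu).sub (hwS.mul (IsUnitwise.const
    (∫ ω, S.wS μ G 0 t s G.star ω * S.resid F 0 t s F.star ω ∂μ))))).sub hEst |>.congr
    fun i => ae_of_all _ fun ω => ?_
  simp only [psiStar, psi, psiM, psiS]
  rw [(hwM.mul hRu).integral_eq hIID i 0, (hwS.mul hRu).integral_eq hIID i 0]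

lemma integral_linear_combination_eq_zero {f g : Ω → ℝ}
    (hf : Integrable f μ ∧ ∫ ω, f ω ∂μ = 0) (hg : Integrable g μ ∧ ∫ ω, g ω ∂μ = 0) (b c : ℝ) :
    Integrable (fun ω => b * (f ω - c * g ω)) μ ∧ ∫ ω, b * (f ω - c * g ω) ∂μ = 0 := by
  refine ⟨(hf.1.sub (hg.1.const_mul c)).const_mul b, ?_⟩
  rw [integral_const_mul, integral_sub hf.1 (hg.1.const_mul c), integral_const_mul, hf.2, hg.2]
  ring

/-- Asymptotic linearity of the doubly robust estimator, with a centred influence function. -/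
theorem asympLinear_atemHat [IsProbabilityMeasure μ]
    (hTrue : ∀ t, S.IsTrue t (S.effStar t)) (hEff : S.EffectiveTreatment)
    (hPar : S.ParallelTrends μ) (hIID : S.IID μ) {t s : Fin T} {e : RVec dE} (hst : s < t)
    (he : e ≠ 0) (hOverlap : S.Overlap μ t s e) {F G : S.Step}
    (hModel : S.CorrectModel μ F (fun i => S.orFun μ i t s) ∨
      S.CorrectModel μ G (fun i => S.gps μ i t s e))
    (hF : S.RegularStep μ F) (hG : S.RegularStep μ G) (hScore : S.BoundedScore μ G)
    (hdY : ∀ i, MemLp (S.dY i t s) 2 μ) (hpsi : ∀ i, MemLp (S.psiStar μ F G i t s e) 2 μ)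
    (j : ℕ) :
    AsympLinear μ (fun p : ℕ × Ω => S.atemHat F G t s e p.1 p.2) (S.atem μ j t s e)
        (fun i => S.psiStar μ F G i t s e) ∧
      ∀ i, ∫ ω, S.psiStar μ F G i t s e ω ∂μ = 0 := by
  obtain ⟨ε, hε, hsc⟩ := hScore
  have hsc' : ∀ i, ∀ᵐ ω ∂μ, ε ≤ G.g (S.X i ω) G.star ∧ G.g (S.X i ω) G.star ≤ 1 - ε :=
    hsc _ hG.star_mem
  obtain ⟨η, hη, hov⟩ := hOverlap
  have hSpos : ∀ i, 0 < ∫ ω, S.ratio G (S.X i ω) G.star * S.St i t s ω ∂μ := fun i =>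
    integral_ratio_St_pos hG.measurable_g hε (hsc' i)
      (hη.trans_le (integral_St_ge ((hov i).mono fun ω h => h.1.1)))
  have hMpos : ∀ i, 0 < ∫ ω, S.M i t s e ω ∂μ := fun i =>
    integral_M_pos he hη ((hov i).mono fun ω h => h.1.1) ((hov i).mono fun ω h => h.2)
  -- The moment assumption on ψ supplies the moments of the residual on movers and on stayers.
  have hMR := fun i => memLp_M_mul_resid hF hG he (hpsi i) (hMpos i).ne'
  have hSR := fun i => memLp_St_mul_resid hF hG he (hpsi i) (hSpos i).ne' hε (hsc' i)
  obtain ⟨C, -, hgrad, -⟩ := hF.exists_eventually_expansion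
  have hgm := fun i => (hF.isUnitwise_gradient.aemeasurable i).aestronglyMeasurable
  have hMD : ∀ i, Integrable (fun ω => S.M i t s e ω • gradient (F.g (S.X i ω)) F.star) μ :=
    fun i => integrable_smul_of_bound (S.integrable_M i t s e) (hgm i) (hgrad.mono fun ω h => h i)
  have hSD : ∀ i, Integrable (fun ω => (S.ratio G (S.X i ω) G.star * S.St i t s ω) •
      gradient (F.g (S.X i ω)) F.star) μ := fun i => by
    have hSi : Integrable (S.St i t s) μ := S.integrable_M i t s 0
    refine integrable_smul_of_bound (hSi.bdd_mul (c := 1 / ε)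
      ((isUnitwise_ratio hG).aemeasurable i).aestronglyMeasurable ?_) (hgm i)
      (hgrad.mono fun ω h => h i)
    filter_upwards [hsc' i] with ω hω
    have := ratio_bounds hε hω
    rw [Real.norm_of_nonneg (by linarith)]
    exact this.2
  obtain ⟨A1, B1, Z1⟩ := expansion_mean_M_mul_resid hIID hF hG t s e j hMR _ rfl
  obtain ⟨A2, B2, Z2⟩ := expansion_mean_M hIID hF hG t s e j
  obtain ⟨A3, B3, Z3⟩ := expansion_mean_ratio_mul_St_mul_resid hIID hF hG t s j ⟨ε, hε, hsc⟩
    hSR _ rfl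
  obtain ⟨A4, B4, Z4⟩ := expansion_mean_ratio_mul_St hIID hF hG t s j ⟨ε, hε, hsc⟩ _ rfl
  have hψ := psiStar_eq hIID hF hG t s e hMD hSD j rfl rfl rfl rfl rfl rfl rfl rfl
    (hMpos j).ne' (hSpos j).ne'
  refine ⟨?_, fun i => ?_⟩
  -- The delta method for each quotient; double robustness then identifies the centring constant as
  -- the ATEM.
  · have h := (A1.div A2 (hMpos j).ne' B1 B2).sub (A3.div A4 (hSpos j).ne' B3 B4)
    rw [← atem_eq_doublyRobust hTrue hEff hPar hst he ⟨η, hη, hov⟩ hF.measurable_g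
      hG.measurable_g hModel hε (hsc' j) ((hdY j).integrable (by norm_num))
      ((hMR j).integrable (by norm_num)) ((hSR j).integrable (by norm_num))] at h
    simp only [← atemHat_eq] at h
    exact h.congr_influence fun i => funext fun ω => (hψ i ω).symm
  -- ψ is a linear combination of the four influence functions, each of mean zero.
  · obtain ⟨k1, z1⟩ := integral_linear_combination_eq_zero (Z1 i) (Z2 i) (∫ ω, S.M j t s e ω ∂μ)⁻¹
      ((∫ ω, S.M j t s e ω * S.resid F j t s F.star ω ∂μ) / ∫ ω, S.M j t s e ω ∂μ)
    obtain ⟨k3, z3⟩ := integral_linear_combination_eq_zero (Z3 i) (Z4 i)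
      (∫ ω, S.ratio G (S.X j ω) G.star * S.St j t s ω ∂μ)⁻¹
      ((∫ ω, S.ratio G (S.X j ω) G.star * (S.St j t s ω * S.resid F j t s F.star ω) ∂μ) /
        ∫ ω, S.ratio G (S.X j ω) G.star * S.St j t s ω ∂μ)
    simp_rw [hψ i]
    have h := integral_sub k1 k3
    rw [z1, z3, sub_zero] at h
    exact h

end PanelSetup

end

/-! ### The main theorem: asymptotic linearity and joint normality -/

theorem theorem5 {Ω : Type*} [MeasurableSpace Ω] (μ : Measure Ω) [IsProbabilityMeasure μ]
    {T dD dX dE dEs : ℕ} [DecidableEq (Fin T × Fin T × RVec dE)]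
    (S : PanelSetup Ω T dD dX dE dEs)
    -- the set of triples `(t, s, e)`, with `s < t` and `e` a nonzero effective treatment intensity
    (A : Finset (Fin T × Fin T × RVec dE))
    (hA : ∀ t s e, (t, s, e) ∈ A → s < t ∧ e ∈ Set.range (S.eff t) ∧ e ≠ 0)
    -- first steps: `F t s` for the outcome regression, `G t s e` for the propensity score
    (F : Fin T → Fin T → S.Step) (G : Fin T → Fin T → RVec dE → S.Step)
    -- the true effective treatment, effective treatment condition, overlap, parallel trends
    (hTrue : ∀ t, S.IsTrue t (S.effStar t))
    (hEff : S.EffectiveTreatment)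
    (hOverlap : ∀ t s e, (t, s, e) ∈ A → S.Overlap μ t s e)
    (hPar : S.ParallelTrends μ)
    -- at least one of the two parametric models is correct
    (hModel : ∀ t s e, (t, s, e) ∈ A →
      S.CorrectModel μ (F t s) (fun i => S.orFun μ i t s) ∨
      S.CorrectModel μ (G t s e) (fun i => S.gps μ i t s e))
    -- IID sampling
    (hIID : S.IID μ)
    -- first-step estimation
    (hF : ∀ t s e, (t, s, e) ∈ A → S.RegularStep μ (F t s))
    (hG : ∀ t s e, (t, s, e) ∈ A → S.RegularStep μ (G t s e))
    (hScore : ∀ t s e, (t, s, e) ∈ A → S.BoundedScore μ (G t s e))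
    -- moments
    (hdY : ∀ t s e, (t, s, e) ∈ A → ∀ i, MemLp (S.dY i t s) 2 μ)
    (hpsi : ∀ t s e, (t, s, e) ∈ A → ∀ i, MemLp (S.psiStar μ (F t s) (G t s e) i t s e) 2 μ)
    -- the unit in terms of which the population quantities are written
    (j : ℕ) :
    (∀ t s e, (t, s, e) ∈ A →
      TendstoInMeasure μ
        (fun (N : ℕ) ω =>
          √(N : ℝ) * (S.atemHat (F t s) (G t s e) t s e N ω - S.atem μ j t s e) -
            (√(N : ℝ))⁻¹ *
              ∑ i ∈ Finset.range N, S.psiStar μ (F t s) (G t s e) i t s e ω)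
        atTop (fun _ => 0)) ∧
    TendstoInDistribution
      (fun (N : ℕ) ω => (WithLp.toLp 2 fun a : A =>
        √(N : ℝ) *
          (S.atemHat (F a.1.1 a.1.2.1) (G a.1.1 a.1.2.1 a.1.2.2) a.1.1 a.1.2.1 a.1.2.2 N ω -
            S.atem μ j a.1.1 a.1.2.1 a.1.2.2) : EuclideanSpace ℝ A))
      atTop (id : EuclideanSpace ℝ A → EuclideanSpace ℝ A) (fun _ => μ)
      (multivariateGaussian 0 (Matrix.of fun a b : A =>
        ∫ ω,
          S.psiStar μ (F a.1.1 a.1.2.1) (G a.1.1 a.1.2.1 a.1.2.2) j a.1.1 a.1.2.1 a.1.2.2 ω *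
          S.psiStar μ (F b.1.1 b.1.2.1) (G b.1.1 b.1.2.1 b.1.2.2) j b.1.1 b.1.2.1 b.1.2.2 ω ∂μ)) := by
  have hlin : ∀ a : A, AsympLinear μ
      (fun p : ℕ × Ω => S.atemHat (F a.1.1 a.1.2.1) (G a.1.1 a.1.2.1 a.1.2.2) a.1.1 a.1.2.1
        a.1.2.2 p.1 p.2) (S.atem μ j a.1.1 a.1.2.1 a.1.2.2)
      (fun i => S.psiStar μ (F a.1.1 a.1.2.1) (G a.1.1 a.1.2.1 a.1.2.2) i a.1.1 a.1.2.1 a.1.2.2) ∧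
      ∀ i, ∫ ω, S.psiStar μ (F a.1.1 a.1.2.1) (G a.1.1 a.1.2.1 a.1.2.2) i a.1.1 a.1.2.1
        a.1.2.2 ω ∂μ = 0 := fun ⟨⟨t, s, e⟩, ha⟩ =>
    PanelSetup.asympLinear_atemHat hTrue hEff hPar hIID (hA t s e ha).1 (hA t s e ha).2.2
      (hOverlap t s e ha) (hModel t s e ha) (hF t s e ha) (hG t s e ha) (hScore t s e ha)
      (hdY t s e ha) (hpsi t s e ha) j
  constructor
  · intro t s e ha
    have h := (hlin ⟨(t, s, e), ha⟩).1
    simp only [AsympLinear, normSum, smul_eq_mul] at h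
    exact (tendsto_whp_iff (X := fun (N : ℕ) ω =>
      √(N : ℝ) * (S.atemHat (F t s) (G t s e) t s e N ω - S.atem μ j t s e) -
        (√(N : ℝ))⁻¹ * ∑ i ∈ Finset.range N, S.psiStar μ (F t s) (G t s e) i t s e ω)).1 h
  · set Z : ℕ → Ω → EuclideanSpace ℝ A := fun i ω => WithLp.toLp 2 fun a : A =>
      S.psiStar μ (F a.1.1 a.1.2.1) (G a.1.1 a.1.2.1 a.1.2.2) i a.1.1 a.1.2.1 a.1.2.2 ω with hZ
    -- The stacked ψ is one function of each unit's data, so the vectors are independent and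
    -- identically distributed jointly over all triples.
    have hZu : S.IsUnitwise μ Z := by
      have hu : ∀ a : A, S.IsUnitwise μ fun i => S.psiStar μ (F a.1.1 a.1.2.1)
          (G a.1.1 a.1.2.1 a.1.2.2) i a.1.1 a.1.2.1 a.1.2.2 := fun ⟨⟨t, s, e⟩, ha⟩ =>
        PanelSetup.isUnitwise_psiStar hIID (hF t s e ha) (hG t s e ha) t s e
      choose f hf hfe using hu
      refine ⟨fun w => WithLp.toLp 2 fun a => f a w,
        (WithLp.measurable_toLp 2 _).comp (measurable_pi_lambda _ hf), fun i => ?_⟩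
      filter_upwards [ae_all_iff.2 fun a => hfe a i] with ω hω
      simp only [hZ]
      congr 1
      funext a
      exact hω a
    have hZ2 : ∀ i, MemLp (Z i) 2 μ := fun i =>
      memLp_piLp_iff.2 fun a => hpsi _ _ _ a.2 i
    have hZ0 : ∀ i, ∫ ω, Z i ω ∂μ = 0 := fun i => by
      ext a
      rw [eval_integral_piLp fun a => (memLp_piLp_iff.1 (hZ2 i) a).integrable (by norm_num)]
      exact (hlin a).2 i
    have hclt := tendstoInDistribution_normSum (hZu.iIndepFun hIID)
      (fun i k => hZu.identDistrib hIID i k) hZ2 hZ0 j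
    -- Slutsky: the scaled error vector and the normalized sum of Z differ by a vector that tends to
    -- zero in probability, because each of its finitely many coordinates does.
    refine tendstoInDistribution_of_tendstoInMeasure_sub _ _ hclt ?_ fun N => ?_
    · refine tendsto_whp_iff.1 ?_
      have hcoord : ∀ a : A, Tendsto (fun p : ℕ × Ω => √(p.1 : ℝ) *
          (S.atemHat (F a.1.1 a.1.2.1) (G a.1.1 a.1.2.1 a.1.2.2) a.1.1 a.1.2.1 a.1.2.2 p.1 p.2 -
            S.atem μ j a.1.1 a.1.2.1 a.1.2.2) - normSum (fun i => S.psiStar μ (F a.1.1 a.1.2.1)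
              (G a.1.1 a.1.2.1 a.1.2.2) i a.1.1 a.1.2.1 a.1.2.2) p) (whp μ) (𝓝 0) :=
        fun a => (hlin a).1
      have h := ((PiLp.continuous_toLp 2 (fun _ : A => ℝ)).tendsto _).comp (tendsto_pi_nhds.2 hcoord)
      refine h.congr fun p => ?_
      ext a
      simp [normSum, hZ]
    · refine ((WithLp.measurable_toLp 2 _).comp (measurable_pi_lambda _ fun a => ?_)).aemeasurable
      exact ((PanelSetup.measurable_atemHat (hF _ _ _ a.2) (hG _ _ _ a.2) _ _ _ N).sub_const
        _).const_mul _
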